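/- Let $m\ge 0$ and $n\ge 3$ be integers, and let $S^n\subset\mathbb R^{n+1}$ be the round unit sphere. For a smooth map $f:\mathbb R^m\to S^n$ write $|Tf|^2=\sum_{\alpha=1}^m|\partial_\alpha f|^2$, let $\tau(f)=\operatorname{tr}\nabla Tf$ be its tension field (the projection of $\sum_\alpha\partial_\alpha\partial_\alpha f$ to the tangent space of $S^n$ at $f$), and define its entropy by $$\lambda(f)=\sup_{x_0\in\mathbb R^m,\ t_0>0}\ \frac{t_0}{2}\int_{\mathbb R^m}|Tf|^2\,\frac{e^{-|x-x_0|^2/(4t_0)}}{(4\pi t_0)^{m/2}}\,dx\ \in[0,\infty].$$ Suppose $f:\mathbb R^m\to S^n$ is a soliton, that is, $f$ is smooth and $\tau(f)=\frac{x}{2}\lrcorner Tf$ (the derivative of $f$ at $x$ in the direction $x/2$) for all $x\in\mathbb R^m$, and suppose that $\lambda(f)<\infty$. If $f$ is entropy stable, meaning that $f$ is a local minimizer of $\lambda$ among smooth maps $\mathbb R^m\to S^n$, then $$\lambda(f)\le\frac{3n}{4(n-2)}.$$ This holds for "local minimizer" in each of the following two senses: 1. There are $k\in\mathbb N$ and $\varepsilon>0$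 such that $\lambda(f)\le\lambda(g)$ for every smooth $g:\mathbb R^m\to S^n$ with $\sup_{x}|D^j(g-f)(x)|<\varepsilon$ for all $0\le j\le k$. 2. $f$ is non-cylindrical (there is no nonzero $\zeta\in\mathbb R^m$ with $\zeta\lrcorner Tf\equiv 0$), and for every compactly supported variation of $f$ (every family of maps $f_s:\mathbb R^m\to S^n$, $s\in\mathbb R$, smooth in $(s,x)$ jointly, with $f_0=f$ and all $f_s$ equal to $f$ outside one compact set) the function $s\mapsto\lambda(f_s)$ has a local minimum at $s=0$. -/

import Mathlib

open scoped Manifold ContDiff ENNReal InnerProductSpace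

noncomputable section

namespace HarmonicSoliton

/-- Euclidean space `ℝ^d`. -/
abbrev Euc (d : ℕ) : Type := EuclideanSpace ℝ (Fin d)

/-- The round unit sphere `S^n ⊂ ℝ^(n+1)`, with Mathlib's smooth structure. -/
abbrev Sph (n : ℕ) : Type := Metric.sphere (0 : Euc (n + 1)) 1

/-- A map into the sphere, regarded as a map into the ambient `ℝ^(n+1)`. -/
def ambient {X : Type*} {n : ℕ} (f : X → Sph n) : X → Euc (n + 1) := fun x => (f x : Euc (n + 1))

/-- `f` is an element of `C^∞(ℝ^m, S^n)`. -/
def IsSmooth {m n : ℕ} (f : Euc m → Sph n) : Prop :=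
  ContMDiff (𝓡 m) (𝓡 n) ∞ f

/-- `|Tf|² = ∑ₐ |∂ₐ f|²` at `x`. As the metric of `S^n` is induced by `ℝ^(n+1)`, the partial
derivatives may be measured in the ambient space. -/
def normSqT {m n : ℕ} (f : Euc m → Sph n) (x : Euc m) : ℝ :=
  ∑ a : Fin m, ‖fderiv ℝ (ambient f) x (EuclideanSpace.single a 1)‖ ^ 2

/-- The tension field `τ(f) = tr ∇(Tf)`: the Levi-Civita connection of `S^n` is the tangential part
of the flat connection of `ℝ^(n+1)`, and the tangent space at `p` is `p^⊥`, so `τ(f)` at `x` is the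
projection to `(f x)^⊥` of `∑ₐ ∂ₐ ∂ₐ f`. -/
def tension {m n : ℕ} (f : Euc m → Sph n) (x : Euc m) : Euc (n + 1) :=
  (ℝ ∙ ambient f x)ᗮ.starProjection (Laplacian.laplacian (ambient f) x)

/-- A soliton (based at `(0,1)`): a smooth map with `τ(f) = (x/2) ⌟ Tf`. -/
def IsSoliton {m n : ℕ} (f : Euc m → Sph n) : Prop :=
  IsSmooth f ∧ ∀ x, tension f x = fderiv ℝ (ambient f) x ((1 / 2 : ℝ) • x)

/-- `𝓕_{x₀,t₀}(f) = (t₀/2) ∫ |Tf|² (4πt₀)^(-m/2) exp(-|x-x₀|²/(4t₀)) dx`, with values in `[0,∞]`. -/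
def functionalF {m n : ℕ} (x₀ : Euc m) (t₀ : ℝ) (f : Euc m → Sph n) : ℝ≥0∞ :=
  ENNReal.ofReal (t₀ / 2) * ∫⁻ x, ENNReal.ofReal
    (normSqT f x * (Real.exp (-‖x - x₀‖ ^ 2 / (4 * t₀)) / (4 * Real.pi * t₀) ^ ((m : ℝ) / 2)))

/-- The entropy `λ(f) = sup { 𝓕_{x₀,t₀}(f) : x₀ ∈ ℝ^m, t₀ > 0 }`, with values in `[0,∞]`. -/
def entropy {m n : ℕ} (f : Euc m → Sph n) : ℝ≥0∞ :=
  ⨆ (x₀ : Euc m) (t₀ : ℝ) (_ : 0 < t₀), functionalF x₀ t₀ f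

/-- `g` lies in the uniform `C^k` ball of radius `ε` around `f`. -/
def UniformlyClose {m n : ℕ} (k : ℕ) (ε : ℝ) (f g : Euc m → Sph n) : Prop :=
  ∀ j ≤ k, ∀ x, ‖iteratedFDeriv ℝ j (fun y => ambient g y - ambient f y) x‖ < ε

/-- Entropy stability: `f` is a local minimizer of `λ` on `C^∞(ℝ^m, S^n)`, for the topology of
uniform convergence of all derivatives. -/
def IsEntropyStable {m n : ℕ} (f : Euc m → Sph n) : Prop :=
  ∃ k : ℕ, ∃ ε : ℝ, 0 < ε ∧
    ∀ g : Euc m → Sph n, IsSmooth g → UniformlyClose k ε f g → entropy f ≤ entropy g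

/-- A compactly supported variation `f_s`, `s ∈ ℝ`, of `f`: jointly smooth in `(s,x)`, with `f_0 = f`
and `f_s = f` outside a compact set. -/
def IsCompactVariation {m n : ℕ} (f : Euc m → Sph n) (F : ℝ → Euc m → Sph n) : Prop :=
  ContMDiff 𝓘(ℝ, ℝ × Euc m) (𝓡 n) ∞ (fun p : ℝ × Euc m => F p.1 p.2) ∧ F 0 = f ∧
    ∃ K : Set (Euc m), IsCompact K ∧ ∀ s, ∀ x ∉ K, F s x = f x

/-- `f` is a local minimizer of `λ` along each of its compactly supported variations. -/
def IsCompactlyEntropyStable {m n : ℕ} (f : Euc m → Sph n) : Prop :=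
  ∀ F : ℝ → Euc m → Sph n, IsCompactVariation f F → IsLocalMin (fun s => entropy (F s)) 0

/-- `f` is cylindrical: `ζ ⌟ Tf ≡ 0` for some constant vector field `ζ ≠ 0`. -/
def IsCylindrical {m n : ℕ} (f : Euc m → Sph n) : Prop :=
  ∃ ζ : Euc m, ζ ≠ 0 ∧ ∀ x, fderiv ℝ (ambient f) x ζ = 0

end HarmonicSoliton

end

/-! Write F(y,t) for the Gaussian energy of f (`gaussEnergy`), G for the Gaussian kernel and e for
|Tf|². For a soliton, F is nonincreasing along every parabola σ ↦ (σy, t) with t = 1 + aσ²: formally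
dF/dσ = -σ/(2t) ∫ |∂_Y f|² G with Y = aσx + y (`IsSoliton.gaussEnergy_path_add_le` is the integrated
form). Hence λ(f) = F(0,1). Near (0,1) the drop F(0,1) - F(y,1+a) is bounded below by a quadratic
expression in (y,a) (`IsSoliton.exists_gaussEnergy_decay`). If f is not cylindrical, F stays a fixed
amount below F(0,1) away from (0,1) (`IsSoliton.exists_gaussEnergy_le_lt`).

A variation f_s = (f + sW)/|f + sW| lowers λ only if it brings all Gaussian energies below F(0,1) at
once. Far from (0,1) the gap beats the uniform O(s) change. Near (0,1) the first order change -(s/2)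
∫ ⟨W, a ∂_x f + ∂_y f⟩ G need not vanish, but it competes with the quadratic drop; completing the
square (`neg_inner_sub_le`) shows that together they contribute at most (3/4) s² ∫ |W|² G, up to
small errors. Adding the second order term gives the quadratic form `stabilityForm`, and a field W
on which it is negative lowers the entropy (`IsSoliton.eventually_entropy_variation_lt`).

Such a W is found by averaging: the cut off tangential projections of the n + 1 coordinate vectors
have forms summing, as the cutoff tends to 1, to 3n/4 - (n-2) F(0,1) (`exists_stabilityForm_neg`).
This is negative exactly when λ(f) > 3n/(4(n-2)).

Two cases are separate. For m ≤ 1, where control at large t would fail, the energy vanishes by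
scaling. For the first notion of stability a cylindrical f is written as a non-cylindrical soliton
composed with an orthogonal projection; this preserves the entropy and uniform closeness. -/

open scoped Manifold ContDiff ENNReal InnerProductSpace

noncomputable section

namespace HarmonicSoliton

open MeasureTheory Filter Topology Set

/-! ### First variation and Pohozaev identity for the Dirichlet energy. -/

section Calculus

variable {m : ℕ} {H : Type*} [NormedAddCommGroup H] [InnerProductSpace ℝ H]

/-- The energy density `∑ₐ |∂ₐ u|²` of a vector valued map. -/
def energyDensity (u : Euc m → H) (x : Euc m) : ℝ :=
  ∑ a : Fin m, ‖fderiv ℝ u x (EuclideanSpace.single a 1)‖ ^ 2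

lemma energyDensity_nonneg (u : Euc m → H) (x : Euc m) : 0 ≤ energyDensity u x :=
  Finset.sum_nonneg fun _ _ => sq_nonneg _

lemma map_eq_sum_single {G : Type*} [NormedAddCommGroup G] [NormedSpace ℝ G]
    (L : Euc m →L[ℝ] G) (x : Euc m) :
    L x = ∑ a : Fin m, x a • L (EuclideanSpace.single a 1) := by
  have h := (EuclideanSpace.basisFun (Fin m) ℝ).sum_repr x
  conv_lhs => rw [← h]
  simp [map_sum]

lemma norm_fderiv_apply_sq_le (u : Euc m → H) (x v : Euc m) :
    ‖fderiv ℝ u x v‖ ^ 2 ≤ energyDensity u x * ‖v‖ ^ 2 := by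
  rw [map_eq_sum_single (fderiv ℝ u x) v]
  have h1 : ‖∑ a : Fin m, v a • fderiv ℝ u x (EuclideanSpace.single a 1)‖ ≤
      ∑ a : Fin m, |v a| * ‖fderiv ℝ u x (EuclideanSpace.single a 1)‖ :=
    (norm_sum_le _ _).trans_eq (by simp [norm_smul])
  refine (pow_le_pow_left₀ (norm_nonneg _) h1 2).trans ?_
  refine (Finset.sum_mul_sq_le_sq_mul_sq _ _ _).trans_eq ?_
  rw [EuclideanSpace.norm_sq_eq, mul_comm]
  simp [energyDensity]

lemma integral_fderiv_apply_eq_zero {h : Euc m → ℝ} (hh : ContDiff ℝ 1 h)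
    (hc : HasCompactSupport h) (v : Euc m) : ∫ x, fderiv ℝ h x v = 0 := by
  have hc' : HasCompactSupport (fun x => fderiv ℝ h x v) := hc.fderiv_apply (𝕜 := ℝ) v
  have hcont : Continuous (fun x => fderiv ℝ h x v) :=
    (hh.continuous_fderiv (by norm_num)).clm_apply continuous_const
  have := integral_mul_fderiv_eq_neg_fderiv_mul_of_integrable (μ := (volume : Measure (Euc m)))
    (f := fun _ : Euc m => (1 : ℝ)) (g := h) (v := v) (by simp)
    (by simpa using hcont.integrable_of_hasCompactSupport hc')
    (by simpa using hh.continuous.integrable_of_hasCompactSupport hc)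
    (by intro x _; fun_prop) (fun x _ => (hh.differentiable (by norm_num)) x)
  simpa using this

/-- Iterated first derivatives are the form in which integration by parts uses the Laplacian. -/
lemma laplacian_eq_sum_fderiv {u : Euc m → H} (hu : ContDiff ℝ ∞ u) (x : Euc m) :
    Laplacian.laplacian u x = ∑ a : Fin m,
      fderiv ℝ (fun y => fderiv ℝ u y (EuclideanSpace.single a 1)) x
        (EuclideanSpace.single a 1) := by
  rw [InnerProductSpace.laplacian_eq_iteratedFDeriv_orthonormalBasis u
    (EuclideanSpace.basisFun (Fin m) ℝ)]
  refine Finset.sum_congr rfl fun a _ => ?_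
  have hd : DifferentiableAt ℝ (fderiv ℝ u) x :=
    ((hu.fderiv_right (m := ∞) (by simp)).differentiable (by simp)) x
  rw [iteratedFDeriv_two_apply, fderiv_clm_apply hd (by fun_prop)]
  simp

lemma contDiff_pderiv {u : Euc m → H} (hu : ContDiff ℝ ∞ u) (v : Euc m) :
    ContDiff ℝ ∞ (fun y => fderiv ℝ u y v) :=
  (hu.fderiv_right (m := ∞) (by simp)).clm_apply contDiff_const

lemma contDiff_energyDensity {u : Euc m → H} (hu : ContDiff ℝ ∞ u) :
    ContDiff ℝ ∞ (energyDensity u) := by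
  unfold energyDensity
  exact ContDiff.sum fun a _ => (contDiff_pderiv hu _).norm_sq ℝ

lemma continuous_laplacian {u : Euc m → H} (hu : ContDiff ℝ ∞ u) :
    Continuous (Laplacian.laplacian u) := by
  rw [funext (laplacian_eq_sum_fderiv hu)]
  exact continuous_finsetSum _ fun a _ => (contDiff_pderiv (contDiff_pderiv hu _) _).continuous

lemma integrable_first_variation {u W : Euc m → H} (hu : ContDiff ℝ ∞ u) (hW : ContDiff ℝ 1 W)
    (hc : HasCompactSupport W) :
    Integrable (fun x => ∑ a : Fin m, ⟪fderiv ℝ u x (EuclideanSpace.single a 1),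
      fderiv ℝ W x (EuclideanSpace.single a 1)⟫_ℝ) ∧
    Integrable (fun x => ⟪Laplacian.laplacian u x, W x⟫_ℝ) := by
  refine ⟨?_, ?_⟩
  · refine integrable_finsetSum _ fun a _ => ?_
    refine ((contDiff_pderiv hu _).continuous.inner ((hW.continuous_fderiv (by norm_num)).clm_apply
      continuous_const)).integrable_of_hasCompactSupport
      ((hc.fderiv_apply (𝕜 := ℝ) (EuclideanSpace.single a 1)).mono' ?_)
    intro x hx
    refine subset_tsupport _ ?_
    contrapose! hx
    simp only [Function.mem_support, not_not] at hx ⊢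
    simp [hx]
  · refine ((continuous_laplacian hu).inner hW.continuous).integrable_of_hasCompactSupport
      (hc.mono' ?_)
    intro x hx
    refine subset_tsupport W ?_
    contrapose! hx
    simp only [Function.mem_support, not_not] at hx ⊢
    simp [hx]

/-- The first variation of the Dirichlet energy. -/
lemma integral_sum_inner_fderiv {u W : Euc m → H} (hu : ContDiff ℝ ∞ u) (hW : ContDiff ℝ 1 W)
    (hc : HasCompactSupport W) :
    ∫ x, ∑ a : Fin m, ⟪fderiv ℝ u x (EuclideanSpace.single a 1),
      fderiv ℝ W x (EuclideanSpace.single a 1)⟫_ℝ = -∫ x, ⟪Laplacian.laplacian u x, W x⟫_ℝ := by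
  have hsm : ∀ a : Fin m, ContDiff ℝ ∞
      (fun y => fderiv ℝ u y (EuclideanSpace.single a (1 : ℝ))) :=
    fun a => contDiff_pderiv hu _
  have hP : ∀ a : Fin m, ContDiff ℝ 1
      (fun x => ⟪fderiv ℝ u x (EuclideanSpace.single a 1), W x⟫_ℝ) := fun a =>
    ((hsm a).of_le (by exact_mod_cast le_top)).inner ℝ hW
  have hPc : ∀ a : Fin m, HasCompactSupport
      (fun x => ⟪fderiv ℝ u x (EuclideanSpace.single a 1), W x⟫_ℝ) := fun a =>
    hc.mono' (by
      intro x hx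
      refine subset_tsupport W ?_
      contrapose! hx
      simp only [Function.mem_support, not_not] at hx ⊢
      simp [hx])
  have hder : ∀ (a : Fin m) (x : Euc m),
      fderiv ℝ (fun x => ⟪fderiv ℝ u x (EuclideanSpace.single a 1), W x⟫_ℝ) x
        (EuclideanSpace.single a 1) =
      ⟪fderiv ℝ u x (EuclideanSpace.single a 1), fderiv ℝ W x (EuclideanSpace.single a 1)⟫_ℝ +
      ⟪fderiv ℝ (fun y => fderiv ℝ u y (EuclideanSpace.single a 1)) x
        (EuclideanSpace.single a 1), W x⟫_ℝ := fun a x => by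
    rw [fderiv_inner_apply ℝ ((hsm a).differentiable (by simp) x)
      (hW.differentiable (by norm_num) x)]
  have hsum : ∫ x, ∑ a : Fin m,
      fderiv ℝ (fun x => ⟪fderiv ℝ u x (EuclideanSpace.single a 1), W x⟫_ℝ) x
        (EuclideanSpace.single a 1) = 0 := by
    rw [integral_finsetSum _ fun a _ => ?_]
    · exact Finset.sum_eq_zero fun a _ => integral_fderiv_apply_eq_zero (hP a) (hPc a) _
    · exact (((hP a).continuous_fderiv (by norm_num)).clm_apply
        continuous_const).integrable_of_hasCompactSupport ((hPc a).fderiv_apply (𝕜 := ℝ) _)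
  obtain ⟨hint1, hint2⟩ := integrable_first_variation hu hW hc
  rw [eq_neg_iff_add_eq_zero, ← integral_add hint1 hint2, ← hsum]
  refine integral_congr_ae (Eventually.of_forall fun x => ?_)
  simp only [hder, Finset.sum_add_distrib, laplacian_eq_sum_fderiv hu x, sum_inner]

lemma fderiv_energyDensity {u : Euc m → H} (hu : ContDiff ℝ ∞ u) (x v : Euc m) :
    fderiv ℝ (energyDensity u) x v = 2 * ∑ a : Fin m,
      ⟪fderiv ℝ u x (EuclideanSpace.single a 1),
        fderiv ℝ (fun y => fderiv ℝ u y (EuclideanSpace.single a 1)) x v⟫_ℝ := by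
  have h : ∀ a : Fin m, HasFDerivAt
      (fun y => ‖fderiv ℝ u y (EuclideanSpace.single a (1 : ℝ))‖ ^ 2) _ x := fun a =>
    ((contDiff_pderiv hu (EuclideanSpace.single a (1:ℝ))).differentiable (by simp) x
      ).hasFDerivAt.norm_sq
  have := HasFDerivAt.fun_sum (u := Finset.univ) fun a _ => h a
  unfold energyDensity
  rw [this.fderiv]
  simp [Finset.mul_sum]

lemma isSymmSndFDerivAt_of_smooth {u : Euc m → H} (hu : ContDiff ℝ ∞ u) (x : Euc m) :
    IsSymmSndFDerivAt ℝ u x :=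
  hu.contDiffAt.isSymmSndFDerivAt (by
    simp only [minSmoothness_of_isRCLikeNormedField]; exact WithTop.coe_le_coe.2 le_top)

/-- The Pohozaev identity for the Dirichlet energy, along the affine field `Y x = c x + b`,
localized by `φ`. -/
lemma integral_pohozaev {u : Euc m → H} (hu : ContDiff ℝ ∞ u) {φ : Euc m → ℝ}
    (hφ : ContDiff ℝ 1 φ) (hc : HasCompactSupport φ) (c : ℝ) (b : Euc m) :
    ∫ x, (φ x * c * energyDensity u x - 2⁻¹ * (energyDensity u x *
      (fderiv ℝ φ x (c • x + b) + m * c * φ x)) +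
      φ x * ⟪Laplacian.laplacian u x, fderiv ℝ u x (c • x + b)⟫_ℝ +
      ∑ a : Fin m, fderiv ℝ φ x (EuclideanSpace.single a 1) *
        ⟪fderiv ℝ u x (EuclideanSpace.single a 1), fderiv ℝ u x (c • x + b)⟫_ℝ) = 0 := by
  set Y : Euc m → Euc m := fun x => c • x + b with hYdef
  have hY : ContDiff ℝ ∞ Y := by fun_prop
  have hYd : ∀ x v, fderiv ℝ Y x v = c • v := by
    intro x v
    have : HasFDerivAt Y (c • ContinuousLinearMap.id ℝ (Euc m)) x :=
      ((hasFDerivAt_id x).const_smul c).add_const b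
    rw [this.fderiv]; simp
  have hDu : ContDiff ℝ ∞ (fderiv ℝ u) := hu.fderiv_right (m := ∞) (by simp)
  set Z : Euc m → H := fun x => fderiv ℝ u x (Y x) with hZdef
  have hZ : ContDiff ℝ ∞ Z := hDu.clm_apply hY
  -- The identity is the first variation tested with W, minus half the integral of div(φ e Y). By
  -- symmetry of second derivatives ∑ₐ ⟨∂ₐu, ∂ₐ∂_Y u⟩ contains them only as half the derivative of e
  -- along Y, and the subtraction cancels this.
  set W : Euc m → H := fun x => φ x • Z x with hWdef
  have hW : ContDiff ℝ 1 W := hφ.smul (hZ.of_le (by exact_mod_cast le_top))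
  have hWc : HasCompactSupport W := hc.smul_right
  have hφd : Differentiable ℝ φ := hφ.differentiable (by norm_num)
  have hZd : ∀ x v, fderiv ℝ Z x v =
      fderiv ℝ (fun y => fderiv ℝ u y v) x (Y x) + c • fderiv ℝ u x v := by
    intro x v
    have hd : DifferentiableAt ℝ (fderiv ℝ u) x := hDu.differentiable (by simp) x
    have hs : IsSymmSndFDerivAt ℝ u x := isSymmSndFDerivAt_of_smooth hu x
    rw [hZdef, fderiv_clm_apply hd (hY.differentiable (by simp) x),
      fderiv_clm_apply hd (differentiableAt_const v)]
    simp [hYd, add_comm, hs.eq v (Y x)]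
  have hWd : ∀ x v, fderiv ℝ W x v = fderiv ℝ φ x v • Z x +
      φ x • (fderiv ℝ (fun y => fderiv ℝ u y v) x (Y x) + c • fderiv ℝ u x v) := by
    intro x v
    rw [hWdef, fderiv_fun_smul (hφd x) (hZ.differentiable (by simp) x)]
    simp [hZd, add_comm]
  have he := contDiff_energyDensity hu
  have hed : Differentiable ℝ (energyDensity u) := he.differentiable (by simp)
  set q : Fin m → Euc m → ℝ := fun a x => φ x * (energyDensity u x * Y x a) with hqdef
  have hYa : ∀ a : Fin m, ContDiff ℝ ∞ (fun x => Y x a) := fun a => by fun_prop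
  have hYad : ∀ (a : Fin m) x v, fderiv ℝ (fun x => Y x a) x v = c * v a := by
    intro a x v
    have h1 : HasFDerivAt (fun x => Y x a)
        ((EuclideanSpace.proj a : Euc m →L[ℝ] ℝ).comp (fderiv ℝ Y x)) x :=
      (EuclideanSpace.proj a : Euc m →L[ℝ] ℝ).hasFDerivAt.comp x
        ((hY.differentiable (by simp)) x).hasFDerivAt
    rw [h1.fderiv]
    simp [hYd]
  have hq : ∀ a, ContDiff ℝ 1 (q a) := fun a =>
    hφ.mul ((he.mul (hYa a)).of_le (by exact_mod_cast le_top))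
  have hqc : ∀ a, HasCompactSupport (q a) := fun a => hc.mul_right
  have hqd : ∀ a x v, fderiv ℝ (q a) x v = fderiv ℝ φ x v * (energyDensity u x * Y x a) +
      φ x * (fderiv ℝ (energyDensity u) x v * Y x a + energyDensity u x * (c * v a)) := by
    intro a x v
    have hYad' := (hYa a).differentiable (by simp) x
    rw [hqdef]
    simp only
    rw [fderiv_fun_mul (hφd x) ((hed x).fun_mul hYad'), fderiv_fun_mul (hed x) hYad']
    simp only [add_apply, FunLike.coe_smul, Pi.smul_apply, smul_eq_mul, hYad]
    ring
  have hq0 : ∫ x, ∑ a, fderiv ℝ (q a) x (EuclideanSpace.single a 1) = 0 := by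
    rw [integral_finsetSum _ fun a _ => ?_]
    · exact Finset.sum_eq_zero fun a _ => integral_fderiv_apply_eq_zero (hq a) (hqc a) _
    · exact (((hq a).continuous_fderiv (by norm_num)).clm_apply
        continuous_const).integrable_of_hasCompactSupport ((hqc a).fderiv_apply (𝕜 := ℝ) _)
  have hqi : Integrable (fun x => ∑ a, fderiv ℝ (q a) x (EuclideanSpace.single a 1)) :=
    integrable_finsetSum _ fun a _ => (((hq a).continuous_fderiv (by norm_num)).clm_apply
        continuous_const).integrable_of_hasCompactSupport ((hqc a).fderiv_apply (𝕜 := ℝ) _)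
  obtain ⟨hi1, hi2⟩ := integrable_first_variation hu hW hWc
  have hfv := integral_sum_inner_fderiv hu hW hWc
  rw [eq_neg_iff_add_eq_zero, ← integral_add hi1 hi2] at hfv
  have key := integral_sub (hi1.add hi2) (hqi.const_mul 2⁻¹)
  rw [integral_const_mul, hq0, mul_zero, sub_zero] at key
  rw [← hfv]
  refine Eq.trans ?_ key
  refine integral_congr_ae (Eventually.of_forall fun x => ?_)
  have e1 : ∑ a, fderiv ℝ (q a) x (EuclideanSpace.single a 1) =
      energyDensity u x * fderiv ℝ φ x (Y x) + φ x * fderiv ℝ (energyDensity u) x (Y x) +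
      m * c * φ x * energyDensity u x := by
    rw [map_eq_sum_single (fderiv ℝ φ x) (Y x),
      map_eq_sum_single (fderiv ℝ (energyDensity u) x) (Y x), Finset.mul_sum, Finset.mul_sum,
      ← Finset.sum_add_distrib]
    have : (m * c * φ x * energyDensity u x : ℝ) =
        ∑ _a : Fin m, c * φ x * energyDensity u x := by simp; ring
    rw [this, ← Finset.sum_add_distrib]
    refine Finset.sum_congr rfl fun a _ => ?_
    rw [hqd]
    simp
    ring
  have e2 : ∑ a : Fin m, ⟪fderiv ℝ u x (EuclideanSpace.single a 1),
      fderiv ℝ W x (EuclideanSpace.single a 1)⟫_ℝ =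
      (∑ a : Fin m, fderiv ℝ φ x (EuclideanSpace.single a 1) *
        ⟪fderiv ℝ u x (EuclideanSpace.single a 1), Z x⟫_ℝ) +
      φ x * (2⁻¹ * fderiv ℝ (energyDensity u) x (Y x) + c * energyDensity u x) := by
    rw [fderiv_energyDensity hu, energyDensity, Finset.mul_sum, Finset.mul_sum, Finset.mul_sum,
      ← Finset.sum_add_distrib, Finset.mul_sum, ← Finset.sum_add_distrib]
    refine Finset.sum_congr rfl fun a _ => ?_
    rw [hWd, inner_add_right, inner_smul_right, inner_smul_right, inner_add_right,
      inner_smul_right, real_inner_self_eq_norm_sq]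
    ring
  simp only [Pi.add_apply]
  rw [e1, e2]
  simp only [hWdef, hZdef, hYdef, inner_smul_right]
  ring

end Calculus

/-! ### The Gaussian kernel: derivatives, mass, uniform domination. -/

section Gaussian

variable {m : ℕ}

/-- The backward heat kernel at time distance `t`, centred at `x₀`. -/
def gauss (x₀ : Euc m) (t : ℝ) (x : Euc m) : ℝ :=
  Real.exp (-‖x - x₀‖ ^ 2 / (4 * t)) / (4 * Real.pi * t) ^ ((m : ℝ) / 2)

lemma gauss_pos (x₀ : Euc m) {t : ℝ} (ht : 0 < t) (x : Euc m) : 0 < gauss x₀ t x := by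
  unfold gauss; positivity

lemma continuousAt_gauss {p : Euc m × ℝ × Euc m} (hp : 0 < p.2.1) :
    ContinuousAt (fun p : Euc m × ℝ × Euc m => gauss p.1 p.2.1 p.2.2) p := by
  unfold gauss
  have h1 : (4 * p.2.1) ≠ 0 := by positivity
  have h2 : 4 * Real.pi * p.2.1 ≠ 0 := by positivity
  have h3 : (4 * Real.pi * p.2.1) ^ ((m : ℝ) / 2) ≠ 0 := by positivity
  refine ContinuousAt.div ?_ ?_ h3
  · exact Real.continuous_exp.continuousAt.comp
      (ContinuousAt.div (by fun_prop) (by fun_prop) h1)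
  · exact ContinuousAt.rpow_const (by fun_prop) (Or.inl h2)

lemma hasFDerivAt_gauss (x₀ : Euc m) (t : ℝ) (x : Euc m) :
    HasFDerivAt (gauss x₀ t) ((-(gauss x₀ t x / (2 * t))) • innerSL ℝ (x - x₀)) x := by
  have h1 : HasFDerivAt (fun x : Euc m => ‖x - x₀‖ ^ 2) (2 • (innerSL ℝ (x - x₀))) x := by
    simpa using ((hasFDerivAt_id x).sub_const x₀).norm_sq
  have h2 := (h1.neg.mul_const (4 * t)⁻¹).exp.mul_const ((4 * Real.pi * t) ^ ((m : ℝ) / 2))⁻¹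
  unfold gauss
  simp only [div_eq_mul_inv]
  convert! h2 using 1
  ext v
  simp
  ring_nf

lemma fderiv_gauss (x₀ : Euc m) (t : ℝ) (x v : Euc m) :
    fderiv ℝ (gauss x₀ t) x v = -(gauss x₀ t x * ⟪x - x₀, v⟫_ℝ / (2 * t)) := by
  rw [(hasFDerivAt_gauss x₀ t x).fderiv, FunLike.coe_smul, Pi.smul_apply, innerSL_apply_apply, smul_eq_mul]
  ring

lemma contDiff_gauss (x₀ : Euc m) (t : ℝ) : ContDiff ℝ ∞ (gauss x₀ t) := by
  unfold gauss
  have : ContDiff ℝ ∞ (fun x : Euc m => ‖x - x₀‖ ^ 2) :=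
    (contDiff_id.sub contDiff_const).norm_sq ℝ
  exact ((this.neg.div_const _).exp).div_const _

/-- The derivative of `t · G_{x₀,t}` along the parabolic path `σ ↦ (σ y, 1 + a σ²)`. -/
lemma hasDerivAt_mul_gauss_path (y x : Euc m) (a σ : ℝ) (ht : 0 < 1 + a * σ ^ 2) :
    HasDerivAt (fun σ : ℝ => (1 + a * σ ^ 2) * gauss (σ • y) (1 + a * σ ^ 2) x)
      (gauss (σ • y) (1 + a * σ ^ 2) x * (a * σ * (2 - m) +
        ⟪x - σ • y, (a * σ) • x + y⟫_ℝ / (2 * (1 + a * σ ^ 2)))) σ := by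
  set t := 1 + a * σ ^ 2 with htdef
  have hT : HasDerivAt (fun σ : ℝ => 1 + a * σ ^ 2) (2 * (a * σ)) σ := by
    have := ((hasDerivAt_pow 2 σ).const_mul a).const_add 1
    convert! this using 1
    simp; ring
  have hx : HasDerivAt (fun σ : ℝ => x - σ • y) (-y) σ := by
    simpa using ((hasDerivAt_id σ).smul_const y).const_sub x
  have hN : HasDerivAt (fun σ : ℝ => ‖x - σ • y‖ ^ 2) (2 * ⟪x - σ • y, -y⟫_ℝ) σ := hx.norm_sq
  have hE := (hN.neg.div (hT.const_mul 4) (by simp only [← htdef]; positivity)).exp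
  have hP := (hT.const_mul (4 * Real.pi)).rpow_const (p := (m : ℝ) / 2)
    (Or.inl (by simp only [← htdef]; positivity))
  have hG := hT.mul (hE.div hP (by simp only [← htdef]; positivity))
  simp only [← htdef] at hG
  unfold gauss
  convert! hG using 1
  have hQ : 0 < 4 * Real.pi * t := by positivity
  rw [Real.rpow_sub_one hQ.ne']
  have hQ' : 0 < (4 * Real.pi * t) ^ ((m : ℝ) / 2) := by positivity
  simp only [Pi.neg_apply, Pi.div_apply, inner_add_right, inner_neg_right,
    inner_smul_right, ← htdef]
  set E := Real.exp (-‖x - σ • y‖ ^ 2 / (4 * t))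
  have hxx : ⟪x - σ • y, x⟫_ℝ = ‖x - σ • y‖ ^ 2 + σ * ⟪x - σ • y, y⟫_ℝ := by
    rw [← real_inner_self_eq_norm_sq, inner_sub_right (x - σ • y) x, inner_smul_right]
    ring
  rw [hxx]
  set N := ‖x - σ • y‖ ^ 2
  set I := ⟪x - σ • y, y⟫_ℝ
  have hpi := Real.pi_pos
  have hI : a * σ * (N + σ * I) + I = a * σ * N + t * I := by rw [htdef]; ring
  rw [hI]
  set Q := (4 * Real.pi * t) ^ ((m : ℝ) / 2)
  clear_value t N I E Q
  field_simp
  ring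

lemma integral_gauss (x₀ : Euc m) {t : ℝ} (ht : 0 < t) : ∫ x, gauss x₀ t x = 1 := by
  unfold gauss
  rw [integral_div]
  have h1 : ∫ x : Euc m, Real.exp (-‖x - x₀‖ ^ 2 / (4 * t)) =
      ∫ x : Euc m, Real.exp (-(4 * t)⁻¹ * ‖x‖ ^ 2) := by
    rw [← integral_sub_right_eq_self (fun x : Euc m => Real.exp (-(4 * t)⁻¹ * ‖x‖ ^ 2)) x₀]
    congr 1; ext x; congr 1; ring
  rw [h1, GaussianFourier.integral_rexp_neg_mul_sq_norm (by positivity)]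
  simp only [finrank_euclideanSpace, Fintype.card_fin]
  rw [div_inv_eq_mul, show Real.pi * (4 * t) = 4 * Real.pi * t by ring]
  exact div_self (by positivity)

lemma integrable_gauss (x₀ : Euc m) {t : ℝ} (ht : 0 < t) : Integrable (gauss x₀ t) :=
  Integrable.of_integral_ne_zero (by rw [integral_gauss x₀ ht]; norm_num)

lemma gauss_le {t : ℝ} (ht : 0 < t) (x₀ x : Euc m) :
    gauss x₀ t x ≤ ((4 * Real.pi * t) ^ ((m : ℝ) / 2))⁻¹ := by
  unfold gauss
  rw [div_eq_mul_inv]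
  refine mul_le_of_le_one_left (by positivity) (Real.exp_le_one_iff.2 ?_)
  rw [neg_div]
  simp only [Left.neg_nonpos_iff]; positivity

/-- Gaussians with parameters in a compact set are dominated, even after multiplication by a linear
function, by one wider Gaussian. -/
lemma exists_gauss_dominated (m : ℕ) {t₁ t₂ : ℝ} (h₁ : 0 < t₁) (h₂ : 0 < t₂) (ρ : ℝ) :
    ∃ C : ℝ, 0 < C ∧ ∀ (x₀ : Euc m) (t : ℝ), ‖x₀‖ ≤ ρ → t₁ ≤ t → t ≤ t₂ → ∀ x : Euc m,
      (1 + ‖x‖) * gauss x₀ t x ≤ C * gauss 0 (2 * t₂) x := by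
  refine ⟨Real.exp (ρ ^ 2 / t₁ + 4 * t₂) * ((4 * Real.pi * (2 * t₂)) ^ ((m : ℝ) / 2) /
    (4 * Real.pi * t₁) ^ ((m : ℝ) / 2)), by positivity, ?_⟩
  intro x₀ t hx₀ ht₁ ht₂ x
  have ht : 0 < t := h₁.trans_le ht₁
  unfold gauss
  have hexp : (1 + ‖x‖) * Real.exp (-‖x - x₀‖ ^ 2 / (4 * t)) ≤
      Real.exp (ρ ^ 2 / t₁ + 4 * t₂) * Real.exp (-‖x - 0‖ ^ 2 / (4 * (2 * t₂))) := by
    have h3 : 1 + ‖x‖ ≤ Real.exp ‖x‖ := by linarith [Real.add_one_le_exp ‖x‖]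
    refine (mul_le_mul_of_nonneg_right h3 (Real.exp_nonneg _)).trans ?_
    rw [← Real.exp_add, ← Real.exp_add, Real.exp_le_exp, sub_zero]
    have hn : ‖x‖ - ‖x₀‖ ≤ ‖x - x₀‖ := norm_sub_norm_le x x₀
    have hsq : 3 / 4 * ‖x‖ ^ 2 - 4 * ρ ^ 2 ≤ ‖x - x₀‖ ^ 2 := by
      have h4 : ‖x‖ ^ 2 ≤ (‖x - x₀‖ + ‖x₀‖) ^ 2 :=
        pow_le_pow_left₀ (norm_nonneg _) (by linarith) 2
      have h5 : ‖x₀‖ ^ 2 ≤ ρ ^ 2 := pow_le_pow_left₀ (norm_nonneg _) hx₀ 2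
      nlinarith [sq_nonneg (‖x - x₀‖ - 3 * ‖x₀‖)]
    -- The shifted Gaussian provides -(3/16)|x|²/t₂ and the wider one asks only for -(1/8)|x|²/t₂;
    -- the difference 1/16 absorbs the linear factor.
    have h6 : ‖x‖ ≤ ‖x‖ ^ 2 / (16 * t₂) + 4 * t₂ := by
      have : ‖x‖ ^ 2 / (16 * t₂) + 4 * t₂ - ‖x‖ = (‖x‖ - 8 * t₂) ^ 2 / (16 * t₂) := by
        field_simp; ring
      have : 0 ≤ (‖x‖ - 8 * t₂) ^ 2 / (16 * t₂) := by positivity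
      linarith
    have h7 : -‖x - x₀‖ ^ 2 / (4 * t) ≤ ρ ^ 2 / t₁ - 3 / 16 * ‖x‖ ^ 2 / t₂ := by
      have a1 : -‖x - x₀‖ ^ 2 / (4 * t) ≤ (4 * ρ ^ 2 - 3 / 4 * ‖x‖ ^ 2) / (4 * t) := by
        gcongr; linarith
      have a2 : (4 * ρ ^ 2 - 3 / 4 * ‖x‖ ^ 2) / (4 * t) =
          ρ ^ 2 / t - 3 / 16 * ‖x‖ ^ 2 / t := by field_simp; ring
      have a3 : ρ ^ 2 / t ≤ ρ ^ 2 / t₁ := by gcongr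
      have a4 : 3 / 16 * ‖x‖ ^ 2 / t₂ ≤ 3 / 16 * ‖x‖ ^ 2 / t := by gcongr
      linarith
    have h8 : -‖x‖ ^ 2 / (4 * (2 * t₂)) =
      ‖x‖ ^ 2 / (16 * t₂) - 3 / 16 * ‖x‖ ^ 2 / t₂ := by field_simp; ring
    linarith
  have hden : (4 * Real.pi * t₁) ^ ((m : ℝ) / 2) ≤ (4 * Real.pi * t) ^ ((m : ℝ) / 2) := by
    have := Real.pi_pos
    exact Real.rpow_le_rpow (by positivity) (by gcongr) (by positivity)
  have hp1 : 0 < (4 * Real.pi * t₁) ^ ((m : ℝ) / 2) := by positivity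
  have hp2 : 0 < (4 * Real.pi * (2 * t₂)) ^ ((m : ℝ) / 2) := by positivity
  rw [← mul_div_assoc]
  calc _ ≤ (1 + ‖x‖) * Real.exp (-‖x - x₀‖ ^ 2 / (4 * t)) / (4 * Real.pi * t₁) ^ ((m : ℝ) / 2) := by
        gcongr
    _ ≤ (Real.exp (ρ ^ 2 / t₁ + 4 * t₂) * Real.exp (-‖x - 0‖ ^ 2 / (4 * (2 * t₂)))) /
          (4 * Real.pi * t₁) ^ ((m : ℝ) / 2) := by gcongr
    _ = _ := by field_simp

end Gaussian

/-! ### Gaussian energies as real integrals. -/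

section Energy

variable {m n : ℕ}

lemma contDiff_ambient {f : Euc m → Sph n} (hf : IsSmooth f) : ContDiff ℝ ∞ (ambient f) :=
  have : Fact (Module.finrank ℝ (Euc (n + 1)) = n + 1) := ⟨by simp⟩
  ContMDiff.contDiff ((contMDiff_coe_sphere (m := ∞) (E := Euc (n + 1)) (n := n)).comp hf)

/-- The real valued counterpart of `functionalF`. -/
def gaussEnergy (e : Euc m → ℝ) (x₀ : Euc m) (t : ℝ) : ℝ := t / 2 * ∫ x, e x * gauss x₀ t x

lemma functionalF_eq_lintegral (f : Euc m → Sph n) (x₀ : Euc m) (t : ℝ) :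
    functionalF x₀ t f = ENNReal.ofReal (t / 2) *
      ∫⁻ x, ENNReal.ofReal (energyDensity (ambient f) x * gauss x₀ t x) := rfl

lemma functionalF_eq_ofReal {f : Euc m → Sph n} {x₀ : Euc m} {t : ℝ} (ht : 0 < t)
    (hi : Integrable (fun x => energyDensity (ambient f) x * gauss x₀ t x)) :
    functionalF x₀ t f = ENNReal.ofReal (gaussEnergy (energyDensity (ambient f)) x₀ t) := by
  rw [functionalF_eq_lintegral, gaussEnergy, ENNReal.ofReal_mul (by positivity),
    ofReal_integral_eq_lintegral_ofReal hi]
  exact Eventually.of_forall fun x =>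
    mul_nonneg (energyDensity_nonneg _ _) (gauss_pos x₀ ht x).le

/-- Only the majorant has to be integrable, so perturbed maps can be treated without knowing that
their own entropy is finite. -/
lemma functionalF_le_ofReal {f : Euc m → Sph n} {x₀ : Euc m} {t : ℝ} (ht : 0 < t) {h : Euc m → ℝ}
    (hle : ∀ x, energyDensity (ambient f) x ≤ h x)
    (hi : Integrable (fun x => h x * gauss x₀ t x)) :
    functionalF x₀ t f ≤ ENNReal.ofReal (gaussEnergy h x₀ t) := by
  rw [functionalF_eq_lintegral, gaussEnergy, ENNReal.ofReal_mul (by positivity),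
    ofReal_integral_eq_lintegral_ofReal hi]
  · gcongr with x
    · exact (gauss_pos x₀ ht x).le
    · exact hle x
  · exact Eventually.of_forall fun x =>
      mul_nonneg ((energyDensity_nonneg _ _).trans (hle x)) (gauss_pos x₀ ht x).le

lemma functionalF_le_entropy (f : Euc m → Sph n) (x₀ : Euc m) {t : ℝ} (ht : 0 < t) :
    functionalF x₀ t f ≤ entropy f :=
  le_iSup₂_of_le x₀ t (le_iSup_of_le ht le_rfl)

lemma continuous_gauss (x₀ : Euc m) (t : ℝ) : Continuous (gauss x₀ t) :=
  (contDiff_gauss x₀ t).continuous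

/-- Finite entropy is the only control on the growth of Tf at infinity; every limit that removes a
cutoff relies on this integrability. -/
lemma integrable_energy_gauss {f : Euc m → Sph n} (hf : IsSmooth f) (hfin : entropy f ≠ ⊤)
    (x₀ : Euc m) {t : ℝ} (ht : 0 < t) :
    Integrable (fun x => energyDensity (ambient f) x * gauss x₀ t x) := by
  have hc : Continuous (fun x => energyDensity (ambient f) x * gauss x₀ t x) :=
    (contDiff_energyDensity (contDiff_ambient hf)).continuous.mul (continuous_gauss x₀ t)
  have h1 := ne_top_of_le_ne_top hfin (functionalF_le_entropy f x₀ ht)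
  rw [functionalF_eq_lintegral] at h1
  have h2 : ∫⁻ x, ENNReal.ofReal (energyDensity (ambient f) x * gauss x₀ t x) ≠ ⊤ := by
    intro h
    rw [h, ENNReal.mul_top (by simpa using ht)] at h1
    exact h1 rfl
  refine ⟨hc.aestronglyMeasurable, ?_⟩
  rw [hasFiniteIntegral_iff_ofReal]
  · exact lt_top_iff_ne_top.2 h2
  · exact Eventually.of_forall fun x =>
      mul_nonneg (energyDensity_nonneg _ _) (gauss_pos x₀ ht x).le

end Energy

/-! ### Smooth cutoffs with gradient of size 1/R. -/

section Cutoff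

/-- A smooth cutoff function, equal to `1` on the ball of radius `R`. -/
def cutoff (m : ℕ) (R : ℝ) (x : Euc m) : ℝ :=
  (⟨1, 2, one_pos, one_lt_two⟩ : ContDiffBump (0 : Euc m)) (R⁻¹ • x)

variable {m : ℕ}

lemma contDiff_cutoff (R : ℝ) : ContDiff ℝ ∞ (cutoff m R) := by
  unfold cutoff
  exact (ContDiffBump.contDiff _).comp (contDiff_id.const_smul _)

lemma cutoff_nonneg (R : ℝ) (x : Euc m) : 0 ≤ cutoff m R x := ContDiffBump.nonneg _

lemma cutoff_le_one (R : ℝ) (x : Euc m) : cutoff m R x ≤ 1 := ContDiffBump.le_one _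

lemma cutoff_eq_one {R : ℝ} (hR : 0 < R) {x : Euc m} (hx : ‖x‖ ≤ R) : cutoff m R x = 1 := by
  unfold cutoff
  refine ContDiffBump.one_of_mem_closedBall _ ?_
  simp only [Metric.mem_closedBall, dist_zero_right, norm_smul, norm_inv, Real.norm_eq_abs,
    abs_of_pos hR]
  rw [inv_mul_le_one₀ hR]
  exact hx

lemma cutoff_eq_zero {R : ℝ} (hR : 0 < R) {x : Euc m} (hx : 2 * R ≤ ‖x‖) :
    cutoff m R x = 0 := by
  unfold cutoff
  refine ContDiffBump.zero_of_le_dist _ ?_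
  simp only [dist_zero_right, norm_smul, norm_inv, Real.norm_eq_abs, abs_of_pos hR]
  rw [le_inv_mul_iff₀ hR]
  linarith

lemma hasCompactSupport_cutoff {R : ℝ} (hR : 0 < R) : HasCompactSupport (cutoff m R) := by
  refine HasCompactSupport.intro (isCompact_closedBall (0 : Euc m) (2 * R)) fun x hx => ?_
  refine cutoff_eq_zero hR ?_
  simp only [Metric.mem_closedBall, dist_zero_right, not_le] at hx
  exact hx.le

lemma exists_norm_fderiv_cutoff_le (m : ℕ) : ∃ C : ℝ, 0 ≤ C ∧ ∀ R : ℝ, 0 < R → ∀ x : Euc m,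
    ‖fderiv ℝ (cutoff m R) x‖ ≤ C / R := by
  set b : ContDiffBump (0 : Euc m) := ⟨1, 2, one_pos, one_lt_two⟩ with hb
  have hbs : ContDiff ℝ 1 b := b.contDiff
  obtain ⟨C, hC⟩ := (b.hasCompactSupport.fderiv (𝕜 := ℝ)).exists_bound_of_continuous
    (hbs.continuous_fderiv (by norm_num))
  refine ⟨C, (norm_nonneg _).trans (hC 0), fun R hR x => ?_⟩
  have h1 : HasFDerivAt (cutoff m R)
      ((fderiv ℝ b (R⁻¹ • x)).comp (R⁻¹ • ContinuousLinearMap.id ℝ (Euc m))) x :=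
    ((hbs.differentiable (by norm_num)) (R⁻¹ • x)).hasFDerivAt.comp x
      ((hasFDerivAt_id x).const_smul R⁻¹)
  rw [h1.fderiv]
  refine (ContinuousLinearMap.opNorm_comp_le _ _).trans ?_
  rw [div_eq_mul_inv]
  refine mul_le_mul (hC _) ?_ (norm_nonneg _) ((norm_nonneg _).trans (hC 0))
  rw [norm_smul, norm_inv, Real.norm_eq_abs, abs_of_pos hR]
  exact mul_le_of_le_one_right (by positivity) ContinuousLinearMap.norm_id_le

lemma integrable_of_eq_zero_off_tsupport {χ h : Euc m → ℝ} (hc : HasCompactSupport χ)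
    (hh : Continuous h) (h0 : ∀ x ∉ tsupport χ, h x = 0) : Integrable h :=
  hh.integrable_of_hasCompactSupport (HasCompactSupport.intro hc h0)

end Cutoff

/-! ### Monotonicity formula with a cutoff. -/

section Soliton

variable {m n : ℕ}

lemma norm_ambient (f : Euc m → Sph n) (x : Euc m) : ‖ambient f x‖ = 1 := by
  simp [ambient]

lemma inner_ambient_fderiv {f : Euc m → Sph n} (hf : IsSmooth f) (x v : Euc m) :
    ⟪ambient f x, fderiv ℝ (ambient f) x v⟫_ℝ = 0 := by
  have hd : DifferentiableAt ℝ (ambient f) x := (contDiff_ambient hf).differentiable (by simp) x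
  have h1 : fderiv ℝ (fun y => ⟪ambient f y, ambient f y⟫_ℝ) x v = 0 := by
    have : (fun y => ⟪ambient f y, ambient f y⟫_ℝ) = fun _ => (1 : ℝ) := by
      ext y; rw [real_inner_self_eq_norm_sq, norm_ambient]; norm_num
    rw [this]; simp
  rw [fderiv_inner_apply ℝ hd hd, real_inner_comm] at h1
  rw [real_inner_comm] at h1
  linarith [real_inner_comm (ambient f x) (fderiv ℝ (ambient f) x v)]

/-- The soliton equation, tested against a tangent vector. -/
lemma IsSoliton.inner_laplacian {f : Euc m → Sph n} (hf : IsSoliton f) (x : Euc m)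
    {w : Euc (n + 1)} (hw : ⟪ambient f x, w⟫_ℝ = 0) :
    ⟪Laplacian.laplacian (ambient f) x, w⟫_ℝ =
      ⟪fderiv ℝ (ambient f) x ((1 / 2 : ℝ) • x), w⟫_ℝ := by
  rw [← hf.2 x, tension]
  have hmem : w ∈ (ℝ ∙ ambient f x)ᗮ := Submodule.mem_orthogonal_singleton_iff_inner_right.2 hw
  rw [Submodule.inner_starProjection_left_eq_right, Submodule.starProjection_eq_self_iff.2 hmem]

/-- The cutoff Gaussian energy along a parabolic path. -/
lemma hasDerivAt_integral_cutoff_path {e χ : Euc m → ℝ} (he : Continuous e) (hχ : Continuous χ)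
    (hc : HasCompactSupport χ) (y : Euc m) (a : ℝ) {σ : ℝ} (ht : 0 < 1 + a * σ ^ 2) :
    HasDerivAt (fun σ : ℝ => ∫ x, χ x * e x * ((1 + a * σ ^ 2) * gauss (σ • y) (1 + a * σ ^ 2) x))
      (∫ x, χ x * e x * (gauss (σ • y) (1 + a * σ ^ 2) x * (a * σ * (2 - m) +
        ⟪x - σ • y, (a * σ) • x + y⟫_ℝ / (2 * (1 + a * σ ^ 2))))) σ := by
  have hopen : IsOpen {s : ℝ | 0 < 1 + a * s ^ 2} := isOpen_lt continuous_const (by fun_prop)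
  obtain ⟨δ, hδ, hδs⟩ := Metric.nhds_basis_closedBall.mem_iff.1 (hopen.mem_nhds ht)
  set F' : ℝ → Euc m → ℝ := fun s x => χ x * e x * (gauss (s • y) (1 + a * s ^ 2) x *
    (a * s * (2 - m) + ⟪x - s • y, (a * s) • x + y⟫_ℝ / (2 * (1 + a * s ^ 2)))) with hF'
  have hgc : ∀ s : ℝ, 0 < 1 + a * s ^ 2 → ∀ x : Euc m,
      ContinuousAt (fun p : ℝ × Euc m => gauss (p.1 • y) (1 + a * p.1 ^ 2) p.2) (s, x) := by
    intro s hs x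
    exact ContinuousAt.comp (x := (s, x)) (g := fun p : Euc m × ℝ × Euc m => gauss p.1 p.2.1 p.2.2)
      (f := fun p : ℝ × Euc m => (p.1 • y, 1 + a * p.1 ^ 2, p.2))
      (continuousAt_gauss (p := (s • y, 1 + a * s ^ 2, x)) hs) (by fun_prop)
  have hcont : ContinuousOn (fun p : ℝ × Euc m => F' p.1 p.2)
      (Metric.closedBall σ δ ×ˢ tsupport χ) := by
    intro p hp
    have hs : 0 < 1 + a * p.1 ^ 2 := hδs hp.1
    have hs' : 2 * (1 + a * p.1 ^ 2) ≠ 0 := by positivity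
    have := hgc p.1 hs p.2
    refine ContinuousAt.continuousWithinAt ?_
    refine ContinuousAt.mul (by fun_prop) (ContinuousAt.mul this (ContinuousAt.add (by fun_prop) ?_))
    exact ContinuousAt.div (by fun_prop) (by fun_prop) hs'
  obtain ⟨C, hC⟩ := ((isCompact_closedBall σ δ).prod hc).exists_bound_of_continuousOn hcont
  have hz : ∀ s, ∀ x ∉ tsupport χ, F' s x = 0 := fun s x hx => by
    simp [hF', image_eq_zero_of_notMem_tsupport hx]
  have hcx : ∀ s, Continuous (F' s) := by
    intro s
    have := continuous_gauss (s • y) (1 + a * s ^ 2)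
    simp only [hF']
    fun_prop
  have hmain := hasDerivAt_integral_of_dominated_loc_of_deriv_le (μ := (volume : Measure (Euc m)))
    (F := fun s x => χ x * e x * ((1 + a * s ^ 2) * gauss (s • y) (1 + a * s ^ 2) x))
    (F' := F') (x₀ := σ) (s := Metric.closedBall σ δ)
    (bound := (tsupport χ).indicator fun _ => C) (Metric.closedBall_mem_nhds σ hδ) ?_ ?_ ?_ ?_ ?_ ?_
  · exact hmain.2
  · refine Eventually.of_forall fun s => Continuous.aestronglyMeasurable ?_
    have := continuous_gauss (s • y) (1 + a * s ^ 2)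
    fun_prop
  · have := continuous_gauss (σ • y) (1 + a * σ ^ 2)
    exact integrable_of_eq_zero_off_tsupport hc (by fun_prop) fun x hx => by
      simp [image_eq_zero_of_notMem_tsupport hx]
  · exact (hcx σ).aestronglyMeasurable
  · refine Eventually.of_forall fun x s hs => ?_
    by_cases hx : x ∈ tsupport χ
    · rw [indicator_of_mem hx]
      exact hC (s, x) ⟨hs, hx⟩
    · rw [indicator_of_notMem hx, hz s x hx, norm_zero]
  · rw [integrable_indicator_iff (isClosed_tsupport χ).measurableSet]
    exact integrableOn_const hc.measure_lt_top.ne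
  · refine Eventually.of_forall fun x s hs => ?_
    exact (hasDerivAt_mul_gauss_path y x a s (hδs hs)).const_mul _

/-- The monotonicity formula, with a cutoff. -/
lemma IsSoliton.monotonicity_cutoff {f : Euc m → Sph n} (hf : IsSoliton f) {χ : Euc m → ℝ}
    (hχ : ContDiff ℝ ∞ χ) (hc : HasCompactSupport χ) (y : Euc m) (a : ℝ) {σ : ℝ}
    (ht : 0 < 1 + a * σ ^ 2) :
    2⁻¹ * (∫ x, χ x * energyDensity (ambient f) x * (gauss (σ • y) (1 + a * σ ^ 2) x *
      (a * σ * (2 - m) + ⟪x - σ • y, (a * σ) • x + y⟫_ℝ / (2 * (1 + a * σ ^ 2))))) =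
    (∫ x, gauss (σ • y) (1 + a * σ ^ 2) x * (2⁻¹ * energyDensity (ambient f) x *
        fderiv ℝ χ x ((a * σ) • x + y) - ∑ b : Fin m, fderiv ℝ χ x (EuclideanSpace.single b 1) *
        ⟪fderiv ℝ (ambient f) x (EuclideanSpace.single b 1),
          fderiv ℝ (ambient f) x ((a * σ) • x + y)⟫_ℝ)) -
    σ / (2 * (1 + a * σ ^ 2)) * ∫ x, χ x * (gauss (σ • y) (1 + a * σ ^ 2) x *
      ‖fderiv ℝ (ambient f) x ((a * σ) • x + y)‖ ^ 2) := by
  have hu := contDiff_ambient hf.1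
  have hDu : Continuous (fderiv ℝ (ambient f)) := hu.continuous_fderiv (by simp)
  have hDχ : Continuous (fderiv ℝ χ) := hχ.continuous_fderiv (by simp)
  have he : Continuous (energyDensity (ambient f)) := (contDiff_energyDensity hu).continuous
  have hG : Continuous (gauss (σ • y) (1 + a * σ ^ 2)) := continuous_gauss _ _
  have hχc := hχ.continuous
  have hGd : ContDiff ℝ ∞ (gauss (σ • y) (1 + a * σ ^ 2)) := contDiff_gauss _ _
  have hφ : ContDiff ℝ 1 (fun x => χ x * gauss (σ • y) (1 + a * σ ^ 2) x) :=
    (hχ.mul hGd).of_le (by exact_mod_cast le_top)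
  -- The weight is χG and the field Y = aσx + y; the terms with derivatives of χ form the cutoff
  -- error.
  have hpo := integral_pohozaev hu hφ hc.mul_right (a * σ) y
  set t := 1 + a * σ ^ 2 with htdef
  have hφd : ∀ x v, fderiv ℝ (fun x => χ x * gauss (σ • y) t x) x v =
      fderiv ℝ χ x v * gauss (σ • y) t x -
        χ x * (gauss (σ • y) t x * ⟪x - σ • y, v⟫_ℝ / (2 * t)) := by
    intro x v
    rw [fderiv_fun_mul (hχ.differentiable (by simp) x) (hGd.differentiable (by simp) x)]
    simp only [add_apply, FunLike.coe_smul, Pi.smul_apply, smul_eq_mul, fderiv_gauss]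
    ring
  have hi1 : Integrable (fun x => 2⁻¹ * (χ x * energyDensity (ambient f) x *
      (gauss (σ • y) t x * (a * σ * (2 - m) + ⟪x - σ • y, (a * σ) • x + y⟫_ℝ / (2 * t))))) :=
    integrable_of_eq_zero_off_tsupport hc (by fun_prop) fun x hx => by
      simp [image_eq_zero_of_notMem_tsupport hx]
  have hi2 : Integrable (fun x => gauss (σ • y) t x * (2⁻¹ * energyDensity (ambient f) x *
        fderiv ℝ χ x ((a * σ) • x + y) - ∑ b : Fin m, fderiv ℝ χ x (EuclideanSpace.single b 1) *
        ⟪fderiv ℝ (ambient f) x (EuclideanSpace.single b 1),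
          fderiv ℝ (ambient f) x ((a * σ) • x + y)⟫_ℝ)) :=
    integrable_of_eq_zero_off_tsupport hc (by fun_prop) fun x hx => by
      simp [fderiv_of_notMem_tsupport (𝕜 := ℝ) hx]
  have hi3 : Integrable (fun x => σ / (2 * t) * (χ x * (gauss (σ • y) t x *
      ‖fderiv ℝ (ambient f) x ((a * σ) • x + y)‖ ^ 2))) :=
    integrable_of_eq_zero_off_tsupport hc (by fun_prop) fun x hx => by
      simp [image_eq_zero_of_notMem_tsupport hx]
  rw [← integral_const_mul, ← integral_const_mul, ← integral_sub hi2 hi3]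
  refine sub_eq_zero.1 ((integral_sub hi1 (hi2.sub hi3)).symm.trans ?_)
  rw [← hpo]
  refine integral_congr_ae (Eventually.of_forall fun x => ?_)
  simp only [Pi.sub_apply, hφd]
  rw [hf.inner_laplacian x (inner_ambient_fderiv hf.1 x _)]
  set Y := (a * σ) • x + y with hY
  set Z := fderiv ℝ (ambient f) x Y with hZ
  have hsum : ∑ b : Fin m, (fderiv ℝ χ x (EuclideanSpace.single b 1) * gauss (σ • y) t x -
        χ x * (gauss (σ • y) t x * ⟪x - σ • y, EuclideanSpace.single b 1⟫_ℝ / (2 * t))) *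
        ⟪fderiv ℝ (ambient f) x (EuclideanSpace.single b 1), Z⟫_ℝ =
      gauss (σ • y) t x * (∑ b : Fin m, fderiv ℝ χ x (EuclideanSpace.single b 1) *
        ⟪fderiv ℝ (ambient f) x (EuclideanSpace.single b 1), Z⟫_ℝ) -
      χ x * gauss (σ • y) t x / (2 * t) * ⟪fderiv ℝ (ambient f) x (x - σ • y), Z⟫_ℝ := by
    rw [map_eq_sum_single (fderiv ℝ (ambient f) x) (x - σ • y), sum_inner, Finset.mul_sum,
      Finset.mul_sum, ← Finset.sum_sub_distrib]
    refine Finset.sum_congr rfl fun b _ => ?_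
    rw [inner_smul_left, EuclideanSpace.inner_single_right]
    simp only [conj_trivial, one_mul]
    ring
  rw [hsum]
  -- The identity σY + (x - σy) = tx is the reason for using parabolic paths. In the soliton
  -- equation the second summand cancels the gradient of G, and the first leaves the signed term
  -- -σ/(2t) |∂_Y f|².
  have hvec : (1 / 2 : ℝ) • x = (σ / (2 * t)) • Y + (2 * t)⁻¹ • (x - σ • y) := by
    have : x = t⁻¹ • ((1 + a * σ ^ 2) • x) := by
      rw [← htdef, smul_smul, inv_mul_cancel₀ ht.ne', one_smul]
    conv_lhs => rw [this]
    rw [hY]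
    match_scalars <;> field_simp <;> ring
  have hDvec : fderiv ℝ (ambient f) x ((1 / 2 : ℝ) • x) = (σ / (2 * t)) • Z +
      (2 * t)⁻¹ • fderiv ℝ (ambient f) x (x - σ • y) := by
    rw [hvec, map_add, map_smul, map_smul]
  rw [hDvec, inner_add_left, inner_smul_left, inner_smul_left, real_inner_self_eq_norm_sq]
  simp only [conj_trivial]
  ring

end Soliton

/-! ### Removing the cutoff; the entropy is F(0,1). -/

section Monotonicity

variable {m n : ℕ}

lemma path_time_bounds {a σ : ℝ} (h₀ : 0 ≤ σ) (h₁ : σ ≤ 1) :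
    min 1 (1 + a) ≤ 1 + a * σ ^ 2 ∧ 1 + a * σ ^ 2 ≤ max 1 (1 + a) := by
  have hs : σ ^ 2 ≤ 1 := pow_le_one₀ h₀ h₁
  rcases le_total 0 a with ha | ha
  · rw [min_eq_left (by linarith), max_eq_right (by linarith)]
    constructor <;> nlinarith [sq_nonneg σ]
  · rw [min_eq_right (by linarith), max_eq_left (by linarith)]
    constructor <;> nlinarith [sq_nonneg σ]

/-- The error integrand is at most a constant times (1/R)(1 + |x|) e G. One wider Gaussian dominates
(1 + |x|) G for all σ in [0,1], and e is integrable against it by finite entropy. -/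
lemma exists_cutoff_error_bound {f : Euc m → Sph n} (hf : IsSmooth f) (hfin : entropy f ≠ ⊤)
    (y : Euc m) {a : ℝ} (ha : -1 < a) :
    ∃ C : ℝ, ∀ R : ℝ, 0 < R → ∀ σ ∈ Icc (0 : ℝ) 1,
    ∫ x, gauss (σ • y) (1 + a * σ ^ 2) x * (2⁻¹ * energyDensity (ambient f) x *
        fderiv ℝ (cutoff m R) x ((a * σ) • x + y) -
        ∑ b : Fin m, fderiv ℝ (cutoff m R) x (EuclideanSpace.single b 1) *
        ⟪fderiv ℝ (ambient f) x (EuclideanSpace.single b 1),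
          fderiv ℝ (ambient f) x ((a * σ) • x + y)⟫_ℝ) ≤ C / R := by
  obtain ⟨C₁, hC₁, hcut⟩ := exists_norm_fderiv_cutoff_le m
  have h1 : 0 < min 1 (1 + a) := lt_min one_pos (by linarith)
  have h2 : 0 < max 1 (1 + a) := lt_max_of_lt_left one_pos
  obtain ⟨C₂, hC₂, hdom⟩ := exists_gauss_dominated m h1 h2 ‖y‖
  set T := 2 * max 1 (1 + a)
  have hT : 0 < T := by positivity
  have hint := integrable_energy_gauss hf hfin 0 hT
  set L : ℝ := (2⁻¹ + m) * (|a| + ‖y‖) * C₁ * C₂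
  refine ⟨L * ∫ x, energyDensity (ambient f) x * gauss 0 T x, fun R hR σ hσ => ?_⟩
  rw [mul_div_right_comm, ← integral_const_mul]
  obtain ⟨ht1, ht2⟩ := path_time_bounds (a := a) hσ.1 hσ.2
  have ht : 0 < 1 + a * σ ^ 2 := h1.trans_le ht1
  have hσy : ‖σ • y‖ ≤ ‖y‖ := by
    rw [norm_smul, Real.norm_eq_abs, abs_of_nonneg hσ.1]
    exact mul_le_of_le_one_left (norm_nonneg _) hσ.2
  refine (Real.le_norm_self _).trans (norm_integral_le_of_norm_le (hint.const_mul (L / R))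
    (Eventually.of_forall fun x => ?_))
  set e := energyDensity (ambient f) x with he
  have he0 : 0 ≤ e := energyDensity_nonneg _ _
  set Y := (a * σ) • x + y with hY
  have hYn : ‖Y‖ ≤ (|a| + ‖y‖) * (1 + ‖x‖) := by
    have : ‖Y‖ ≤ |a| * ‖x‖ + ‖y‖ := by
      refine (norm_add_le _ _).trans ?_
      rw [norm_smul, Real.norm_eq_abs, abs_mul, abs_of_nonneg hσ.1]
      gcongr
      exact mul_le_of_le_one_right (abs_nonneg a) hσ.2
    nlinarith [abs_nonneg a, norm_nonneg y, norm_nonneg x]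
  have hsing : ∀ b : Fin m, ‖(EuclideanSpace.single b (1 : ℝ) : Euc m)‖ = 1 := by simp
  have hDχ : ∀ v, ‖fderiv ℝ (cutoff m R) x v‖ ≤ C₁ / R * ‖v‖ := fun v =>
    (ContinuousLinearMap.le_opNorm _ _).trans (by gcongr; exact hcut R hR x)
  have hG := gauss_pos (σ • y) ht x
  have hin : ∀ b : Fin m, |⟪fderiv ℝ (ambient f) x (EuclideanSpace.single b 1),
      fderiv ℝ (ambient f) x Y⟫_ℝ| ≤ e * ‖Y‖ := by
    intro b
    refine (abs_real_inner_le_norm _ _).trans ?_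
    have q1 := norm_fderiv_apply_sq_le (ambient f) x (EuclideanSpace.single b 1)
    have q2 := norm_fderiv_apply_sq_le (ambient f) x Y
    rw [hsing] at q1
    refine abs_le_of_sq_le_sq' ?_ (by positivity) |>.2
    rw [mul_pow, mul_pow]
    calc _ ≤ (e * 1 ^ 2) * (e * ‖Y‖ ^ 2) := by gcongr
      _ = _ := by ring
  have hmain : ‖2⁻¹ * e * fderiv ℝ (cutoff m R) x Y -
      ∑ b : Fin m, fderiv ℝ (cutoff m R) x (EuclideanSpace.single b 1) *
        ⟪fderiv ℝ (ambient f) x (EuclideanSpace.single b 1), fderiv ℝ (ambient f) x Y⟫_ℝ‖ ≤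
      (2⁻¹ + m) * (C₁ / R) * e * ‖Y‖ := by
    refine (norm_sub_le _ _).trans ?_
    have b1 : ‖2⁻¹ * e * fderiv ℝ (cutoff m R) x Y‖ ≤ 2⁻¹ * e * (C₁ / R * ‖Y‖) := by
      rw [norm_mul, Real.norm_of_nonneg (by positivity : 0 ≤ 2⁻¹ * e)]
      gcongr
      exact hDχ Y
    have b2 : ‖∑ b : Fin m, fderiv ℝ (cutoff m R) x (EuclideanSpace.single b 1) *
        ⟪fderiv ℝ (ambient f) x (EuclideanSpace.single b 1), fderiv ℝ (ambient f) x Y⟫_ℝ‖ ≤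
        ∑ _b : Fin m, C₁ / R * (e * ‖Y‖) := by
      refine (norm_sum_le _ _).trans (Finset.sum_le_sum fun b _ => ?_)
      rw [norm_mul]
      have := hDχ (EuclideanSpace.single b 1)
      rw [hsing, mul_one] at this
      exact mul_le_mul this (hin b) (norm_nonneg _) (by positivity)
    rw [Finset.sum_const, Finset.card_univ, Fintype.card_fin, nsmul_eq_mul] at b2
    linarith
  rw [norm_mul, Real.norm_of_nonneg hG.le]
  calc _ ≤ gauss (σ • y) (1 + a * σ ^ 2) x * ((2⁻¹ + m) * (C₁ / R) * e *
        ((|a| + ‖y‖) * (1 + ‖x‖))) := by gcongr; exact hmain.trans (by gcongr)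
    _ = (2⁻¹ + m) * (C₁ / R) * e * (|a| + ‖y‖) *
        ((1 + ‖x‖) * gauss (σ • y) (1 + a * σ ^ 2) x) := by ring
    _ ≤ (2⁻¹ + m) * (C₁ / R) * e * (|a| + ‖y‖) * (C₂ * gauss 0 T x) := by
        exact mul_le_mul_of_nonneg_left (hdom _ _ hσy ht1 ht2 x) (by positivity)
    _ = _ := by simp only [L]; ring

/-- The monotonicity formula along parabolic paths, in integrated form. -/
lemma IsSoliton.gaussEnergy_path_add_le {f : Euc m → Sph n} (hf : IsSoliton f)
    (hfin : entropy f ≠ ⊤) (y : Euc m) {a : ℝ} (ha : -1 < a) {K : Set (Euc m)} (hK : IsCompact K)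
    {p p' : ℝ → ℝ} (hp : ∀ σ, HasDerivAt p (p' σ) σ)
    (hp' : ∀ σ ∈ Icc (0 : ℝ) 1, p' σ ≤ σ / (2 * (1 + a * σ ^ 2)) *
      ∫ x in K, gauss (σ • y) (1 + a * σ ^ 2) x *
        ‖fderiv ℝ (ambient f) x ((a * σ) • x + y)‖ ^ 2)
    {σ₀ σ₁ : ℝ} (h₀ : 0 ≤ σ₀) (h₀₁ : σ₀ ≤ σ₁) (h₁ : σ₁ ≤ 1) :
    gaussEnergy (energyDensity (ambient f)) (σ₁ • y) (1 + a * σ₁ ^ 2) + p σ₁ ≤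
      gaussEnergy (energyDensity (ambient f)) (σ₀ • y) (1 + a * σ₀ ^ 2) + p σ₀ := by
  have hu := contDiff_ambient hf.1
  have hDu : Continuous (fderiv ℝ (ambient f)) := hu.continuous_fderiv (by simp)
  have he : Continuous (energyDensity (ambient f)) := (contDiff_energyDensity hu).continuous
  obtain ⟨C, hC⟩ := exists_cutoff_error_bound hf.1 hfin y ha
  obtain ⟨ρ, hρ⟩ := hK.isBounded.exists_norm_le
  have htpos : ∀ σ ∈ Icc (0 : ℝ) 1, 0 < 1 + a * σ ^ 2 := fun σ hσ =>
    (lt_min one_pos (by linarith)).trans_le (path_time_bounds hσ.1 hσ.2).1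
  set ψ : ℝ → ℝ → ℝ := fun R σ => 2⁻¹ * ∫ x, cutoff m R x * energyDensity (ambient f) x *
    ((1 + a * σ ^ 2) * gauss (σ • y) (1 + a * σ ^ 2) x) with hψ
  -- The term C/R · σ pays for the cutoff error, and for R ≥ ρ the cutoff equals 1 on K, so its
  -- dissipation dominates the one over K that bounds p'. Letting R → ∞ in the resulting inequality
  -- avoids differentiating the full energy.
  have hstep : ∀ R : ℝ, 0 < R → ρ ≤ R →
      ψ R σ₁ + p σ₁ - C / R * σ₁ ≤ ψ R σ₀ + p σ₀ - C / R * σ₀ := by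
    intro R hR hρR
    have hder : ∀ σ ∈ Icc (0 : ℝ) 1, ∃ d, d ≤ 0 ∧
        HasDerivAt (fun σ => ψ R σ + p σ - C / R * σ) d σ := by
      intro σ hσ
      have ht := htpos σ hσ
      refine ⟨_, ?_, (((hasDerivAt_integral_cutoff_path he (contDiff_cutoff R).continuous
        (hasCompactSupport_cutoff hR) y a ht).const_mul 2⁻¹).add (hp σ)).sub
        ((hasDerivAt_id σ).const_mul (C / R))⟩
      rw [hf.monotonicity_cutoff (contDiff_cutoff R) (hasCompactSupport_cutoff hR) y a ht]
      have hG := continuous_gauss (σ • y) (1 + a * σ ^ 2)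
      have hχ := (contDiff_cutoff (m := m) R).continuous
      have hmono : ∫ x in K, gauss (σ • y) (1 + a * σ ^ 2) x *
          ‖fderiv ℝ (ambient f) x ((a * σ) • x + y)‖ ^ 2 ≤
          ∫ x, cutoff m R x * (gauss (σ • y) (1 + a * σ ^ 2) x *
          ‖fderiv ℝ (ambient f) x ((a * σ) • x + y)‖ ^ 2) := by
        rw [← integral_indicator hK.measurableSet]
        refine integral_mono_ae ?_ ?_ (Eventually.of_forall fun x => ?_)
        · rw [integrable_indicator_iff hK.measurableSet]
          exact ContinuousOn.integrableOn_compact hK (by fun_prop)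
        · exact integrable_of_eq_zero_off_tsupport (hasCompactSupport_cutoff hR) (by fun_prop)
            fun x hx => by simp [image_eq_zero_of_notMem_tsupport hx]
        · simp only
          by_cases hx : x ∈ K
          · rw [indicator_of_mem hx, cutoff_eq_one hR ((hρ x hx).trans hρR), one_mul]
          · rw [indicator_of_notMem hx]
            exact mul_nonneg (cutoff_nonneg _ _)
              (mul_nonneg (gauss_pos _ ht x).le (sq_nonneg _))
      have hcoef : 0 ≤ σ / (2 * (1 + a * σ ^ 2)) := div_nonneg hσ.1 (by positivity)
      have := mul_le_mul_of_nonneg_left hmono hcoef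
      linarith [hC R hR σ hσ, hp' σ hσ]
    have hanti : AntitoneOn (fun σ => ψ R σ + p σ - C / R * σ) (Icc 0 1) := by
      choose! d hd0 hd using hder
      refine antitoneOn_of_hasDerivWithinAt_nonpos (f' := d) (convex_Icc 0 1)
        (fun σ hσ => (hd σ hσ).continuousAt.continuousWithinAt)
        (fun σ hσ => (hd σ (interior_subset hσ)).hasDerivWithinAt)
        (fun σ hσ => hd0 σ (interior_subset hσ))
    exact hanti ⟨h₀, h₀₁.trans h₁⟩ ⟨h₀.trans h₀₁, h₁⟩ h₀₁
  have hlim : ∀ σ ∈ Icc (0 : ℝ) 1, Tendsto (fun k : ℕ => ψ (k : ℝ) σ) atTop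
      (𝓝 (gaussEnergy (energyDensity (ambient f)) (σ • y) (1 + a * σ ^ 2))) := by
    intro σ hσ
    have ht := htpos σ hσ
    have hG := continuous_gauss (σ • y) (1 + a * σ ^ 2)
    have heq : gaussEnergy (energyDensity (ambient f)) (σ • y) (1 + a * σ ^ 2) = 2⁻¹ *
        ∫ x, energyDensity (ambient f) x *
          ((1 + a * σ ^ 2) * gauss (σ • y) (1 + a * σ ^ 2) x) := by
      rw [gaussEnergy, div_eq_mul_inv, mul_comm _ (2⁻¹ : ℝ), mul_assoc, ← integral_const_mul]
      congr 2; ext x; ring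
    rw [heq]
    refine Tendsto.const_mul _ (tendsto_integral_of_dominated_convergence
      (fun x => energyDensity (ambient f) x *
          ((1 + a * σ ^ 2) * gauss (σ • y) (1 + a * σ ^ 2) x)) ?_ ?_ ?_ ?_)
    · intro k
      have hχ := (contDiff_cutoff (m := m) k).continuous
      exact Continuous.aestronglyMeasurable (by fun_prop)
    · have := (integrable_energy_gauss hf.1 hfin (σ • y) ht).const_mul (1 + a * σ ^ 2)
      refine this.congr (Eventually.of_forall fun x => ?_)
      simp only; ring
    · intro k
      refine Eventually.of_forall fun x => ?_
      have h3 : 0 ≤ energyDensity (ambient f) x := energyDensity_nonneg _ _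
      have h4 := (gauss_pos (σ • y) ht x).le
      have h5 := cutoff_nonneg (k : ℝ) x
      rw [Real.norm_of_nonneg (by positivity), mul_assoc]
      exact mul_le_of_le_one_left (by positivity) (cutoff_le_one _ _)
    · refine Eventually.of_forall fun x => tendsto_const_nhds.congr' ?_
      obtain ⟨k₀, hk₀⟩ := exists_nat_gt ‖x‖
      filter_upwards [eventually_ge_atTop k₀] with k hk
      have : ‖x‖ ≤ (k : ℝ) := hk₀.le.trans (by exact_mod_cast hk)
      rw [cutoff_eq_one (hk₀.trans_le (by exact_mod_cast hk) |>.trans_le' (norm_nonneg _)) this,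
        one_mul]
  have hlim2 : ∀ σ ∈ Icc (0 : ℝ) 1, Tendsto (fun k : ℕ => ψ (k : ℝ) σ + p σ - C / k * σ) atTop
      (𝓝 (gaussEnergy (energyDensity (ambient f)) (σ • y) (1 + a * σ ^ 2) + p σ)) := by
    intro σ hσ
    have := ((hlim σ hσ).add_const (p σ)).sub
      ((tendsto_const_div_atTop_nhds_zero_nat C).mul_const σ)
    simpa using this
  refine le_of_tendsto_of_tendsto (hlim2 σ₁ ⟨h₀.trans h₀₁, h₁⟩) (hlim2 σ₀ ⟨h₀, h₀₁.trans h₁⟩) ?_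
  obtain ⟨k₀, hk₀⟩ := exists_nat_gt ρ
  filter_upwards [eventually_ge_atTop k₀, eventually_gt_atTop 0] with k hk hk'
  exact hstep k (by exact_mod_cast hk') (hk₀.le.trans (by exact_mod_cast hk))

lemma IsSoliton.gaussEnergy_path_le {f : Euc m → Sph n} (hf : IsSoliton f)
    (hfin : entropy f ≠ ⊤) (y : Euc m) {a : ℝ} (ha : -1 < a)
    {σ₀ σ₁ : ℝ} (h₀ : 0 ≤ σ₀) (h₀₁ : σ₀ ≤ σ₁) (h₁ : σ₁ ≤ 1) :
    gaussEnergy (energyDensity (ambient f)) (σ₁ • y) (1 + a * σ₁ ^ 2) ≤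
      gaussEnergy (energyDensity (ambient f)) (σ₀ • y) (1 + a * σ₀ ^ 2) := by
  have := hf.gaussEnergy_path_add_le hfin y ha isCompact_empty (p := 0) (p' := 0)
    (fun σ => hasDerivAt_const σ 0) (by simp) h₀ h₀₁ h₁
  simpa using this

lemma IsSoliton.gaussEnergy_le {f : Euc m → Sph n} (hf : IsSoliton f)
    (hfin : entropy f ≠ ⊤) (y : Euc m) {t : ℝ} (ht : 0 < t) :
    gaussEnergy (energyDensity (ambient f)) y t ≤ gaussEnergy (energyDensity (ambient f)) 0 1 := by
  have := hf.gaussEnergy_path_le hfin y (a := t - 1) (by linarith) le_rfl zero_le_one le_rfl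
  simpa using this

/-- The entropy of a soliton is attained at `(0, 1)`. -/
lemma IsSoliton.entropy_eq {f : Euc m → Sph n} (hf : IsSoliton f) (hfin : entropy f ≠ ⊤) :
    entropy f = ENNReal.ofReal (gaussEnergy (energyDensity (ambient f)) 0 1) := by
  refine le_antisymm (iSup₂_le fun x₀ t => iSup_le fun ht => ?_) ?_
  · rw [functionalF_eq_ofReal ht (integrable_energy_gauss hf.1 hfin x₀ ht)]
    exact ENNReal.ofReal_le_ofReal (hf.gaussEnergy_le hfin x₀ ht)
  · rw [← functionalF_eq_ofReal one_pos (integrable_energy_gauss hf.1 hfin 0 one_pos)]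
    exact functionalF_le_entropy f 0 one_pos

end Monotonicity

/-! ### Quadratic decay near (0,1) and a gap away from it. -/

section NearFar

variable {m n : ℕ}

/-- Gaussians with parameters near `(0, 1)` are uniformly comparable on compact sets. -/
lemma exists_gauss_comparison {K : Set (Euc m)} (hK : IsCompact K) {ε : ℝ} (hε : 0 < ε) :
    ∃ r : ℝ, 0 < r ∧ r ≤ ε ∧ r < 1 ∧ ∀ (y : Euc m) (a : ℝ), ‖y‖ ^ 2 + |a| ≤ r → ∀ x ∈ K,
      (1 - ε) * gauss 0 1 x ≤ gauss y (1 + a) x ∧ gauss y (1 + a) x ≤ (1 + ε) * gauss 0 1 x := by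
  have hev : ∀ᶠ p : Euc m × ℝ in 𝓝 (0, 0), ∀ x ∈ K,
      |gauss p.1 (1 + p.2) x / gauss 0 1 x - 1| < ε := by
    refine hK.eventually_forall_of_forall_eventually fun x _ => ?_
    have h1 : ContinuousAt (fun z : (Euc m × ℝ) × Euc m => gauss z.1.1 (1 + z.1.2) z.2)
        ((0, 0), x) :=
      ContinuousAt.comp (x := ((0, 0), x))
        (g := fun p : Euc m × ℝ × Euc m => gauss p.1 p.2.1 p.2.2)
        (f := fun z : (Euc m × ℝ) × Euc m => (z.1.1, 1 + z.1.2, z.2))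
        (continuousAt_gauss (by simp)) (by fun_prop)
    have h2 : ContinuousAt (fun z : (Euc m × ℝ) × Euc m => gauss 0 1 z.2) ((0, 0), x) :=
      (continuous_gauss 0 1).continuousAt.comp (by fun_prop)
    have h3 : ContinuousAt (fun z : (Euc m × ℝ) × Euc m =>
        |gauss z.1.1 (1 + z.1.2) z.2 / gauss 0 1 z.2 - 1|) ((0, 0), x) :=
      ((h1.div h2 (gauss_pos 0 one_pos x).ne').sub continuousAt_const).abs
    refine h3.eventually_lt continuousAt_const ?_
    simp [div_self (gauss_pos 0 one_pos x).ne', hε]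
  obtain ⟨δ, hδ, hball⟩ := Metric.eventually_nhds_iff.1 hev
  -- The size ‖y‖² + |a| is parabolic: δ²/4 controls ‖y‖ and δ/2 controls |a|.
  have hδ' : 0 < min (δ / 2) (δ ^ 2 / 4) := by positivity
  refine ⟨min (min (δ / 2) (δ ^ 2 / 4)) (min ε 2⁻¹), by positivity,
    (min_le_right _ _).trans (min_le_left _ _),
    ((min_le_right _ _).trans (min_le_right _ _)).trans_lt (by norm_num), ?_⟩
  intro y a hya x hx
  have hle := hya.trans (min_le_left _ _)
  have hy : ‖y‖ < δ := by
    have : ‖y‖ ^ 2 ≤ (δ / 2) ^ 2 := by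
      have := hle.trans (min_le_right _ _)
      have := abs_nonneg a
      linarith
    have := abs_le_of_sq_le_sq this (by positivity)
    rw [abs_of_nonneg (norm_nonneg _)] at this
    linarith
  have ha : |a| < δ := by
    have := hle.trans (min_le_left _ _)
    have := sq_nonneg ‖y‖
    linarith
  have hd : dist (y, a) ((0 : Euc m), (0 : ℝ)) < δ := by
    rw [Prod.dist_eq, dist_zero_right, dist_zero_right]
    exact max_lt hy ha
  have hb := abs_lt.1 (hball hd x hx)
  have hG := gauss_pos (0 : Euc m) one_pos x
  simp only at hb
  constructor
  · rw [← le_div_iff₀ hG]; linarith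
  · rw [← div_le_iff₀ hG]; linarith

lemma path_param_le {r σ a : ℝ} {y : Euc m} (h₀ : 0 ≤ σ) (h₁ : σ ≤ 1)
    (h : ‖y‖ ^ 2 + |a| ≤ r) : ‖σ • y‖ ^ 2 + |a * σ ^ 2| ≤ r := by
  have hs : σ ^ 2 ≤ 1 := pow_le_one₀ h₀ h₁
  rw [norm_smul, mul_pow, Real.norm_eq_abs, sq_abs, abs_mul, abs_of_nonneg (sq_nonneg σ)]
  nlinarith [sq_nonneg ‖y‖, abs_nonneg a]

lemma integral_linear_combination {α : Type*} [MeasurableSpace α] {μ : Measure α} {f g h : α → ℝ}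
    (hf : Integrable f μ) (hg : Integrable g μ) (hh : Integrable h μ) (a b c : ℝ) :
    ∫ x, (a * f x + b * g x + c * h x) ∂μ =
      a * ∫ x, f x ∂μ + b * ∫ x, g x ∂μ + c * ∫ x, h x ∂μ := by
  have h1 := integral_add ((hf.const_mul a).add (hg.const_mul b)) (hh.const_mul c)
  have h2 := integral_add (hf.const_mul a) (hg.const_mul b)
  simp only [Pi.add_apply] at h1
  rw [h1, h2, integral_const_mul, integral_const_mul, integral_const_mul]

/-- The density controlling the decay of the Gaussian energy away from `(0, 1)`. -/
def decayDensity (u : Euc m → Euc (n + 1)) (y : Euc m) (a : ℝ) (x : Euc m) : ℝ :=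
  a ^ 2 / 4 * ‖fderiv ℝ u x x‖ ^ 2 + 2 * a / 3 * ⟪fderiv ℝ u x x, fderiv ℝ u x y⟫_ℝ +
    2⁻¹ * ‖fderiv ℝ u x y‖ ^ 2

lemma continuous_decayDensity {u : Euc m → Euc (n + 1)} (hu : ContDiff ℝ ∞ u) (y : Euc m) (a : ℝ) :
    Continuous (decayDensity u y a) := by
  have hDu : Continuous (fderiv ℝ u) := hu.continuous_fderiv (by simp)
  unfold decayDensity
  fun_prop

/-- The quadratic form has matrix (1/4, 1/3; 1/3, 1/2) of determinant 1/72 > 0. After subtracting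
1/72 of both squares it is still positive; 24/35 completes the square in the derivative along y. -/
lemma decayDensity_ge (u : Euc m → Euc (n + 1)) (y : Euc m) (a : ℝ) (x : Euc m) :
    72⁻¹ * (a ^ 2 * ‖fderiv ℝ u x x‖ ^ 2) + 72⁻¹ * ‖fderiv ℝ u x y‖ ^ 2 ≤ decayDensity u y a x := by
  have h := sq_nonneg ‖(24 / 35 * a) • fderiv ℝ u x x + fderiv ℝ u x y‖
  rw [← real_inner_self_eq_norm_sq, inner_add_add_self, inner_smul_left, inner_smul_right,
    inner_smul_left, inner_smul_right, real_inner_self_eq_norm_sq, real_inner_self_eq_norm_sq,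
    real_inner_comm (fderiv ℝ u x x) (fderiv ℝ u x y)] at h
  simp only [conj_trivial] at h
  unfold decayDensity
  nlinarith [sq_nonneg (a * ‖fderiv ℝ u x x‖), sq_nonneg ‖fderiv ℝ u x y‖]

/-- Quadratic decay of the Gaussian energy of a soliton near `(0, 1)`, localized to `K`. -/
lemma IsSoliton.exists_gaussEnergy_decay {f : Euc m → Sph n} (hf : IsSoliton f)
    (hfin : entropy f ≠ ⊤) {K : Set (Euc m)} (hK : IsCompact K) {ε : ℝ} (hε : 0 < ε)
    (hε' : ε < 1 / 3) :
    ∃ r : ℝ, 0 < r ∧ r < 1 ∧ ∀ (y : Euc m) (a : ℝ), ‖y‖ ^ 2 + |a| ≤ r →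
      (∀ x ∈ K, (1 - ε) * gauss 0 1 x ≤ gauss y (1 + a) x ∧
        gauss y (1 + a) x ≤ (1 + ε) * gauss 0 1 x) ∧ |a| ≤ ε ∧
      gaussEnergy (energyDensity (ambient f)) y (1 + a) + (1 - 3 * ε) / 2 *
        ∫ x in K, decayDensity (ambient f) y a x * gauss y (1 + a) x ≤
      gaussEnergy (energyDensity (ambient f)) 0 1 := by
  obtain ⟨r, hr, hrε, hr1, hcomp⟩ := exists_gauss_comparison hK hε
  refine ⟨r, hr, hr1, fun y a hya => ⟨hcomp y a hya, ?_, ?_⟩⟩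
  · have := sq_nonneg ‖y‖; linarith
  have haε : |a| ≤ ε := by have := sq_nonneg ‖y‖; linarith
  have ha : -1 < a := by have := neg_abs_le a; linarith
  -- The loss factor satisfies κ(1+ε)² ≤ 1 - ε, which pays for freezing the kernel at the end point
  -- of the path and for replacing 1 + aσ² by 1.
  set κ := 1 - 3 * ε with hκ
  have hκ0 : 0 < κ := by linarith
  have hDu : Continuous (fderiv ℝ (ambient f)) :=
    (contDiff_ambient hf.1).continuous_fderiv (by simp)
  have hg := continuous_gauss y (1 + a)
  set g := gauss y (1 + a) with hgdef
  set A := ∫ x in K, g x * ‖fderiv ℝ (ambient f) x x‖ ^ 2 with hA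
  set B := ∫ x in K, g x * ⟪fderiv ℝ (ambient f) x x, fderiv ℝ (ambient f) x y⟫_ℝ with hB
  set D := ∫ x in K, g x * ‖fderiv ℝ (ambient f) x y‖ ^ 2 with hD
  have hiA : IntegrableOn (fun x => g x * ‖fderiv ℝ (ambient f) x x‖ ^ 2) K :=
    ContinuousOn.integrableOn_compact hK (by fun_prop)
  have hiB : IntegrableOn (fun x => g x *
      ⟪fderiv ℝ (ambient f) x x, fderiv ℝ (ambient f) x y⟫_ℝ) K :=
    ContinuousOn.integrableOn_compact hK (by fun_prop)
  have hiD : IntegrableOn (fun x => g x * ‖fderiv ℝ (ambient f) x y‖ ^ 2) K :=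
    ContinuousOn.integrableOn_compact hK (by fun_prop)
  -- With the kernel frozen, σ|aσ ∂_x f + ∂_y f|² is a polynomial in σ, and p integrates it: 1/4,
  -- 2/3, 1/2 come from ∫σ³, 2∫σ², ∫σ over [0,1], which are the coefficients in `decayDensity`.
  set p : ℝ → ℝ := fun σ => κ / 2 * (a ^ 2 * A / 4 * σ ^ 4 + 2 * a * B / 3 * σ ^ 3 + D / 2 * σ ^ 2)
    with hp
  set p' : ℝ → ℝ := fun σ => κ / 2 * (a ^ 2 * A * σ ^ 3 + 2 * a * B * σ ^ 2 + D * σ) with hp'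
  have hpd : ∀ σ, HasDerivAt p (p' σ) σ := by
    intro σ
    have := ((((hasDerivAt_pow 4 σ).const_mul (a ^ 2 * A / 4)).add
      ((hasDerivAt_pow 3 σ).const_mul (2 * a * B / 3))).add
      ((hasDerivAt_pow 2 σ).const_mul (D / 2))).const_mul (κ / 2)
    convert! this using 1
    simp only [hp']
    push_cast
    ring
  have hexp : ∀ σ x, ‖fderiv ℝ (ambient f) x ((a * σ) • x + y)‖ ^ 2 =
      a ^ 2 * σ ^ 2 * ‖fderiv ℝ (ambient f) x x‖ ^ 2 + 2 * (a * σ) *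
      ⟪fderiv ℝ (ambient f) x x, fderiv ℝ (ambient f) x y⟫_ℝ +
      ‖fderiv ℝ (ambient f) x y‖ ^ 2 := by
    intro σ x
    rw [map_add, map_smul, norm_add_sq_real, norm_smul, inner_smul_left, mul_pow,
      Real.norm_eq_abs, sq_abs]
    simp only [conj_trivial]
    ring
  have hmain := hf.gaussEnergy_path_add_le hfin y ha hK (p := p) (p' := p') hpd ?_
    le_rfl zero_le_one le_rfl
  · have hint : ∫ x in K, decayDensity (ambient f) y a x * g x =
        a ^ 2 / 4 * A + 2 * a / 3 * B + 2⁻¹ * D := by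
      rw [hA, hB, hD, ← integral_linear_combination hiA hiB hiD]
      refine integral_congr_ae (Eventually.of_forall fun x => ?_)
      simp only [decayDensity]
      ring
    rw [hint]
    simp only [hp, one_smul, one_pow, mul_one, zero_smul, ne_eq, OfNat.ofNat_ne_zero,
      not_false_eq_true, zero_pow, mul_zero, add_zero] at hmain
    linarith
  · intro σ hσ
    obtain ⟨ht1, ht2⟩ := path_time_bounds (a := a) hσ.1 hσ.2
    have ht : 0 < 1 + a * σ ^ 2 := (lt_min one_pos (by linarith)).trans_le ht1
    have hpt : p' σ = σ / 2 * ∫ x in K,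
        κ * (g x * ‖fderiv ℝ (ambient f) x ((a * σ) • x + y)‖ ^ 2) := by
      rw [integral_const_mul]
      have : ∫ x in K, g x * ‖fderiv ℝ (ambient f) x ((a * σ) • x + y)‖ ^ 2 =
          a ^ 2 * σ ^ 2 * A + 2 * (a * σ) * B + 1 * D := by
        rw [hA, hB, hD, ← integral_linear_combination hiA hiB hiD]
        refine integral_congr_ae (Eventually.of_forall fun x => ?_)
        simp only [hexp]
        ring
      rw [this]
      simp only [hp']
      ring
    rw [hpt, show σ / (2 * (1 + a * σ ^ 2)) = σ / 2 * (1 + a * σ ^ 2)⁻¹ by field_simp, mul_assoc]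
    rw [← integral_const_mul (1 + a * σ ^ 2)⁻¹]
    refine mul_le_mul_of_nonneg_left ?_ (div_nonneg hσ.1 zero_le_two)
    have hgs := continuous_gauss (σ • y) (1 + a * σ ^ 2)
    refine setIntegral_mono_on (ContinuousOn.integrableOn_compact hK (by fun_prop))
      (ContinuousOn.integrableOn_compact hK (by fun_prop)) hK.measurableSet fun x hx => ?_
    rw [← mul_assoc, ← mul_assoc]
    refine mul_le_mul_of_nonneg_right ?_ (sq_nonneg _)
    have c1 := (hcomp y a hya x hx).2
    have c2 := (hcomp (σ • y) (a * σ ^ 2) (path_param_le hσ.1 hσ.2 hya) x hx).1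
    have hG := gauss_pos (0 : Euc m) one_pos x
    have ht3 : 1 + a * σ ^ 2 ≤ 1 + ε := by
      refine ht2.trans (max_le (by linarith) ?_)
      linarith [le_abs_self a]
    rw [inv_mul_eq_div, le_div_iff₀ ht]
    refine le_trans ?_ c2
    calc κ * g x * (1 + a * σ ^ 2) ≤ κ * ((1 + ε) * gauss 0 1 x) * (1 + ε) := by gcongr
      _ = (κ * (1 + ε) ^ 2) * gauss 0 1 x := by ring
      _ ≤ (1 - ε) * gauss 0 1 x := by
        gcongr
        rw [hκ]
        nlinarith [mul_pos hε hε, mul_pos (mul_pos hε hε) hε]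

/-- The map is constant along every ray, hence equal to its value at the origin. -/
lemma fderiv_eq_zero_of_radial {u : Euc m → Euc (n + 1)} (hu : ContDiff ℝ ∞ u)
    (h : ∀ x, fderiv ℝ u x x = 0) (x : Euc m) : fderiv ℝ u x = 0 := by
  have hd : Differentiable ℝ u := hu.differentiable (by simp)
  have hDu : Continuous (fderiv ℝ u) := hu.continuous_fderiv (by simp)
  have hconst : ∀ x, u x = u 0 := by
    intro x
    have h1 : ∀ t : ℝ, HasDerivAt (fun t : ℝ => u (t • x)) (fderiv ℝ u (t • x) x) t := by
      intro t
      have hx : HasDerivAt (fun t : ℝ => t • x) x t := by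
        simpa using (hasDerivAt_id t).smul_const x
      exact (hd (t • x)).hasFDerivAt.comp_hasDerivAt t hx
    have h2 : ∀ t : ℝ, t ≠ 0 → fderiv ℝ u (t • x) x = 0 := by
      intro t ht
      have := h (t • x)
      rw [map_smul] at this
      exact (smul_eq_zero.1 this).resolve_left ht
    have h3 : ∀ t : ℝ, fderiv ℝ u (t • x) x = 0 := by
      have hc : Continuous (fun t : ℝ => fderiv ℝ u (t • x) x) := by fun_prop
      have := hc.ext_on (dense_compl_singleton (0 : ℝ)) (g := fun _ => 0) continuous_const
        (fun t ht => h2 t ht)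
      exact fun t => congrFun this t
    have h4 := is_const_of_deriv_eq_zero (fun t => (h1 t).differentiableAt)
      (fun t => by rw [(h1 t).deriv, h3 t]) 1 0
    simpa using h4
  have : u = fun _ => u 0 := funext hconst
  rw [this]
  simp

/-- For a noncylindrical soliton, the Gaussian energy is maximal only at `(0, 1)`. -/
lemma IsSoliton.gaussEnergy_lt {f : Euc m → Sph n} (hf : IsSoliton f) (hfin : entropy f ≠ ⊤)
    (hm : 0 < m) (hcyl : ¬ IsCylindrical f) {y : Euc m} {a : ℝ} (ha : -1 < a)
    (hya : y ≠ 0 ∨ a ≠ 0) :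
    gaussEnergy (energyDensity (ambient f)) y (1 + a) <
      gaussEnergy (energyDensity (ambient f)) 0 1 := by
  by_contra! hcon
  have hu := contDiff_ambient hf.1
  have key : ∀ x, a ^ 2 * ‖fderiv ℝ (ambient f) x x‖ ^ 2 = 0 ∧ fderiv ℝ (ambient f) x y = 0 := by
    intro x₁
    obtain ⟨r, hr, hr1, hdec⟩ := hf.exists_gaussEnergy_decay hfin
      (isCompact_closedBall (0 : Euc m) (‖x₁‖ + 1)) (ε := 1 / 6) (by norm_num) (by norm_num)
    set N := ‖y‖ ^ 2 + |a| with hN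
    have hN0 : 0 ≤ N := by positivity
    -- A point of the path close enough to (0,1) for the decay estimate. If the energy at σ = 1 is
    -- maximal, so is the one at σ = s by monotonicity, and the decay density must vanish on the
    -- ball around 0 containing x₁.
    set s := min 1 (r / (N + 1)) with hs
    have hs0 : 0 < s := by positivity
    have hs1 : s ≤ 1 := min_le_left _ _
    have hparam : ‖s • y‖ ^ 2 + |a * s ^ 2| ≤ r := by
      rw [norm_smul, mul_pow, Real.norm_eq_abs, sq_abs, abs_mul, abs_of_nonneg (sq_nonneg s)]
      have h1 : s ^ 2 ≤ s := by nlinarith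
      have h2 : s * (N + 1) ≤ r := by
        rw [← le_div_iff₀ (by positivity)]; exact min_le_right _ _
      nlinarith [sq_nonneg ‖y‖, abs_nonneg a]
    obtain ⟨-, hasm, hle⟩ := hdec _ _ hparam
    have hle2 := hf.gaussEnergy_path_le hfin y ha hs0.le hs1 le_rfl
    simp only [one_smul, one_pow, mul_one] at hle2
    have hts : 0 < 1 + a * s ^ 2 := by linarith [neg_abs_le (a * s ^ 2)]
    have hg := continuous_gauss (s • y) (1 + a * s ^ 2)
    have hq := continuous_decayDensity hu (s • y) (a * s ^ 2)
    have hq0 : ∀ x, 0 ≤ decayDensity (ambient f) (s • y) (a * s ^ 2) x *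
        gauss (s • y) (1 + a * s ^ 2) x := fun x =>
      mul_nonneg (le_trans (by positivity) (decayDensity_ge _ _ _ _)) (gauss_pos _ hts x).le
    have hzero : ∫ x in Metric.closedBall (0 : Euc m) (‖x₁‖ + 1),
        decayDensity (ambient f) (s • y) (a * s ^ 2) x * gauss (s • y) (1 + a * s ^ 2) x = 0 :=
      le_antisymm (by linarith) (integral_nonneg hq0)
    rw [setIntegral_eq_zero_iff_of_nonneg_ae (Eventually.of_forall hq0)
      (ContinuousOn.integrableOn_compact (isCompact_closedBall _ _) (by fun_prop))] at hzero
    have hzero' := ae_restrict_of_ae_restrict_of_subset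
      (Metric.ball_subset_closedBall (x := (0 : Euc m)) (ε := ‖x₁‖ + 1)) hzero
    have hEq := Measure.eqOn_open_of_ae_eq hzero' Metric.isOpen_ball
      (Continuous.continuousOn (by fun_prop)) continuousOn_const
    have hx₁ : x₁ ∈ Metric.ball (0 : Euc m) (‖x₁‖ + 1) := by simp
    have hx0 := hEq hx₁
    simp only [Pi.zero_apply, mul_eq_zero, (gauss_pos (s • y) hts x₁).ne', or_false] at hx0
    have hge := decayDensity_ge (ambient f) (s • y) (a * s ^ 2) x₁
    rw [hx0] at hge
    have e1 : 0 ≤ (a * s ^ 2) ^ 2 * ‖fderiv ℝ (ambient f) x₁ x₁‖ ^ 2 := by positivity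
    have e2 : 0 ≤ ‖fderiv ℝ (ambient f) x₁ (s • y)‖ ^ 2 := by positivity
    have e3 : (a * s ^ 2) ^ 2 * ‖fderiv ℝ (ambient f) x₁ x₁‖ ^ 2 = 0 := by linarith
    have e4 : ‖fderiv ℝ (ambient f) x₁ (s • y)‖ ^ 2 = 0 := by linarith
    refine ⟨?_, ?_⟩
    · have : (a * s ^ 2) ^ 2 * ‖fderiv ℝ (ambient f) x₁ x₁‖ ^ 2 =
          s ^ 4 * (a ^ 2 * ‖fderiv ℝ (ambient f) x₁ x₁‖ ^ 2) := by ring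
      rw [this] at e3
      exact (mul_eq_zero.1 e3).resolve_left (by positivity)
    · rw [map_smul] at e4
      simpa [hs0.ne'] using e4
  by_cases hy : y = 0
  · have ha0 : a ≠ 0 := hya.resolve_left (by simp [hy])
    have hrad : ∀ x, fderiv ℝ (ambient f) x x = 0 := fun x => by
      have := (key x).1
      simpa [ha0] using this
    -- A constant map is invariant in every direction, and m > 0 supplies a nonzero one.
    refine hcyl ⟨EuclideanSpace.single ⟨0, hm⟩ 1, by simp, fun x => ?_⟩
    rw [fderiv_eq_zero_of_radial hu hrad x]; simp
  · exact hcyl ⟨y, hy, fun x => (key x).2⟩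

/-- Dominated convergence, with one wider Gaussian for all nearby parameters. -/
lemma continuousAt_gaussEnergy {f : Euc m → Sph n} (hf : IsSmooth f) (hfin : entropy f ≠ ⊤)
    {p : Euc m × ℝ} (hp : 0 < p.2) :
    ContinuousAt (fun p : Euc m × ℝ => gaussEnergy (energyDensity (ambient f)) p.1 p.2) p := by
  have he : Continuous (energyDensity (ambient f)) :=
    (contDiff_energyDensity (contDiff_ambient hf)).continuous
  obtain ⟨C, hC, hdom⟩ := exists_gauss_dominated m (t₁ := p.2 / 2) (t₂ := 2 * p.2)
    (by positivity) (by positivity) (‖p.1‖ + 1)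
  unfold gaussEnergy
  refine ContinuousAt.mul (by fun_prop) ?_
  refine continuousAt_of_dominated
    (bound := fun x => C * (energyDensity (ambient f) x * gauss 0 (2 * (2 * p.2)) x)) ?_ ?_ ?_ ?_
  · refine Eventually.of_forall fun q => ?_
    have := continuous_gauss q.1 q.2
    exact Continuous.aestronglyMeasurable (by fun_prop)
  · have h1 : ∀ᶠ q : Euc m × ℝ in 𝓝 p, ‖q.1‖ < ‖p.1‖ + 1 :=
      ContinuousAt.eventually_lt (by fun_prop) continuousAt_const (by linarith)
    have h2 : ∀ᶠ q : Euc m × ℝ in 𝓝 p, p.2 / 2 < q.2 :=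
      ContinuousAt.eventually_lt continuousAt_const (by fun_prop) (by linarith)
    have h3 : ∀ᶠ q : Euc m × ℝ in 𝓝 p, q.2 < 2 * p.2 :=
      ContinuousAt.eventually_lt (by fun_prop) continuousAt_const (by linarith)
    filter_upwards [h1, h2, h3] with q hq1 hq2 hq3
    refine Eventually.of_forall fun x => ?_
    have hq : 0 < q.2 := by linarith
    have hg := (gauss_pos q.1 hq x).le
    rw [Real.norm_of_nonneg (mul_nonneg (energyDensity_nonneg _ _) hg), mul_left_comm]
    refine mul_le_mul_of_nonneg_left ?_ (energyDensity_nonneg _ _)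
    refine le_trans ?_ (hdom q.1 q.2 hq1.le hq2.le hq3.le x)
    exact le_mul_of_one_le_left hg (by linarith [norm_nonneg x])
  · exact (integrable_energy_gauss hf hfin 0 (by positivity)).const_mul C
  · refine Eventually.of_forall fun x => continuousAt_const.mul ?_
    exact ContinuousAt.comp (x := p) (g := fun p : Euc m × ℝ × Euc m => gauss p.1 p.2.1 p.2.2)
      (f := fun q : Euc m × ℝ => (q.1, q.2, x)) (continuousAt_gauss (by exact hp)) (by fun_prop)

/-- For a noncylindrical soliton, the Gaussian energy away from `(0, 1)` is bounded away from
its maximum. -/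
lemma IsSoliton.exists_gaussEnergy_le_lt {f : Euc m → Sph n} (hf : IsSoliton f)
    (hfin : entropy f ≠ ⊤) (hm : 0 < m) (hcyl : ¬ IsCylindrical f) {r : ℝ} (hr : 0 < r)
    (hr1 : r < 1) :
    ∃ M < gaussEnergy (energyDensity (ambient f)) 0 1, ∀ (y : Euc m) (a : ℝ), -1 < a →
      r ≤ ‖y‖ ^ 2 + |a| → gaussEnergy (energyDensity (ambient f)) y (1 + a) ≤ M := by
  -- The path from (0,1) to any point outside this parabolic sphere crosses it, at σ² = r/N with N =
  -- ‖y‖² + |a|. By monotonicity the maximum over the compact set S bounds F on the whole noncompact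
  -- exterior.
  set S : Set (Euc m × ℝ) := {p | ‖p.1‖ ^ 2 + |p.2| = r} with hS
  have hSc : IsCompact S := by
    refine Metric.isCompact_of_isClosed_isBounded (isClosed_eq (by fun_prop) continuous_const) ?_
    refine (Metric.isBounded_closedBall (x := ((0 : Euc m), (0 : ℝ))) (r := 1)).subset ?_
    intro p hp
    have hp' : ‖p.1‖ ^ 2 + |p.2| = r := hp
    rw [Metric.mem_closedBall, Prod.dist_eq, dist_zero_right, dist_zero_right, Real.norm_eq_abs]
    refine max_le ?_ ?_
    · nlinarith [norm_nonneg p.1, abs_nonneg p.2]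
    · nlinarith [norm_nonneg p.1, abs_nonneg p.2]
  have hSn : S.Nonempty := ⟨(0, r), by simp [hS, abs_of_pos hr]⟩
  have hpos : ∀ p ∈ S, -1 < p.2 := fun p hp => by
    have hp' : ‖p.1‖ ^ 2 + |p.2| = r := hp
    nlinarith [neg_abs_le p.2, sq_nonneg ‖p.1‖]
  obtain ⟨q, hqS, hq⟩ := hSc.exists_isMaxOn hSn
    (f := fun p : Euc m × ℝ => gaussEnergy (energyDensity (ambient f)) p.1 (1 + p.2))
    (fun p hp => (ContinuousAt.comp (x := p)
      (g := fun p : Euc m × ℝ => gaussEnergy (energyDensity (ambient f)) p.1 p.2)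
      (f := fun p : Euc m × ℝ => (p.1, 1 + p.2))
      (continuousAt_gaussEnergy hf.1 hfin (by simp only; linarith [hpos p hp]))
      (by fun_prop)).continuousWithinAt)
  refine ⟨_, hf.gaussEnergy_lt hfin hm hcyl (y := q.1) (hpos q hqS) ?_, ?_⟩
  · by_contra! hq0
    have : ‖q.1‖ ^ 2 + |q.2| = r := hqS
    simp [hq0.1, hq0.2] at this
    exact hr.ne this
  · intro y a ha hya
    set N := ‖y‖ ^ 2 + |a| with hN
    have hN0 : 0 < N := hr.trans_le hya
    set s := √(r / N) with hs
    have hs2 : s ^ 2 = r / N := Real.sq_sqrt (by positivity)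
    have hs0 : 0 ≤ s := Real.sqrt_nonneg _
    have hs1 : s ≤ 1 := by
      rw [hs, Real.sqrt_le_one]
      exact (div_le_one hN0).2 hya
    have hmem : (s • y, a * s ^ 2) ∈ S := by
      simp only [hS, mem_ofPred_eq]
      rw [norm_smul, mul_pow, Real.norm_eq_abs, sq_abs, abs_mul, abs_of_nonneg (sq_nonneg s), hs2]
      rw [mul_comm |a|, ← mul_add, ← hN]
      field_simp
    have h1 := hf.gaussEnergy_path_le hfin y ha hs0 hs1 le_rfl
    simp only [one_smul, one_pow, mul_one] at h1
    exact h1.trans (hq hmem)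

end NearFar

/-! ### Normalized variations and their energy expansion. -/

section Variation

variable {m n : ℕ}

/-- A smooth, compactly supported vector field along `f`. -/
structure IsTangentField (f : Euc m → Sph n) (W : Euc m → Euc (n + 1)) : Prop where
  smooth : ContDiff ℝ ∞ W
  compact : HasCompactSupport W
  tangent : ∀ x, ⟪ambient f x, W x⟫_ℝ = 0

lemma norm_add_smul_sq {u w : Euc (n + 1)} (hu : ‖u‖ = 1) (h : ⟪u, w⟫_ℝ = 0) (s : ℝ) :
    ‖u + s • w‖ ^ 2 = 1 + s ^ 2 * ‖w‖ ^ 2 := by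
  rw [norm_add_sq_real, hu, inner_smul_right, h, norm_smul, mul_pow, Real.norm_eq_abs, sq_abs]
  ring

/-- The variation `(f + s W) / |f + s W|`. -/
def variation {f : Euc m → Sph n} {W : Euc m → Euc (n + 1)} (hW : IsTangentField f W) (s : ℝ)
    (x : Euc m) : Sph n :=
  ⟨(√(1 + s ^ 2 * ‖W x‖ ^ 2))⁻¹ • (ambient f x + s • W x), by
    have h := norm_add_smul_sq (norm_ambient f x) (hW.tangent x) s
    have hp : 0 < 1 + s ^ 2 * ‖W x‖ ^ 2 := by positivity
    rw [mem_sphere_zero_iff_norm, norm_smul, norm_inv, Real.norm_of_nonneg (Real.sqrt_nonneg _),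
      ← h, Real.sqrt_sq (norm_nonneg _)]
    refine inv_mul_cancel₀ fun h0 => ?_
    rw [h0] at h
    norm_num at h
    linarith⟩

lemma ambient_variation {f : Euc m → Sph n} {W : Euc m → Euc (n + 1)} (hW : IsTangentField f W)
    (s : ℝ) : ambient (variation hW s) =
      fun x => (√(1 + s ^ 2 * ‖W x‖ ^ 2))⁻¹ • (ambient f x + s • W x) := rfl

lemma contDiff_variation_uncurried {f : Euc m → Sph n} (hf : IsSmooth f) {W : Euc m → Euc (n + 1)}
    (hW : IsTangentField f W) : ContDiff ℝ ∞ (fun p : ℝ × Euc m =>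
      (√(1 + p.1 ^ 2 * ‖W p.2‖ ^ 2))⁻¹ • (ambient f p.2 + p.1 • W p.2)) := by
  have hu := contDiff_ambient hf
  have hWs := hW.smooth
  have h1 : ContDiff ℝ ∞ (fun p : ℝ × Euc m => 1 + p.1 ^ 2 * ‖W p.2‖ ^ 2) :=
    contDiff_const.add ((contDiff_fst.pow 2).mul ((hWs.comp contDiff_snd).norm_sq ℝ))
  have h2 : ∀ p : ℝ × Euc m, 1 + p.1 ^ 2 * ‖W p.2‖ ^ 2 ≠ 0 := fun p => by positivity
  exact ((h1.sqrt h2).inv fun p => by positivity).smul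
    ((hu.comp contDiff_snd).add (contDiff_fst.smul (hWs.comp contDiff_snd)))

lemma contMDiff_variation {f : Euc m → Sph n} (hf : IsSmooth f) {W : Euc m → Euc (n + 1)}
    (hW : IsTangentField f W) :
    ContMDiff 𝓘(ℝ, ℝ × Euc m) (𝓡 n) ∞ (fun p : ℝ × Euc m => variation hW p.1 p.2) := by
  have : Fact (Module.finrank ℝ (Euc (n + 1)) = n + 1) := ⟨by simp⟩
  exact ContMDiff.codRestrict_sphere (contDiff_variation_uncurried hf hW).contMDiff _

lemma isSmooth_variation {f : Euc m → Sph n} (hf : IsSmooth f) {W : Euc m → Euc (n + 1)}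
    (hW : IsTangentField f W) (s : ℝ) : IsSmooth (variation hW s) := by
  have : Fact (Module.finrank ℝ (Euc (n + 1)) = n + 1) := ⟨by simp⟩
  have h : ContDiff ℝ ∞ (fun x : Euc m =>
      (√(1 + s ^ 2 * ‖W x‖ ^ 2))⁻¹ • (ambient f x + s • W x)) :=
    (contDiff_variation_uncurried hf hW).comp (contDiff_const.prodMk contDiff_id)
  exact ContMDiff.codRestrict_sphere h.contMDiff _

lemma variation_eq_of_eq_zero {f : Euc m → Sph n} {W : Euc m → Euc (n + 1)}
    (hW : IsTangentField f W) (s : ℝ) {x : Euc m} (hx : W x = 0) : variation hW s x = f x := by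
  apply Subtype.ext
  simp [variation, hx, ambient]

lemma variation_zero {f : Euc m → Sph n} {W : Euc m → Euc (n + 1)} (hW : IsTangentField f W) :
    variation hW 0 = f := by
  funext x
  apply Subtype.ext
  simp [variation, ambient]

lemma isCompactVariation_variation {f : Euc m → Sph n} (hf : IsSmooth f)
    {W : Euc m → Euc (n + 1)} (hW : IsTangentField f W) : IsCompactVariation f (variation hW) :=
  ⟨contMDiff_variation hf hW, variation_zero hW, tsupport W, hW.compact, fun s _ hx =>
    variation_eq_of_eq_zero hW s (image_eq_zero_of_notMem_tsupport hx)⟩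

/-- Differentiating the normalizing factor gives only a radial vector, orthogonal to the derivative
d of the sphere-valued map. Pairing d with itself discards that term, and Cauchy-Schwarz finishes.
-/
lemma norm_fderiv_variation_le {f : Euc m → Sph n} (hf : IsSmooth f) {W : Euc m → Euc (n + 1)}
    (hW : IsTangentField f W) (s : ℝ) (x v : Euc m) :
    ‖fderiv ℝ (ambient (variation hW s)) x v‖ ≤ (√(1 + s ^ 2 * ‖W x‖ ^ 2))⁻¹ *
      ‖fderiv ℝ (ambient f) x v + s • fderiv ℝ W x v‖ := by
  have hs := inner_ambient_fderiv (isSmooth_variation hf hW s) x v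
  have hud := (contDiff_ambient hf).differentiable (by simp) x
  have hWd := hW.smooth.differentiable (by simp) x
  have hU : HasFDerivAt (fun x => ambient f x + s • W x)
      (fderiv ℝ (ambient f) x + s • fderiv ℝ W x) x :=
    hud.hasFDerivAt.add (hWd.hasFDerivAt.const_smul s)
  have hρ : ContDiff ℝ ∞ (fun x : Euc m => (√(1 + s ^ 2 * ‖W x‖ ^ 2))⁻¹) :=
    ((contDiff_const.add (contDiff_const.mul (hW.smooth.norm_sq ℝ))).sqrt
      fun x => by positivity).inv fun x => by positivity
  have hD := ((hρ.differentiable (by simp) x).hasFDerivAt.fun_smul hU).fderiv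
  rw [← ambient_variation hW s] at hD
  set r := (√(1 + s ^ 2 * ‖W x‖ ^ 2))⁻¹ with hr
  have hr0 : 0 < r := by positivity
  set d := fderiv ℝ (ambient (variation hW s)) x v with hd
  have hd' : d = r • (fderiv ℝ (ambient f) x v + s • fderiv ℝ W x v) +
      (fderiv ℝ (fun x : Euc m => (√(1 + s ^ 2 * ‖W x‖ ^ 2))⁻¹) x v) •
        (ambient f x + s • W x) := by
    rw [hd, hD]
    simp
  have hsU : ⟪ambient f x + s • W x, d⟫_ℝ = 0 := by
    have : ambient f x + s • W x = r⁻¹ • ambient (variation hW s) x := by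
      rw [ambient_variation, smul_smul, ← hr, inv_mul_cancel₀ hr0.ne', one_smul]
    rw [this, inner_smul_left, hs, mul_zero]
  have hsq : ‖d‖ ^ 2 ≤ (r * ‖fderiv ℝ (ambient f) x v + s • fderiv ℝ W x v‖) * ‖d‖ := by
    have h1 : ‖d‖ ^ 2 = r * ⟪fderiv ℝ (ambient f) x v + s • fderiv ℝ W x v, d⟫_ℝ := by
      rw [← real_inner_self_eq_norm_sq]
      conv_lhs => enter [2]; rw [hd']
      rw [inner_add_left, inner_smul_left, inner_smul_left, hsU]
      simp
    rw [h1, mul_assoc]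
    exact mul_le_mul_of_nonneg_left (real_inner_le_norm _ _) hr0.le
  rcases (norm_nonneg d).eq_or_lt with h0 | h0
  · rw [← h0]; positivity
  · rw [sq] at hsq
    exact le_of_mul_le_mul_right hsq h0

/-- The pairing `⟨Tu, ∇W⟩`. -/
def energyPairing (u W : Euc m → Euc (n + 1)) (x : Euc m) : ℝ :=
  ∑ b : Fin m, ⟪fderiv ℝ u x (EuclideanSpace.single b 1),
    fderiv ℝ W x (EuclideanSpace.single b 1)⟫_ℝ

/-- A bound for the third order remainder of the energy density along `variation`. -/
def energyRemainder (u W : Euc m → Euc (n + 1)) (x : Euc m) : ℝ :=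
  ‖W x‖ ^ 2 * (2 * |energyPairing u W x| + energyDensity W x) +
    (‖W x‖ ^ 2) ^ 2 * (energyDensity u x + 2 * |energyPairing u W x| + energyDensity W x)

lemma energyRemainder_nonneg (u W : Euc m → Euc (n + 1)) (x : Euc m) :
    0 ≤ energyRemainder u W x := by
  have h1 := energyDensity_nonneg u x
  have h2 := energyDensity_nonneg W x
  unfold energyRemainder
  positivity

/-- With z = s²|W|², the density is at most (1+z)⁻¹ times that of f + sW, and (1+z)⁻¹ ≤ 1 - z + z².
Tangency of W makes z purely quadratic in s, which yields the term -s² e|W|². -/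
lemma energyDensity_variation_le {f : Euc m → Sph n} (hf : IsSmooth f) {W : Euc m → Euc (n + 1)}
    (hW : IsTangentField f W) {s : ℝ} (hs : |s| ≤ 1) (x : Euc m) :
    energyDensity (ambient (variation hW s)) x ≤ energyDensity (ambient f) x +
      2 * s * energyPairing (ambient f) W x +
      s ^ 2 * (energyDensity W x - energyDensity (ambient f) x * ‖W x‖ ^ 2) +
      |s| ^ 3 * energyRemainder (ambient f) W x := by
  set z := s ^ 2 * ‖W x‖ ^ 2 with hz
  have hz0 : 0 ≤ z := by positivity
  set N := energyDensity (ambient f) x + 2 * s * energyPairing (ambient f) W x +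
    s ^ 2 * energyDensity W x with hN
  have h1 : energyDensity (ambient (variation hW s)) x ≤ (1 + z)⁻¹ * N := by
    have : N = ∑ b : Fin m, ‖fderiv ℝ (ambient f) x (EuclideanSpace.single b 1) +
        s • fderiv ℝ W x (EuclideanSpace.single b 1)‖ ^ 2 := by
      simp only [hN, energyDensity, energyPairing, Finset.mul_sum, ← Finset.sum_add_distrib]
      refine Finset.sum_congr rfl fun b _ => ?_
      rw [norm_add_sq_real, inner_smul_right, norm_smul, mul_pow, Real.norm_eq_abs, sq_abs]
      ring
    rw [this, energyDensity, Finset.mul_sum]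
    refine Finset.sum_le_sum fun b _ => ?_
    refine (pow_le_pow_left₀ (norm_nonneg _) (norm_fderiv_variation_le hf hW s x _) 2).trans_eq ?_
    rw [mul_pow, inv_pow, Real.sq_sqrt (by positivity)]
  have hN0 : 0 ≤ N := by
    have h2 : 0 ≤ (1 + z)⁻¹ * N := (energyDensity_nonneg _ _).trans h1
    exact nonneg_of_mul_nonneg_right h2 (by positivity)
  have h3 : (1 + z)⁻¹ * N ≤ (1 - z + z ^ 2) * N := by
    refine mul_le_mul_of_nonneg_right ?_ hN0
    rw [inv_le_iff_one_le_mul₀ (by positivity)]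
    nlinarith [pow_nonneg hz0 3]
  refine h1.trans (h3.trans ?_)
  have he := energyDensity_nonneg (ambient f) x
  have hE := energyDensity_nonneg W x
  unfold energyRemainder
  set e := energyDensity (ambient f) x
  set E := energyDensity W x
  set X := energyPairing (ambient f) W x
  set w := ‖W x‖ ^ 2 with hw
  have hw0 : 0 ≤ w := by positivity
  have hs0 := abs_nonneg s
  have hss : s ^ 2 = |s| ^ 2 := (sq_abs s).symm
  have hsX : -(|s| * |X|) ≤ s * X := by rw [← abs_mul]; exact neg_abs_le _
  have hsX' : s * X ≤ |s| * |X| := by rw [← abs_mul]; exact le_abs_self _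
  have hXn := abs_nonneg X
  have p3 : |s| ^ 3 ≤ 1 := pow_le_one₀ hs0 hs
  have p2 : |s| ^ 2 ≤ 1 := pow_le_one₀ hs0 hs
  have p43 : |s| ^ 4 ≤ |s| ^ 3 := pow_le_pow_of_le_one hs0 hs (by norm_num)
  have hNle : N ≤ e + 2 * |X| + E := by
    have h4 : |s| * |X| ≤ |X| := mul_le_of_le_one_left hXn hs
    have h5 : s ^ 2 * E ≤ E := by rw [hss]; exact mul_le_of_le_one_left hE p2
    linarith
  have t1 : z ^ 2 * N ≤ |s| ^ 3 * (w ^ 2 * (e + 2 * |X| + E)) := by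
    have : z ^ 2 * N = |s| ^ 4 * (w ^ 2 * N) := by rw [hz, hss]; ring
    rw [this]
    gcongr
  have t2 : -(z * (2 * s * X + s ^ 2 * E)) ≤ |s| ^ 3 * (w * (2 * |X| + E)) := by
    have a1 : -(z * (2 * s * X)) ≤ |s| ^ 3 * (w * (2 * |X|)) := by
      have : |s| ^ 3 * (w * (2 * |X|)) = 2 * z * (|s| * |X|) := by rw [hz, hss]; ring
      rw [this]
      nlinarith [mul_nonneg hz0 (by linarith : 0 ≤ |s| * |X| + s * X)]
    have a2 : 0 ≤ z * (s ^ 2 * E) := by positivity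
    have a3 : 0 ≤ |s| ^ 3 * (w * E) := by positivity
    nlinarith
  have : (1 - z + z ^ 2) * N = e + 2 * s * X + s ^ 2 * (E - e * w) +
      -(z * (2 * s * X + s ^ 2 * E)) + z ^ 2 * N := by
    rw [hN, hz]; ring
  rw [this]
  linarith

lemma fderiv_gauss_smul {W : Euc m → Euc (n + 1)} (hW : ContDiff ℝ ∞ W) (y : Euc m) (t : ℝ)
    (x v : Euc m) : fderiv ℝ (fun x => gauss y t x • W x) x v =
      gauss y t x • fderiv ℝ W x v - (gauss y t x * ⟪x - y, v⟫_ℝ / (2 * t)) • W x := by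
  rw [fderiv_fun_smul ((contDiff_gauss y t).differentiable (by simp) x)
    (hW.differentiable (by simp) x)]
  simp [fderiv_gauss, sub_eq_add_neg]

lemma sum_inner_fderiv_gauss_smul {W : Euc m → Euc (n + 1)} (hW : ContDiff ℝ ∞ W)
    (u : Euc m → Euc (n + 1)) (y : Euc m) (t : ℝ) (x : Euc m) :
    ∑ b : Fin m, ⟪fderiv ℝ u x (EuclideanSpace.single b 1),
      fderiv ℝ (fun x => gauss y t x • W x) x (EuclideanSpace.single b 1)⟫_ℝ =
      energyPairing u W x * gauss y t x -
        gauss y t x / (2 * t) * ⟪fderiv ℝ u x (x - y), W x⟫_ℝ := by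
  rw [map_eq_sum_single (fderiv ℝ u x) (x - y), sum_inner, energyPairing,
    Finset.sum_mul, Finset.mul_sum, ← Finset.sum_sub_distrib]
  refine Finset.sum_congr rfl fun b _ => ?_
  rw [fderiv_gauss_smul hW, inner_sub_right, inner_smul_right, inner_smul_right, inner_smul_left,
    EuclideanSpace.inner_single_right]
  simp only [conj_trivial, one_mul]
  ring

/-- The first variation of the Gaussian energy at a soliton. -/
lemma IsSoliton.integral_energyPairing {f : Euc m → Sph n} (hf : IsSoliton f)
    {W : Euc m → Euc (n + 1)} (hW : IsTangentField f W) (y : Euc m) {a t : ℝ} (ht : t = 1 + a)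
    (ht0 : 0 < t) :
    t * ∫ x, energyPairing (ambient f) W x * gauss y t x =
      ∫ x, -(2⁻¹ * ⟪W x, a • fderiv ℝ (ambient f) x x + fderiv ℝ (ambient f) x y⟫_ℝ) *
        gauss y t x := by
  have hu := contDiff_ambient hf.1
  have hG := contDiff_gauss y t
  -- The test field is GW. The soliton equation contributes x/2 and the gradient of G contributes
  -- (x-y)/(2t); their difference multiplied by t = 1 + a is (ax + y)/2.
  have hV : ContDiff ℝ ∞ (fun x => gauss y t x • W x) := hG.smul hW.smooth
  have hVc : HasCompactSupport (fun x => gauss y t x • W x) := 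
    HasCompactSupport.intro hW.compact fun x hx => by simp [image_eq_zero_of_notMem_tsupport hx]
  have hV1 : ContDiff ℝ 1 (fun x => gauss y t x • W x) := hV.of_le (by exact_mod_cast le_top)
  have hfv := integral_sum_inner_fderiv hu hV1 hVc
  obtain ⟨hi1, hi2⟩ := integrable_first_variation hu hV1 hVc
  rw [eq_neg_iff_add_eq_zero, ← integral_add hi1 hi2] at hfv
  have hi := (hi1.add hi2).const_mul t
  simp only [Pi.add_apply, sum_inner_fderiv_gauss_smul hW.smooth, inner_smul_right] at hi hfv
  have hDu : Continuous (fderiv ℝ (ambient f)) := hu.continuous_fderiv (by simp)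
  have hGc := hG.continuous
  have hWc := hW.smooth.continuous
  have hi3 : Integrable (fun x => -(2⁻¹ * ⟪W x, a • fderiv ℝ (ambient f) x x +
      fderiv ℝ (ambient f) x y⟫_ℝ) * gauss y t x) := by
    refine (Continuous.integrable_of_hasCompactSupport (by fun_prop) ?_)
    refine HasCompactSupport.intro hW.compact fun x hx => ?_
    simp [image_eq_zero_of_notMem_tsupport hx]
  have hsum := integral_add hi hi3
  rw [integral_const_mul, hfv, mul_zero, zero_add] at hsum
  rw [← integral_const_mul, ← hsum]
  refine integral_congr_ae (Eventually.of_forall fun x => ?_)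
  simp only
  rw [hf.inner_laplacian x (hW.tangent x), map_smul, map_sub,
    inner_smul_left, inner_sub_left, inner_add_right, inner_smul_right,
    real_inner_comm (fderiv ℝ (ambient f) x x) (W x),
    real_inner_comm (fderiv ℝ (ambient f) x y) (W x), conj_trivial]
  generalize ⟪fderiv ℝ (ambient f) x x, W x⟫_ℝ = A
  generalize ⟪fderiv ℝ (ambient f) x y, W x⟫_ℝ = B
  generalize energyPairing (ambient f) W x = D
  generalize gauss y t x = G
  field_simp
  rw [ht]
  ring

end Variation

/-! ### A negative stability form lowers the entropy. -/

section Instability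

variable {m n : ℕ}

/-- The quadratic form whose negativity makes a tangent field destabilizing. -/
def stabilityForm (u W : Euc m → Euc (n + 1)) : ℝ :=
  ∫ x, (3 / 4 * ‖W x‖ ^ 2 + 2⁻¹ * (energyDensity W x - energyDensity u x * ‖W x‖ ^ 2)) *
    gauss 0 1 x

/-- This is the source of the constant 3/4. With c = s/κ and P = ap, the left side is maximized over
P and z at P = -6cw, z = 3cw, with value (3/4)κc²‖w‖². The two squares in the proof vanish there, so
the bound is sharp over independent P and z. -/
lemma neg_inner_sub_le {V : Type*} [NormedAddCommGroup V] [InnerProductSpace ℝ V] (w p z : V)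
    {κ : ℝ} (hκ : 0 < κ) (s a : ℝ) :
    s * -(2⁻¹ * ⟪w, a • p + z⟫_ℝ) - κ / 2 * (a ^ 2 / 4 * ‖p‖ ^ 2 + 2 * a / 3 * ⟪p, z⟫_ℝ +
      2⁻¹ * ‖z‖ ^ 2) ≤ s ^ 2 * (3 / 4 / κ * ‖w‖ ^ 2) := by
  obtain ⟨c, rfl⟩ : ∃ c, s = κ * c := ⟨s / κ, by field_simp⟩
  have h1 := sq_nonneg ‖(a / 2) • p + (2 / 3 : ℝ) • z + c • w‖
  have h2 := sq_nonneg ‖(1 / 6 : ℝ) • z - (c / 2) • w‖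
  rw [← real_inner_self_eq_norm_sq] at h1 h2
  simp only [inner_add_left, inner_add_right, inner_sub_left, inner_sub_right, inner_smul_left,
    inner_smul_right, conj_trivial, real_inner_self_eq_norm_sq, real_inner_comm p z,
    real_inner_comm w p, real_inner_comm w z] at h1 h2
  rw [inner_add_right, inner_smul_right]
  have e : (κ * c) ^ 2 * (3 / 4 / κ * ‖w‖ ^ 2) = κ * (3 / 4 * c ^ 2 * ‖w‖ ^ 2) := by
    field_simp
  rw [e, ← sub_nonneg]
  have := mul_nonneg hκ.le (add_nonneg (mul_nonneg (by norm_num : (0 : ℝ) ≤ 1 / 2) h1) h2)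
  refine this.trans_eq ?_
  ring

lemma integrable_mul_gauss_of_compact {W : Euc m → Euc (n + 1)} (hc : HasCompactSupport W)
    {h : Euc m → ℝ} (hh : Continuous h) (h0 : ∀ x ∉ tsupport W, h x = 0) (y : Euc m) (t : ℝ) :
    Integrable (fun x => h x * gauss y t x) := by
  have hG := continuous_gauss y t
  exact (Continuous.integrable_of_hasCompactSupport (by fun_prop))
    (HasCompactSupport.intro hc fun x hx => by simp [h0 x hx])

lemma continuous_energyPairing {u W : Euc m → Euc (n + 1)} (hu : ContDiff ℝ ∞ u)
    (hW : ContDiff ℝ ∞ W) : Continuous (energyPairing u W) := by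
  have h1 : Continuous (fderiv ℝ u) := hu.continuous_fderiv (by simp)
  have h2 : Continuous (fderiv ℝ W) := hW.continuous_fderiv (by simp)
  unfold energyPairing
  fun_prop

lemma continuous_energyRemainder {u W : Euc m → Euc (n + 1)} (hu : ContDiff ℝ ∞ u)
    (hW : ContDiff ℝ ∞ W) : Continuous (energyRemainder u W) := by
  have h1 := continuous_energyPairing hu hW
  have h2 := (contDiff_energyDensity hu).continuous
  have h3 := (contDiff_energyDensity hW).continuous
  have h4 := hW.continuous
  unfold energyRemainder
  fun_prop

lemma energyPairing_eq_zero {W : Euc m → Euc (n + 1)} (u : Euc m → Euc (n + 1)) {x : Euc m}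
    (hx : x ∉ tsupport W) : energyPairing u W x = 0 := by
  simp [energyPairing, fderiv_of_notMem_tsupport (𝕜 := ℝ) hx]

lemma energyDensity_eq_zero {W : Euc m → Euc (n + 1)} {x : Euc m} (hx : x ∉ tsupport W) :
    energyDensity W x = 0 := by
  simp [energyDensity, fderiv_of_notMem_tsupport (𝕜 := ℝ) hx]

lemma energyRemainder_eq_zero {W : Euc m → Euc (n + 1)} (u : Euc m → Euc (n + 1)) {x : Euc m}
    (hx : x ∉ tsupport W) : energyRemainder u W x = 0 := by
  simp [energyRemainder, image_eq_zero_of_notMem_tsupport hx]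

set_option maxHeartbeats 1000000 in
/-- Near `(0, 1)`, a destabilizing variation lowers the Gaussian energy quadratically. -/
lemma IsSoliton.exists_functionalF_variation_le_near {f : Euc m → Sph n} (hf : IsSoliton f)
    (hfin : entropy f ≠ ⊤) {W : Euc m → Euc (n + 1)} (hW : IsTangentField f W)
    (hq : stabilityForm (ambient f) W < 0) :
    ∃ r : ℝ, 0 < r ∧ r < 1 ∧ ∃ s₀ : ℝ, 0 < s₀ ∧ ∀ s : ℝ, |s| < s₀ →
      ∀ (y : Euc m) (a : ℝ), ‖y‖ ^ 2 + |a| ≤ r →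
      functionalF y (1 + a) (variation hW s) ≤ ENNReal.ofReal
        (gaussEnergy (energyDensity (ambient f)) 0 1 +
          s ^ 2 * (stabilityForm (ambient f) W / 4)) := by
  have hu := contDiff_ambient hf.1
  set u := ambient f with hudef
  set q := stabilityForm u W with hqdef
  set w : Euc m → ℝ := fun x => ‖W x‖ ^ 2 with hw
  set d : Euc m → ℝ := fun x => energyDensity W x - energyDensity u x * ‖W x‖ ^ 2 with hd
  set X := energyPairing u W with hX
  set B := energyRemainder u W with hB
  have hDu : Continuous (fderiv ℝ u) := hu.continuous_fderiv (by simp)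
  have hWc := hW.smooth.continuous
  have hec := (contDiff_energyDensity hu).continuous
  have hwc : Continuous w := by fun_prop
  have hdc : Continuous d := by
    have h3 := (contDiff_energyDensity hW.smooth).continuous
    fun_prop
  have hXc : Continuous X := continuous_energyPairing hu hW.smooth
  have hBc : Continuous B := continuous_energyRemainder hu hW.smooth
  have hw0 : ∀ x ∉ tsupport W, w x = 0 := fun x hx => by
    simp [hw, image_eq_zero_of_notMem_tsupport hx]
  have hd0 : ∀ x ∉ tsupport W, d x = 0 := fun x hx => by
    simp [hd, image_eq_zero_of_notMem_tsupport hx, energyDensity_eq_zero hx]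
  have hX0 : ∀ x ∉ tsupport W, X x = 0 := fun x hx => energyPairing_eq_zero u hx
  have hB0 : ∀ x ∉ tsupport W, B x = 0 := fun x hx => energyRemainder_eq_zero u hx
  have hwi := integrable_mul_gauss_of_compact hW.compact hwc hw0
  have hdi := integrable_mul_gauss_of_compact hW.compact hdc hd0
  have hai := integrable_mul_gauss_of_compact hW.compact hdc.abs
    (fun x hx => by rw [hd0 x hx, abs_zero])
  have hXi := integrable_mul_gauss_of_compact hW.compact hXc hX0
  have hBi := integrable_mul_gauss_of_compact hW.compact hBc hB0
  set Iw := ∫ x, w x * gauss 0 1 x with hIw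
  set Id := ∫ x, d x * gauss 0 1 x with hId
  set Ia := ∫ x, |d x| * gauss 0 1 x with hIa
  set IB := ∫ x, B x * gauss 0 1 x with hIB
  have hG0 : ∀ x : Euc m, 0 < gauss 0 1 x := gauss_pos 0 one_pos
  have hBnn : ∀ x, 0 ≤ B x := energyRemainder_nonneg u W
  have hIB0 : 0 ≤ IB := integral_nonneg fun x => mul_nonneg (hBnn x) (hG0 x).le
  have hqI : q = 3 / 4 * Iw + 2⁻¹ * Id := by
    rw [hqdef, stabilityForm, hIw, hId, ← integral_const_mul, ← integral_const_mul,
      ← integral_add ((hwi 0 1).const_mul _) ((hdi 0 1).const_mul _)]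
    refine integral_congr_ae (Eventually.of_forall fun x => ?_)
    simp only [hw, hd]
    ring
  -- At ε = 0 the expression equals q, and q < q/2 because q < 0; continuity gives a positive ε.
  obtain ⟨ε, hε0, hε1, hεq⟩ : ∃ ε : ℝ, 0 < ε ∧ ε < 1 / 3 ∧
      3 / 4 / (1 - 3 * ε) * ((1 + ε) * Iw) + 2⁻¹ * (Id + 3 * ε * Ia) < q / 2 := by
    have hc : ContinuousAt (fun ε : ℝ =>
        3 / 4 / (1 - 3 * ε) * ((1 + ε) * Iw) + 2⁻¹ * (Id + 3 * ε * Ia)) 0 := by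
      refine ContinuousAt.add (ContinuousAt.mul (ContinuousAt.div (by fun_prop) (by fun_prop)
        (by norm_num)) (by fun_prop)) (by fun_prop)
    have hlt := hc.eventually_lt (continuousAt_const (y := q / 2)) (by
      simp only [mul_zero, sub_zero, div_one, add_zero, one_mul, zero_mul]
      rw [← hqI]; linarith)
    have hlt' : ∀ᶠ ε : ℝ in 𝓝[>] 0, ε < 1 / 3 :=
      nhdsWithin_le_nhds (Iio_mem_nhds (by norm_num))
    obtain ⟨ε, ⟨h1, h2⟩, h3⟩ := (((hlt.filter_mono nhdsWithin_le_nhds).and hlt').and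
      (self_mem_nhdsWithin (s := Ioi (0 : ℝ)))).exists
    exact ⟨ε, h3, h2, h1⟩
  obtain ⟨r, hr, hr1, hdec⟩ := hf.exists_gaussEnergy_decay hfin hW.compact hε0 hε1
  -- This bound on |s| keeps the cubic remainder below -q s²/4, half of the gain q s²/2.
  refine ⟨r, hr, hr1, min 1 (-q / (4 * (IB + 1))), ?_, ?_⟩
  · exact lt_min one_pos (div_pos (by linarith) (by positivity))
  intro s hs y a hya
  have hs1 : |s| ≤ 1 := hs.le.trans (min_le_left _ _)
  have hs2 : |s| * (4 * (IB + 1)) ≤ -q := by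
    rw [← le_div_iff₀ (by positivity)]
    exact hs.le.trans (min_le_right _ _)
  obtain ⟨hcomp, haε, hdecay⟩ := hdec y a hya
  obtain ⟨haε1, haε2⟩ := abs_le.1 haε
  obtain ⟨t, ht⟩ : ∃ t, t = 1 + a := ⟨_, rfl⟩
  rw [← ht] at hdecay hcomp ⊢
  have ht0 : 0 < t := by linarith
  set κ := 1 - 3 * ε with hκ
  have hκ0 : 0 < κ := by linarith
  set G := gauss y t with hG
  have hGc : Continuous G := continuous_gauss y t
  have hei : Integrable (fun x => energyDensity u x * G x) :=
    integrable_energy_gauss hf.1 hfin y ht0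
  set h : Euc m → ℝ := fun x => energyDensity u x + 2 * s * X x + s ^ 2 * d x + |s| ^ 3 * B x
    with hh
  have hhG : ∀ x, h x * G x = 1 * (energyDensity u x * G x) + 2 * s * (X x * G x) +
      s ^ 2 * (d x * G x) + |s| ^ 3 * (B x * G x) := fun x => by simp only [hh]; ring
  have hi3 : Integrable (fun x => 1 * (energyDensity u x * G x) + 2 * s * (X x * G x) +
      s ^ 2 * (d x * G x)) :=
    ((hei.const_mul 1).add ((hXi y t).const_mul _)).add ((hdi y t).const_mul _)
  have hiB := (hBi y t).const_mul (|s| ^ 3)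
  have hhi : Integrable (fun x => h x * G x) := by
    simp only [hhG]
    exact hi3.add hiB
  refine (functionalF_le_ofReal ht0 (energyDensity_variation_le hf.1 hW hs1) hhi).trans
    (ENNReal.ofReal_le_ofReal ?_)
  have hexpand : gaussEnergy h y t = gaussEnergy (energyDensity u) y t +
      s * (t * ∫ x, X x * G x) + s ^ 2 * (2⁻¹ * ∫ x, t * (d x * G x)) +
      |s| ^ 3 * (2⁻¹ * ∫ x, t * (B x * G x)) := by
    have e1 := integral_add hi3 hiB
    rw [integral_linear_combination hei (hXi y t) (hdi y t), integral_const_mul] at e1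
    rw [gaussEnergy, gaussEnergy, ← hG]
    simp only [hhG]
    rw [e1, integral_const_mul, integral_const_mul]
    ring
  -- The first variation is linear in s and need not be O(s²) uniformly in (y,a); the decay of the
  -- unperturbed energy absorbs it pointwise on the support of W.
  have hfirst : s * (t * ∫ x, X x * G x) - κ / 2 * ∫ x in tsupport W, decayDensity u y a x * G x ≤
      s ^ 2 * (3 / 4 / κ * ((1 + ε) * Iw)) := by
    rw [hX, hG, hf.integral_energyPairing hW y ht ht0, ← setIntegral_eq_integral_of_forall_compl_eq_zero
      (s := tsupport W) (fun x hx => by simp [image_eq_zero_of_notMem_tsupport hx]),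
      hIw, ← setIntegral_eq_integral_of_forall_compl_eq_zero (f := fun x => w x * gauss 0 1 x)
      (s := tsupport W) (fun x hx => by simp [hw0 x hx]), ← hG]
    have hq := continuous_decayDensity hu y a
    have hG1 := continuous_gauss (0 : Euc m) 1
    rw [← integral_const_mul, ← integral_const_mul, ← integral_const_mul, ← integral_const_mul,
      ← integral_const_mul, ← integral_sub]
    · refine setIntegral_mono_on ?_ ?_ hW.compact.measurableSet fun x hx => ?_
      · exact ContinuousOn.integrableOn_compact hW.compact (by fun_prop)
      · exact ContinuousOn.integrableOn_compact hW.compact (by fun_prop)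
      · have hp := neg_inner_sub_le (W x) (fderiv ℝ u x x) (fderiv ℝ u x y) hκ0 s a
        have hGx : 0 < G x := gauss_pos y ht0 x
        have h2 := (hcomp x hx).2
        calc _ = (s * -(2⁻¹ * ⟪W x, a • fderiv ℝ u x x + fderiv ℝ u x y⟫_ℝ) -
              κ / 2 * decayDensity u y a x) * G x := by ring
          _ ≤ (s ^ 2 * (3 / 4 / κ * w x)) * G x := mul_le_mul_of_nonneg_right hp hGx.le
          _ ≤ (s ^ 2 * (3 / 4 / κ * w x)) * ((1 + ε) * gauss 0 1 x) := by
            refine mul_le_mul_of_nonneg_left h2 ?_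
            simp only [hw]; positivity
          _ = _ := by ring
    · exact ContinuousOn.integrableOn_compact hW.compact (by fun_prop)
    · exact ContinuousOn.integrableOn_compact hW.compact (by fun_prop)
  have htG : ∀ x ∈ tsupport W, |t * G x - gauss 0 1 x| ≤ 3 * ε * gauss 0 1 x := by
    intro x hx
    obtain ⟨c1, c2⟩ := hcomp x hx
    have hg := hG0 x
    have hGx : 0 < G x := gauss_pos y ht0 x
    have t1 : 1 - ε ≤ t := by linarith
    have t2 : t ≤ 1 + ε := by linarith
    rw [abs_le]
    constructor
    · have : (1 - ε) * ((1 - ε) * gauss 0 1 x) ≤ t * G x := by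
        refine mul_le_mul t1 c1 ?_ ht0.le
        exact mul_nonneg (by linarith) hg.le
      nlinarith [mul_pos hε0 hg, mul_pos (mul_pos hε0 hε0) hg]
    · have : t * G x ≤ (1 + ε) * ((1 + ε) * gauss 0 1 x) :=
        mul_le_mul t2 c2 hGx.le (by linarith)
      nlinarith [mul_pos hε0 hg, mul_pos (mul_pos hε0 hε0) hg]
  have hsecond : ∫ x, t * (d x * G x) ≤ Id + 3 * ε * Ia := by
    rw [hId, hIa, ← integral_const_mul, ← integral_add (hdi 0 1) ((hai 0 1).const_mul _)]
    refine integral_mono ((hdi y t).const_mul t) ((hdi 0 1).add ((hai 0 1).const_mul _))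
      fun x => ?_
    by_cases hx : x ∈ tsupport W
    · have h1 : d x * (t * G x - gauss 0 1 x) ≤ |d x| * (3 * ε * gauss 0 1 x) := by
        refine (le_abs_self _).trans ?_
        rw [abs_mul]
        exact mul_le_mul_of_nonneg_left (htG x hx) (abs_nonneg _)
      simp only
      linarith
    · simp [hd0 x hx]
  have hthird : 2⁻¹ * ∫ x, t * (B x * G x) ≤ IB := by
    have : ∫ x, t * (B x * G x) ≤ ∫ x, 2 * (B x * gauss 0 1 x) := by
      refine integral_mono ((hBi y t).const_mul t) ((hBi 0 1).const_mul _) fun x => ?_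
      by_cases hx : x ∈ tsupport W
      · have h1 := (abs_le.1 (htG x hx)).2
        have h2 : t * G x ≤ 2 * gauss 0 1 x := by nlinarith [hG0 x]
        have := mul_le_mul_of_nonneg_left h2 (hBnn x)
        simp only
        linarith
      · simp [hB0 x hx]
    rw [integral_const_mul 2] at this
    linarith
  rw [hexpand]
  have s3 : |s| ^ 3 * (2⁻¹ * ∫ x, t * (B x * G x)) ≤ s ^ 2 * (-q / 4) := by
    calc |s| ^ 3 * (2⁻¹ * ∫ x, t * (B x * G x)) ≤ |s| ^ 3 * IB := by gcongr
      _ = s ^ 2 * (|s| * IB) := by rw [← sq_abs s]; ring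
      _ ≤ s ^ 2 * (-q / 4) := by
        gcongr
        nlinarith [abs_nonneg s]
  have s2 : s ^ 2 * (2⁻¹ * ∫ x, t * (d x * G x)) ≤ s ^ 2 * (2⁻¹ * (Id + 3 * ε * Ia)) := by gcongr
  have s1 : s ^ 2 * (3 / 4 / κ * ((1 + ε) * Iw) + 2⁻¹ * (Id + 3 * ε * Ia)) ≤ s ^ 2 * (q / 2) := by
    gcongr
  linarith

/-- A compactly supported variation changes the Gaussian energies uniformly little. -/
lemma exists_functionalF_variation_le {f : Euc m → Sph n} (hf : IsSmooth f)
    (hfin : entropy f ≠ ⊤) (hm : 2 ≤ m) {W : Euc m → Euc (n + 1)} (hW : IsTangentField f W) :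
    ∃ L : ℝ, ∀ s : ℝ, |s| ≤ 1 → ∀ (y : Euc m) (t : ℝ), 0 < t →
      functionalF y t (variation hW s) ≤ ENNReal.ofReal
        (gaussEnergy (energyDensity (ambient f)) y t + |s| * L) := by
  have hu := contDiff_ambient hf
  set u := ambient f with hudef
  set b : Euc m → ℝ := fun x => 2 * |energyPairing u W x| +
    |energyDensity W x - energyDensity u x * ‖W x‖ ^ 2| + energyRemainder u W x with hb
  have hbc : Continuous b := by
    have h1 := continuous_energyPairing hu hW.smooth
    have h2 := continuous_energyRemainder hu hW.smooth
    have h3 := (contDiff_energyDensity hW.smooth).continuous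
    have h4 := (contDiff_energyDensity hu).continuous
    have h5 := hW.smooth.continuous
    fun_prop
  have hb0 : ∀ x ∉ tsupport W, b x = 0 := fun x hx => by
    simp [hb, image_eq_zero_of_notMem_tsupport hx, energyDensity_eq_zero hx,
      energyPairing_eq_zero u hx, energyRemainder_eq_zero u hx]
  have hbn : ∀ x, 0 ≤ b x := fun x => by
    have := energyRemainder_nonneg u W x
    simp only [hb]; positivity
  have hbs : HasCompactSupport b := HasCompactSupport.intro hW.compact hb0
  have hbi : Integrable b := hbc.integrable_of_hasCompactSupport hbs
  obtain ⟨C, hC⟩ := hbs.exists_bound_of_continuous hbc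
  have hC0 : 0 ≤ C := (norm_nonneg _).trans (hC 0)
  have hI0 : 0 ≤ ∫ x, b x := integral_nonneg hbn
  refine ⟨C + ∫ x, b x, fun s hs y t ht => ?_⟩
  have hei : Integrable (fun x => energyDensity u x * gauss y t x) :=
    integrable_energy_gauss hf hfin y ht
  have hbG := integrable_mul_gauss_of_compact hW.compact hbc hb0 y t
  have hle : ∀ x, energyDensity (ambient (variation hW s)) x ≤ energyDensity u x + |s| * b x := by
    intro x
    refine (energyDensity_variation_le hf hW hs x).trans ?_
    have hR := energyRemainder_nonneg u W x
    have hs0 := abs_nonneg s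
    have a1 : 2 * s * energyPairing u W x ≤ |s| * (2 * |energyPairing u W x|) := by
      have := le_abs_self (s * energyPairing u W x)
      rw [abs_mul] at this
      linarith
    have a2 : s ^ 2 * (energyDensity W x - energyDensity u x * ‖W x‖ ^ 2) ≤
        |s| * |energyDensity W x - energyDensity u x * ‖W x‖ ^ 2| := by
      have h1 : s ^ 2 ≤ |s| := by rw [← sq_abs]; nlinarith
      calc _ ≤ s ^ 2 * |energyDensity W x - energyDensity u x * ‖W x‖ ^ 2| := by
            gcongr; exact le_abs_self _
        _ ≤ _ := by gcongr
    have a3 : |s| ^ 3 * energyRemainder u W x ≤ |s| * energyRemainder u W x := by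
      gcongr
      exact pow_le_of_le_one hs0 hs (by norm_num)
    simp only [hb]
    linarith
  have hsum : Integrable (fun x => (energyDensity u x + |s| * b x) * gauss y t x) := by
    refine (hei.add (hbG.const_mul |s|)).congr (Eventually.of_forall fun x => ?_)
    simp only [Pi.add_apply]; ring
  refine (functionalF_le_ofReal ht hle hsum).trans (ENNReal.ofReal_le_ofReal ?_)
  have hexp : gaussEnergy (fun x => energyDensity u x + |s| * b x) y t =
      gaussEnergy (energyDensity u) y t + |s| * (t / 2 * ∫ x, b x * gauss y t x) := by
    have e1 := integral_add hei (hbG.const_mul |s|)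
    rw [integral_const_mul] at e1
    rw [gaussEnergy, gaussEnergy]
    have : ∀ x, (energyDensity u x + |s| * b x) * gauss y t x =
      energyDensity u x * gauss y t x + |s| * (b x * gauss y t x) := fun x => by ring
    simp only [this]
    rw [e1]
    ring
  rw [hexp]
  gcongr
  have hbG0 : 0 ≤ ∫ x, b x * gauss y t x :=
    integral_nonneg fun x => mul_nonneg (hbn x) (gauss_pos y ht x).le
  -- For t ≤ 1 the kernel has mass one and b is bounded. For t ≥ 1 and m ≥ 2 the kernel is at most
  -- 1/t, which cancels the prefactor t.
  rcases le_total t 1 with ht1 | ht1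
  · have h1 : ∫ x, b x * gauss y t x ≤ ∫ x, C * gauss y t x := by
      refine integral_mono hbG ((integrable_gauss y ht).const_mul C) fun x => ?_
      exact mul_le_mul_of_nonneg_right ((Real.le_norm_self _).trans (hC x)) (gauss_pos y ht x).le
    rw [integral_const_mul, integral_gauss y ht, mul_one] at h1
    nlinarith
  · have hpi := Real.pi_gt_three
    have hden : t ≤ (4 * Real.pi * t) ^ ((m : ℝ) / 2) := by
      have h1 : (1 : ℝ) ≤ 4 * Real.pi * t := by nlinarith
      have h2 : (4 * Real.pi * t) ^ (1 : ℝ) ≤ (4 * Real.pi * t) ^ ((m : ℝ) / 2) := by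
        refine Real.rpow_le_rpow_of_exponent_le h1 ?_
        rw [le_div_iff₀ (by norm_num)]
        exact_mod_cast (by omega : 1 * 2 ≤ m)
      rw [Real.rpow_one] at h2
      nlinarith
    have h1 : ∫ x, b x * gauss y t x ≤ ∫ x, t⁻¹ * b x := by
      refine integral_mono hbG (hbi.const_mul _) fun x => ?_
      simp only
      rw [mul_comm]
      refine mul_le_mul_of_nonneg_right ((gauss_le ht y x).trans ?_) (hbn x)
      exact inv_anti₀ ht hden
    rw [integral_const_mul] at h1
    have h2 : t / 2 * ∫ x, b x * gauss y t x ≤ t / 2 * (t⁻¹ * ∫ x, b x) := by gcongr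
    have h3 : t / 2 * (t⁻¹ * ∫ x, b x) = 2⁻¹ * ∫ x, b x := by field_simp
    linarith

/-- A destabilizing tangent field lowers the entropy of a noncylindrical soliton. -/
lemma IsSoliton.eventually_entropy_variation_lt {f : Euc m → Sph n} (hf : IsSoliton f)
    (hfin : entropy f ≠ ⊤) (hm : 2 ≤ m) (hcyl : ¬ IsCylindrical f)
    (hpos : 0 < gaussEnergy (energyDensity (ambient f)) 0 1) {W : Euc m → Euc (n + 1)}
    (hW : IsTangentField f W) (hq : stabilityForm (ambient f) W < 0) :
    ∀ᶠ s in 𝓝[≠] (0 : ℝ), entropy (variation hW s) < entropy f := by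
  set F₀ := gaussEnergy (energyDensity (ambient f)) 0 1 with hF₀
  set q := stabilityForm (ambient f) W with hqdef
  obtain ⟨r, hr, hr1, s₀, hs₀, hnear⟩ := hf.exists_functionalF_variation_le_near hfin hW hq
  obtain ⟨M, hM, hfar⟩ := hf.exists_gaussEnergy_le_lt hfin (by omega) hcyl hr hr1
  obtain ⟨L, hL⟩ := exists_functionalF_variation_le hf.1 hfin hm hW
  have e1 : ∀ᶠ s : ℝ in 𝓝 0, |s| < s₀ :=
    continuous_abs.continuousAt.eventually_lt continuousAt_const (by simpa using hs₀)
  have e2 : ∀ᶠ s : ℝ in 𝓝 0, |s| < 1 :=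
    continuous_abs.continuousAt.eventually_lt continuousAt_const (by simp)
  have e3 : ∀ᶠ s : ℝ in 𝓝 0, M + |s| * L < (M + F₀) / 2 :=
    ContinuousAt.eventually_lt (by fun_prop) continuousAt_const (by simp; linarith)
  filter_upwards [e1.filter_mono nhdsWithin_le_nhds, e2.filter_mono nhdsWithin_le_nhds,
    e3.filter_mono nhdsWithin_le_nhds, self_mem_nhdsWithin] with s h1 h2 h3 h4
  have hs : 0 < s ^ 2 := by
    have : s ≠ 0 := h4
    positivity
  have hle : entropy (variation hW s) ≤
      ENNReal.ofReal (max (F₀ + s ^ 2 * (q / 4)) ((M + F₀) / 2)) := by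
    refine iSup₂_le fun y t => iSup_le fun ht => ?_
    obtain ⟨a, rfl⟩ : ∃ a, t = 1 + a := ⟨t - 1, by ring⟩
    -- Both bounds are independent of (y,a), so the supremum itself stays strictly below F₀.
    rcases le_total (‖y‖ ^ 2 + |a|) r with hle | hle
    · exact (hnear s h1 y a hle).trans (ENNReal.ofReal_le_ofReal (le_max_left _ _))
    · refine (hL s h2.le y (1 + a) ht).trans (ENNReal.ofReal_le_ofReal ?_)
      have := hfar y a (by linarith) hle
      exact le_max_of_le_right (by linarith)
  refine hle.trans_lt ?_
  rw [hf.entropy_eq hfin, ENNReal.ofReal_lt_ofReal_iff hpos]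
  refine max_lt ?_ (by linarith)
  nlinarith

end Instability

/-! ### Low dimensions; averaging over coordinate fields. -/

section Destabilizing

variable {m n : ℕ}

/-- A solution of finite entropy on a space of dimension at most one has no energy. -/
lemma IsSoliton.gaussEnergy_nonpos_of_le_one {f : Euc m → Sph n} (hf : IsSoliton f)
    (hfin : entropy f ≠ ⊤) (hm : m ≤ 1) :
    gaussEnergy (energyDensity (ambient f)) 0 1 ≤ 0 := by
  -- For m ≤ 1 the kernel at t = 1 is at most twice the one at t = 4, because 4^(m/2) ≤ 2, while the
  -- prefactor t/2 grows fourfold. So 2F(0,1) ≤ F(0,4) ≤ F(0,1).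
  have h4 := hf.gaussEnergy_le hfin 0 (t := 4) (by norm_num)
  have hle : 2 * gaussEnergy (energyDensity (ambient f)) 0 1 ≤
      gaussEnergy (energyDensity (ambient f)) 0 4 := by
    unfold gaussEnergy
    have h1 : ∫ x, energyDensity (ambient f) x * gauss 0 1 x ≤
        ∫ x, 2 * (energyDensity (ambient f) x * gauss 0 4 x) := by
      refine integral_mono (integrable_energy_gauss hf.1 hfin 0 one_pos)
        ((integrable_energy_gauss hf.1 hfin 0 (by norm_num)).const_mul 2) fun x => ?_
      have hg : gauss 0 1 x ≤ 2 * gauss 0 4 x := by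
        unfold gauss
        have hpi := Real.pi_pos
        have e1 : (4 * Real.pi * 4) ^ ((m : ℝ) / 2) =
            4 ^ ((m : ℝ) / 2) * (4 * Real.pi * 1) ^ ((m : ℝ) / 2) := by
          rw [← Real.mul_rpow (by norm_num) (by positivity)]
          congr 1; ring
        have e2 : (4 : ℝ) ^ ((m : ℝ) / 2) ≤ 2 := by
          have : (4 : ℝ) ^ ((m : ℝ) / 2) ≤ 4 ^ ((1 : ℝ) / 2) := by
            refine Real.rpow_le_rpow_of_exponent_le (by norm_num) ?_
            gcongr
            exact_mod_cast hm
          refine this.trans_eq ?_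
          rw [← Real.sqrt_eq_rpow, show (4 : ℝ) = 2 ^ 2 by norm_num]
          exact Real.sqrt_sq (by norm_num)
        have e3 : Real.exp (-‖x - 0‖ ^ 2 / (4 * 1)) ≤ Real.exp (-‖x - 0‖ ^ 2 / (4 * 4)) := by
          rw [Real.exp_le_exp, div_le_div_iff₀ (by norm_num) (by norm_num)]
          nlinarith [sq_nonneg ‖x - 0‖]
        set A := (4 * Real.pi * 1) ^ ((m : ℝ) / 2) with hA
        have hA0 : 0 < A := by positivity
        rw [e1, mul_div_assoc', div_le_div_iff₀ hA0 (by positivity)]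
        calc _ ≤ Real.exp (-‖x - 0‖ ^ 2 / (4 * 4)) * (2 * A) := by gcongr
          _ = _ := by ring
      have := mul_le_mul_of_nonneg_left hg (energyDensity_nonneg (ambient f) x)
      simp only
      linarith
    rw [integral_const_mul] at h1
    linarith
  linarith

/-- The tangential projection of the `i`-th coordinate vector, multiplied by `η`. -/
def coordinateField (u : Euc m → Euc (n + 1)) (η : Euc m → ℝ) (i : Fin (n + 1)) (x : Euc m) :
    Euc (n + 1) :=
  η x • (EuclideanSpace.single i 1 - u x i • u x)

lemma sum_mul_eq_inner (u d : Euc n) : ∑ i, u i * d i = ⟪u, d⟫_ℝ := by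
  simp [PiLp.inner_apply, mul_comm]

lemma sum_sq_eq_norm_sq (u : Euc n) : ∑ i, u i ^ 2 = ‖u‖ ^ 2 := by
  rw [EuclideanSpace.norm_sq_eq]; simp

lemma norm_coordinate_sq {u d : Euc n} (hu : ‖u‖ = 1) (hd : ⟪u, d⟫_ℝ = 0) (c h : ℝ) (i : Fin n) :
    ‖c • (EuclideanSpace.single i (1 : ℝ) - u i • u) - h • (d i • u + u i • d)‖ ^ 2 =
      c ^ 2 * (1 - u i ^ 2) + h ^ 2 * (d i ^ 2 + u i ^ 2 * ‖d‖ ^ 2) - 2 * c * h * (u i * d i) := by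
  have h1 : ⟪EuclideanSpace.single i (1 : ℝ), u⟫_ℝ = u i := by
    simp [EuclideanSpace.inner_single_left]
  have h2 : ⟪EuclideanSpace.single i (1 : ℝ), d⟫_ℝ = d i := by
    simp [EuclideanSpace.inner_single_left]
  have h3 : ⟪EuclideanSpace.single i (1 : ℝ), EuclideanSpace.single i (1 : ℝ)⟫_ℝ = 1 := by
    simp
  have h4 : ⟪u, u⟫_ℝ = 1 := by rw [real_inner_self_eq_norm_sq, hu]; norm_num
  have h5 : ⟪d, d⟫_ℝ = ‖d‖ ^ 2 := real_inner_self_eq_norm_sq d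
  have h1' : ⟪u, EuclideanSpace.single i (1 : ℝ)⟫_ℝ = u i := by rw [real_inner_comm, h1]
  have h2' : ⟪d, EuclideanSpace.single i (1 : ℝ)⟫_ℝ = d i := by rw [real_inner_comm, h2]
  have hd' : ⟪d, u⟫_ℝ = 0 := by rw [real_inner_comm, hd]
  rw [← real_inner_self_eq_norm_sq]
  simp only [inner_sub_left, inner_sub_right, inner_add_left, inner_add_right, inner_smul_left,
    inner_smul_right, conj_trivial, h1, h2, h3, h4, h5, h1', h2', hd, hd']
  ring

/-- One computation serves both the fields and their derivatives: c and h stand for the derivative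
and value of the cutoff, d for a partial derivative of u. The cross terms sum to ⟨u,d⟩ = 0, and ∑(1
- uᵢ²) = n. -/
lemma sum_norm_coordinate_sq {u d : Euc (n + 1)} (hu : ‖u‖ = 1) (hd : ⟪u, d⟫_ℝ = 0) (c h : ℝ) :
    ∑ i, ‖c • (EuclideanSpace.single i (1 : ℝ) - u i • u) - h • (d i • u + u i • d)‖ ^ 2 =
      n * c ^ 2 + 2 * (h ^ 2 * ‖d‖ ^ 2) := by
  simp only [norm_coordinate_sq hu hd]
  rw [Finset.sum_sub_distrib, Finset.sum_add_distrib, ← Finset.mul_sum, ← Finset.mul_sum,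
    ← Finset.mul_sum, Finset.sum_sub_distrib, Finset.sum_add_distrib, ← Finset.sum_mul,
    sum_sq_eq_norm_sq, sum_sq_eq_norm_sq, sum_mul_eq_inner, hu, hd]
  simp
  ring

lemma isTangentField_coordinateField {f : Euc m → Sph n} (hf : IsSmooth f) {η : Euc m → ℝ}
    (hη : ContDiff ℝ ∞ η) (hc : HasCompactSupport η) (i : Fin (n + 1)) :
    IsTangentField f (coordinateField (ambient f) η i) := by
  have hu := contDiff_ambient hf
  have hui : ContDiff ℝ ∞ (fun x => ambient f x i) := by fun_prop
  refine ⟨hη.smul (contDiff_const.sub (hui.smul hu)), ?_, fun x => ?_⟩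
  · exact HasCompactSupport.intro hc fun x hx => by
      simp [coordinateField, image_eq_zero_of_notMem_tsupport hx]
  · rw [coordinateField, inner_smul_right, inner_sub_right, inner_smul_right,
      real_inner_self_eq_norm_sq, norm_ambient, EuclideanSpace.inner_single_right]
    simp

lemma fderiv_coordinateField {f : Euc m → Sph n} (hf : IsSmooth f) {η : Euc m → ℝ}
    (hη : ContDiff ℝ ∞ η) (i : Fin (n + 1)) (x v : Euc m) :
    fderiv ℝ (coordinateField (ambient f) η i) x v =
      fderiv ℝ η x v • (EuclideanSpace.single i 1 - ambient f x i • ambient f x) -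
      η x • (fderiv ℝ (ambient f) x v i • ambient f x +
        ambient f x i • fderiv ℝ (ambient f) x v) := by
  have hu := contDiff_ambient hf
  have hud := (hu.differentiable (by simp) x).hasFDerivAt
  have hui : HasFDerivAt (fun x => ambient f x i)
      ((EuclideanSpace.proj i : Euc (n + 1) →L[ℝ] ℝ).comp (fderiv ℝ (ambient f) x)) x :=
    (EuclideanSpace.proj i : Euc (n + 1) →L[ℝ] ℝ).hasFDerivAt.comp x hud
  have h := ((hη.differentiable (by simp) x).hasFDerivAt).fun_smul
    ((hui.fun_smul hud).const_sub (EuclideanSpace.single i (1 : ℝ)))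
  unfold coordinateField
  rw [h.fderiv]
  simp only [add_apply, FunLike.coe_smul, Pi.smul_apply, neg_apply,
    ContinuousLinearMap.smulRight_apply, ContinuousLinearMap.comp_apply, PiLp.proj_apply]
  module

lemma sum_norm_coordinateField_sq (f : Euc m → Sph n) (η : Euc m → ℝ) (x : Euc m) :
    ∑ i, ‖coordinateField (ambient f) η i x‖ ^ 2 = n * η x ^ 2 := by
  have := sum_norm_coordinate_sq (norm_ambient f x) (inner_zero_right _) (η x) 0
  simpa [coordinateField] using this

lemma sum_energyDensity_coordinateField {f : Euc m → Sph n} (hf : IsSmooth f) {η : Euc m → ℝ}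
    (hη : ContDiff ℝ ∞ η) (x : Euc m) :
    ∑ i, energyDensity (coordinateField (ambient f) η i) x =
      n * energyDensity η x + 2 * (η x ^ 2 * energyDensity (ambient f) x) := by
  simp only [energyDensity, fderiv_coordinateField hf hη]
  rw [Finset.sum_comm]
  simp only [sum_norm_coordinate_sq (norm_ambient f x) (inner_ambient_fderiv hf x _)]
  simp only [Finset.sum_add_distrib, Finset.mul_sum, Real.norm_eq_abs, sq_abs]

lemma integrable_stabilityForm {f : Euc m → Sph n} (hf : IsSmooth f) {W : Euc m → Euc (n + 1)}
    (hW : IsTangentField f W) : Integrable (fun x => (3 / 4 * ‖W x‖ ^ 2 +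
      2⁻¹ * (energyDensity W x - energyDensity (ambient f) x * ‖W x‖ ^ 2)) * gauss 0 1 x) := by
  refine integrable_mul_gauss_of_compact hW.compact ?_ (fun x hx => ?_) 0 1
  · have h1 := (contDiff_energyDensity hW.smooth).continuous
    have h2 := (contDiff_energyDensity (contDiff_ambient hf)).continuous
    have h3 := hW.smooth.continuous
    fun_prop
  · simp [image_eq_zero_of_notMem_tsupport hx, energyDensity_eq_zero hx]

/-- Here 2η²e from the derivatives meets -nη²e from the curvature term, leaving the factor -(n-2).
For η → 1 the integral tends to 3n/4 - (n-2)F(0,1). -/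
lemma sum_stabilityForm_coordinateField {f : Euc m → Sph n} (hf : IsSmooth f) {η : Euc m → ℝ}
    (hη : ContDiff ℝ ∞ η) (hc : HasCompactSupport η) :
    ∑ i, stabilityForm (ambient f) (coordinateField (ambient f) η i) =
      ∫ x, (3 / 4 * n * η x ^ 2 + n / 2 * energyDensity η x -
        (n - 2) / 2 * (η x ^ 2 * energyDensity (ambient f) x)) * gauss 0 1 x := by
  unfold stabilityForm
  rw [← integral_finsetSum _ fun i _ =>
    integrable_stabilityForm hf (isTangentField_coordinateField hf hη hc i)]
  refine integral_congr_ae (Eventually.of_forall fun x => ?_)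
  simp only
  rw [← Finset.sum_mul, Finset.sum_add_distrib, ← Finset.mul_sum, ← Finset.mul_sum,
    Finset.sum_sub_distrib, ← Finset.mul_sum, sum_norm_coordinateField_sq,
    sum_energyDensity_coordinateField hf hη]
  ring

/-- Above the threshold, some cut off coordinate field destabilizes. -/
lemma exists_stabilityForm_neg (hn : 3 ≤ n) {f : Euc m → Sph n} (hf : IsSmooth f)
    (hfin : entropy f ≠ ⊤)
    (hbig : 3 * (n : ℝ) / (4 * (n - 2)) < gaussEnergy (energyDensity (ambient f)) 0 1) :
    ∃ W, IsTangentField f W ∧ stabilityForm (ambient f) W < 0 := by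
  set e := energyDensity (ambient f) with he
  have hec : Continuous e := (contDiff_energyDensity (contDiff_ambient hf)).continuous
  have hei : Integrable (fun x => e x * gauss 0 1 x) := integrable_energy_gauss hf hfin 0 one_pos
  set I := ∫ x, e x * gauss 0 1 x with hI
  have hn' : (0 : ℝ) < n - 2 := by
    have : (3 : ℝ) ≤ n := by exact_mod_cast hn
    linarith
  have hbig' : 3 / 4 * (n : ℝ) - (n - 2) / 2 * I < 0 := by
    rw [gaussEnergy, div_lt_iff₀ (by positivity), ← hI] at hbig
    linarith
  obtain ⟨C, hC0, hC⟩ := exists_norm_fderiv_cutoff_le m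
  have hG := continuous_gauss (0 : Euc m) 1
  have hG0 : ∀ x : Euc m, 0 < gauss 0 1 x := gauss_pos 0 one_pos
  have hle : ∀ k : ℕ, 0 < k → ∑ i, stabilityForm (ambient f)
      (coordinateField (ambient f) (cutoff m k) i) ≤ 3 / 4 * n + n / 2 * (m * (C / k) ^ 2) -
        (n - 2) / 2 * ∫ x, cutoff m k x ^ 2 * e x * gauss 0 1 x := by
    intro k hk
    have hk' : (0 : ℝ) < k := by exact_mod_cast hk
    have hχ := (contDiff_cutoff (m := m) k)
    have hχc := hχ.continuous
    have hχs : HasCompactSupport (cutoff m (k : ℝ)) := hasCompactSupport_cutoff hk'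
    have hi : Integrable (fun x => cutoff m k x ^ 2 * e x * gauss 0 1 x) :=
      integrable_of_eq_zero_off_tsupport hχs (by fun_prop) fun x hx => by
        simp [image_eq_zero_of_notMem_tsupport hx]
    rw [sum_stabilityForm_coordinateField hf hχ hχs]
    have hconst : 3 / 4 * (n : ℝ) + n / 2 * (m * (C / k) ^ 2) =
        ∫ x : Euc m, (3 / 4 * (n : ℝ) + n / 2 * (m * (C / k) ^ 2)) * gauss 0 1 x := by
      rw [integral_const_mul, integral_gauss 0 one_pos, mul_one]
    rw [hconst, ← integral_const_mul,
      ← integral_sub ((integrable_gauss 0 one_pos).const_mul _) (hi.const_mul _)]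
    refine integral_mono ?_ (((integrable_gauss 0 one_pos).const_mul _).sub (hi.const_mul _))
      fun x => ?_
    · refine integrable_of_eq_zero_off_tsupport hχs ?_ fun x hx => ?_
      · have h1 := (contDiff_energyDensity hχ).continuous
        have h2 : Continuous (energyDensity (ambient f)) := hec
        fun_prop
      · simp [image_eq_zero_of_notMem_tsupport hx, energyDensity,
          fderiv_of_notMem_tsupport (𝕜 := ℝ) hx]
    · have h1 : cutoff m k x ^ 2 ≤ 1 := pow_le_one₀ (cutoff_nonneg _ _) (cutoff_le_one _ _)
      have h2 : energyDensity (cutoff m k) x ≤ m * (C / k) ^ 2 := by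
        have : energyDensity (cutoff m k) x ≤ ∑ _a : Fin m, (C / k) ^ 2 := by
          refine Finset.sum_le_sum fun a _ => pow_le_pow_left₀ (norm_nonneg _) ?_ 2
          refine (ContinuousLinearMap.le_opNorm _ _).trans ?_
          simpa using hC k hk' x
        simpa using this
      have h3 : 3 / 4 * (n : ℝ) * cutoff m k x ^ 2 ≤ 3 / 4 * n :=
        mul_le_of_le_one_right (by positivity) h1
      have h4 : (n : ℝ) / 2 * energyDensity (cutoff m k) x ≤ n / 2 * (m * (C / k) ^ 2) := by
        gcongr
      have h5 := mul_le_mul_of_nonneg_right (add_le_add h3 h4) (hG0 x).le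
      simp only
      linarith
  have hlim1 : Tendsto (fun k : ℕ => ∫ x, cutoff m k x ^ 2 * e x * gauss 0 1 x) atTop (𝓝 I) := by
    refine tendsto_integral_of_dominated_convergence (fun x => e x * gauss 0 1 x) ?_ hei ?_ ?_
    · intro k
      have hχ := (contDiff_cutoff (m := m) k).continuous
      exact Continuous.aestronglyMeasurable (by fun_prop)
    · intro k
      refine Eventually.of_forall fun x => ?_
      have h3 : 0 ≤ e x := energyDensity_nonneg _ _
      have h4 := (hG0 x).le
      rw [Real.norm_of_nonneg (by positivity), mul_assoc]
      exact mul_le_of_le_one_left (by positivity)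
        (pow_le_one₀ (cutoff_nonneg _ _) (cutoff_le_one _ _))
    · refine Eventually.of_forall fun x => tendsto_const_nhds.congr' ?_
      obtain ⟨k₀, hk₀⟩ := exists_nat_gt ‖x‖
      filter_upwards [eventually_ge_atTop k₀] with k hk
      have hk' : (k₀ : ℝ) ≤ k := by exact_mod_cast hk
      rw [cutoff_eq_one ((norm_nonneg x).trans_lt (hk₀.trans_le hk')) (hk₀.le.trans hk'),
        one_pow, one_mul]
  have hlim : Tendsto (fun k : ℕ => 3 / 4 * (n : ℝ) + n / 2 * (m * (C / k) ^ 2) -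
      (n - 2) / 2 * ∫ x, cutoff m k x ^ 2 * e x * gauss 0 1 x) atTop
      (𝓝 (3 / 4 * (n : ℝ) + n / 2 * (m * 0 ^ 2) - (n - 2) / 2 * I)) :=
    (((((tendsto_const_div_atTop_nhds_zero_nat C).pow 2).const_mul _).const_mul _).const_add _).sub
      (hlim1.const_mul _)
  have hev := hlim.eventually_lt_const (u := 0) (by simpa using hbig')
  obtain ⟨k, hk, hk0⟩ := (hev.and (eventually_gt_atTop 0)).exists
  have hneg := (hle k hk0).trans_lt hk
  obtain ⟨i, -, hi⟩ := Finset.exists_lt_of_sum_lt (f := fun i => stabilityForm (ambient f)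
    (coordinateField (ambient f) (cutoff m k) i)) (g := fun _ => (0 : ℝ)) (s := Finset.univ)
    (by simpa using hneg)
  exact ⟨_, isTangentField_coordinateField hf (contDiff_cutoff _)
    (hasCompactSupport_cutoff (by exact_mod_cast hk0)) i, hi⟩

/-- A noncylindrical soliton of large entropy has an entropy decreasing variation. -/
lemma IsSoliton.exists_entropy_variation_lt (hn : 3 ≤ n) {f : Euc m → Sph n} (hf : IsSoliton f)
    (hfin : entropy f ≠ ⊤) (hcyl : ¬ IsCylindrical f)
    (hbig : ENNReal.ofReal (3 * (n : ℝ) / (4 * ((n : ℝ) - 2))) < entropy f) :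
    ∃ (W : Euc m → Euc (n + 1)) (hW : IsTangentField f W),
      ∀ᶠ s in 𝓝[≠] (0 : ℝ), entropy (variation hW s) < entropy f := by
  have hn' : (0 : ℝ) < n - 2 := by
    have : (3 : ℝ) ≤ n := by exact_mod_cast hn
    linarith
  have h0 : (0 : ℝ) ≤ 3 * (n : ℝ) / (4 * ((n : ℝ) - 2)) := by positivity
  rw [hf.entropy_eq hfin, ENNReal.ofReal_lt_ofReal_iff_of_nonneg h0] at hbig
  have hpos := h0.trans_lt hbig
  have hm : 2 ≤ m := by
    by_contra! hm
    exact absurd (hf.gaussEnergy_nonpos_of_le_one hfin (by omega)) (not_le.2 hpos)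
  obtain ⟨W, hW, hq⟩ := exists_stabilityForm_neg hn hf.1 hfin hbig
  exact ⟨W, hW, hf.eventually_entropy_variation_lt hfin hm hcyl hpos hW hq⟩

end Destabilizing

/-! ### Small variations are uniformly close with all derivatives. -/

section UniformlyClose

variable {m n : ℕ}

/-- Derivatives in x alone are restrictions of joint derivatives, hence jointly continuous in (s,x).
-/
lemma iteratedFDeriv_slice {G : Type*} [NormedAddCommGroup G] [NormedSpace ℝ G]
    {h : ℝ × Euc m → G} (hh : ContDiff ℝ ∞ h) (j : ℕ) (s : ℝ) (x : Euc m) :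
    iteratedFDeriv ℝ j (fun y => h (s, y)) x =
      (iteratedFDeriv ℝ j h (s, x)).compContinuousLinearMap
        fun _ => ContinuousLinearMap.inr ℝ ℝ (Euc m) := by
  have h1 : ContDiff ℝ ∞ (fun z : ℝ × Euc m => h (z + (s, 0))) := by fun_prop
  have h2 := (ContinuousLinearMap.inr ℝ ℝ (Euc m)).iteratedFDeriv_comp_right h1 x (i := j)
    (by exact_mod_cast le_top)
  have h3 : (fun z : ℝ × Euc m => h (z + (s, 0))) ∘ ContinuousLinearMap.inr ℝ ℝ (Euc m) =
      fun y => h (s, y) := by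
    ext y; simp
  rw [h3] at h2
  rw [h2, iteratedFDeriv_comp_add_right]
  simp

/-- Off the support of W nothing changes; on this compact set joint continuity at s = 0 gives
uniform smallness, and only finitely many orders are involved. -/
lemma eventually_uniformlyClose_variation {f : Euc m → Sph n} (hf : IsSmooth f)
    {W : Euc m → Euc (n + 1)} (hW : IsTangentField f W) (k : ℕ) {ε : ℝ} (hε : 0 < ε) :
    ∀ᶠ s in 𝓝 (0 : ℝ), UniformlyClose k ε f (variation hW s) := by
  set h : ℝ × Euc m → Euc (n + 1) := fun p => ambient (variation hW p.1) p.2 - ambient f p.2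
    with hh
  have hs : ContDiff ℝ ∞ h := (contDiff_variation_uncurried hf hW).sub
    ((contDiff_ambient hf).comp contDiff_snd)
  have hmain : ∀ j : ℕ, ∀ᶠ s in 𝓝 (0 : ℝ), ∀ x,
      ‖iteratedFDeriv ℝ j (fun y => h (s, y)) x‖ < ε := by
    intro j
    have hcont : Continuous (fun p : ℝ × Euc m => iteratedFDeriv ℝ j (fun y => h (p.1, y)) p.2) := by
      simp only [iteratedFDeriv_slice hs]
      have h1 : Continuous (iteratedFDeriv ℝ j h) :=
        hs.continuous_iteratedFDeriv (by exact_mod_cast le_top)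
      exact (ContinuousMultilinearMap.compContinuousLinearMapL (F := Euc (n + 1)) (𝕜 := ℝ)
        (fun _ : Fin j => ContinuousLinearMap.inr ℝ ℝ (Euc m))).continuous.comp
        (by simpa using h1)
    have hev := hW.compact.eventually_forall_of_forall_eventually (x₀ := (0 : ℝ))
      (P := fun s x => ‖iteratedFDeriv ℝ j (fun y => h (s, y)) x‖ < ε) (fun x _ => by
        refine hcont.norm.continuousAt.eventually_lt continuousAt_const ?_
        have : (fun y => h (0, y)) = fun _ => 0 := by
          ext1 y; simp [hh, variation_zero]
        simp only
        rw [this, iteratedFDeriv_fun_zero]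
        simpa using hε)
    filter_upwards [hev] with s hsx x
    by_cases hx : x ∈ tsupport W
    · exact hsx x hx
    · have hz : (fun y => h (s, y)) =ᶠ[𝓝 x] fun _ => 0 := by
        filter_upwards [(isClosed_tsupport W).isOpen_compl.mem_nhds hx] with y hy
        have := variation_eq_of_eq_zero hW s (image_eq_zero_of_notMem_tsupport hy)
        simp [hh, ambient, this]
      rw [(hz.iteratedFDeriv (𝕜 := ℝ) j).eq_of_nhds, iteratedFDeriv_fun_zero]
      simpa using hε
  have := (Filter.eventually_all_finite (Set.finite_Iic k)).2 fun j _ => hmain j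
  filter_upwards [this] with s hs' j hj x
  exact hs' j hj x

end UniformlyClose

/-! ### Pull-back under an orthogonal projection. -/

section Splitting

variable {m n p q : ℕ}

lemma exists_splitting (Z : Submodule ℝ (Euc m)) :
    ∃ (p q : ℕ) (e : Euc m ≃ₗᵢ[ℝ] WithLp 2 (Euc p × Euc q)), ∀ x, x ∈ Z ↔ (e x).fst = 0 := by
  let e := Zᗮ.orthogonalDecomposition.trans
    (LinearIsometryEquiv.withLpProdCongr 2 (stdOrthonormalBasis ℝ Zᗮ).repr
      (stdOrthonormalBasis ℝ Zᗮᗮ).repr)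
  refine ⟨_, _, e, fun x => ?_⟩
  have h : (e x).fst = (stdOrthonormalBasis ℝ Zᗮ).repr (Zᗮ.orthogonalProjectionOnto x) := by
    simp [e, Submodule.orthogonalDecomposition_apply]
  rw [h, LinearIsometryEquiv.map_eq_zero_iff, Submodule.orthogonalProjectionOnto_eq_zero_iff,
    Submodule.orthogonal_orthogonal]

/-- The first component of an orthogonal splitting. -/
def splitFst (e : Euc m ≃ₗᵢ[ℝ] WithLp 2 (Euc p × Euc q)) : Euc m →L[ℝ] Euc p :=
  (WithLp.fstL 2 ℝ (Euc p) (Euc q)).comp (e : Euc m →L[ℝ] WithLp 2 (Euc p × Euc q))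

/-- The inclusion of the first factor of an orthogonal splitting. -/
def splitInl (e : Euc m ≃ₗᵢ[ℝ] WithLp 2 (Euc p × Euc q)) : Euc p →L[ℝ] Euc m :=
  (e.symm : WithLp 2 (Euc p × Euc q) →L[ℝ] Euc m).comp
    (((WithLp.prodContinuousLinearEquiv 2 ℝ (Euc p) (Euc q)).symm :
      Euc p × Euc q →L[ℝ] WithLp 2 (Euc p × Euc q)).comp
      (ContinuousLinearMap.inl ℝ (Euc p) (Euc q)))

variable (e : Euc m ≃ₗᵢ[ℝ] WithLp 2 (Euc p × Euc q))

lemma splitFst_apply (x : Euc m) : splitFst e x = (e x).fst := rfl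

lemma splitFst_symm (z : Euc p) (w : Euc q) : splitFst e (e.symm (WithLp.toLp 2 (z, w))) = z := by
  simp [splitFst_apply]

lemma splitFst_splitInl (z : Euc p) : splitFst e (splitInl e z) = z := splitFst_symm e z 0

lemma norm_splitFst_le : ‖splitFst e‖ ≤ 1 := by
  refine ContinuousLinearMap.opNorm_le_bound _ zero_le_one fun x => ?_
  rw [one_mul, ← e.norm_map x, splitFst_apply]
  exact WithLp.norm_fst_le _ (e x)

lemma measurePreserving_splitting :
    MeasurePreserving (fun x : Euc m => (WithLp.ofLp (e x) : Euc p × Euc q)) :=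
  (WithLp.volume_preserving_ofLp (Euc p) (Euc q)).comp e.measurePreserving

lemma gauss_splitting (x₀ x : Euc m) {t : ℝ} (ht : 0 < t) :
    gauss x₀ t x = gauss (e x₀).fst t (e x).fst * gauss (e x₀).snd t (e x).snd := by
  have hdim : (m : ℝ) = p + q := by
    have h := e.toLinearEquiv.finrank_eq
    rw [(WithLp.linearEquiv 2 ℝ (Euc p × Euc q)).finrank_eq] at h
    simp at h
    exact_mod_cast h
  have hnorm : ‖x - x₀‖ ^ 2 = ‖(e x).fst - (e x₀).fst‖ ^ 2 + ‖(e x).snd - (e x₀).snd‖ ^ 2 := by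
    rw [← e.norm_map (x - x₀), WithLp.prod_norm_sq_eq_of_L2, map_sub]
    simp
  unfold gauss
  rw [hnorm, hdim, add_div, Real.rpow_add (by positivity), div_mul_div_comm, ← Real.exp_add]
  congr 2
  ring

/-- The orthonormal basis adapted to a splitting. -/
def splitBasis : OrthonormalBasis (Fin p ⊕ Fin q) ℝ (Euc m) :=
  ((EuclideanSpace.basisFun (Fin p) ℝ).prod (EuclideanSpace.basisFun (Fin q) ℝ)).map e.symm

lemma splitFst_splitBasis_inl (i : Fin p) :
    splitFst e (splitBasis e (Sum.inl i)) = EuclideanSpace.single i 1 := by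
  simp [splitFst_apply, splitBasis]

lemma splitFst_splitBasis_inr (i : Fin q) : splitFst e (splitBasis e (Sum.inr i)) = 0 := by
  simp [splitFst_apply, splitBasis]

/-- Both sides are the trace of L*L; this permits computing the energy density in a basis adapted to
the splitting. -/
lemma sum_norm_sq_eq_sum_orthonormalBasis {ι : Type*} [Fintype ι] {d : ℕ}
    (b : OrthonormalBasis ι ℝ (Euc m)) (L : Euc m →L[ℝ] Euc d) :
    ∑ a, ‖L (EuclideanSpace.single a 1)‖ ^ 2 = ∑ i, ‖L (b i)‖ ^ 2 := by
  let T : Euc m →ₗ[ℝ] Euc m := ((ContinuousLinearMap.adjoint L).comp L : Euc m →L[ℝ] Euc m)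
  have h := (LinearMap.trace_eq_sum_inner T (EuclideanSpace.basisFun (Fin m) ℝ)).symm.trans
    (LinearMap.trace_eq_sum_inner T b)
  simpa [T, ContinuousLinearMap.adjoint_inner_right] using h

lemma fderiv_comp_splitFst {d : ℕ} {u : Euc p → Euc d} (hu : ContDiff ℝ ∞ u) (x v : Euc m) :
    fderiv ℝ (u ∘ splitFst e) x v = fderiv ℝ u (splitFst e x) (splitFst e v) := by
  rw [fderiv_comp x (hu.differentiable (by simp) _) (splitFst e).differentiableAt]
  simp

lemma energyDensity_comp_splitFst {d : ℕ} {u : Euc p → Euc d} (hu : ContDiff ℝ ∞ u) (x : Euc m) :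
    energyDensity (u ∘ splitFst e) x = energyDensity u (splitFst e x) := by
  unfold energyDensity
  rw [sum_norm_sq_eq_sum_orthonormalBasis (splitBasis e)]
  simp [fderiv_comp_splitFst e hu, splitFst_splitBasis_inl, splitFst_splitBasis_inr]

lemma laplacian_comp_splitFst {d : ℕ} {u : Euc p → Euc d} (hu : ContDiff ℝ ∞ u) (x : Euc m) :
    Laplacian.laplacian (u ∘ splitFst e) x = Laplacian.laplacian u (splitFst e x) := by
  rw [InnerProductSpace.laplacian_eq_iteratedFDeriv_orthonormalBasis _ (splitBasis e),
    InnerProductSpace.laplacian_eq_iteratedFDeriv_orthonormalBasis _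
      (EuclideanSpace.basisFun (Fin p) ℝ)]
  have h := (splitFst e).iteratedFDeriv_comp_right hu x (i := 2) (by norm_cast)
  simp only [h, Fintype.sum_sum_type, ContinuousMultilinearMap.compContinuousLinearMap_apply,
    iteratedFDeriv_two_apply]
  simp [splitFst_splitBasis_inl, splitFst_splitBasis_inr]

variable {g : Euc p → Sph n}

lemma IsSmooth.comp_splitFst (hg : IsSmooth g) : IsSmooth (g ∘ splitFst e) :=
  ContMDiff.comp hg (splitFst e).contDiff.contMDiff

/-- The Gaussian factors over the splitting, and the factor in the invariant directions integrates
to one by Tonelli. -/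
lemma functionalF_comp_splitFst (hg : IsSmooth g) (x₀ : Euc m) {t : ℝ} (ht : 0 < t) :
    functionalF x₀ t (g ∘ splitFst e) = functionalF (splitFst e x₀) t g := by
  rw [functionalF_eq_lintegral, functionalF_eq_lintegral]
  congr 1
  have hE := (contDiff_energyDensity (contDiff_ambient hg)).continuous
  have hone : ∫⁻ b, ENNReal.ofReal (gauss (e x₀).snd t b) = 1 := by
    rw [← ofReal_integral_eq_lintegral_ofReal (integrable_gauss _ ht)
      (Eventually.of_forall fun b => (gauss_pos _ ht b).le), integral_gauss _ ht]
    simp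
  have hm1 : Measurable fun a : Euc p =>
      ENNReal.ofReal (energyDensity (ambient g) a * gauss (splitFst e x₀) t a) :=
    (hE.mul (continuous_gauss _ t)).measurable.ennreal_ofReal
  have hm2 : Measurable fun b : Euc q => ENNReal.ofReal (gauss (e x₀).snd t b) :=
    (continuous_gauss _ t).measurable.ennreal_ofReal
  set F : Euc p × Euc q → ℝ≥0∞ := fun w =>
    ENNReal.ofReal (energyDensity (ambient g) w.1 * gauss (splitFst e x₀) t w.1) *
      ENNReal.ofReal (gauss (e x₀).snd t w.2) with hF
  have hFm : Measurable F := (hm1.comp measurable_fst).mul (hm2.comp measurable_snd)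
  have hsplit : ∀ x, ENNReal.ofReal (energyDensity (ambient (g ∘ splitFst e)) x * gauss x₀ t x) =
      F (WithLp.ofLp (e x)) := by
    intro x
    have h := energyDensity_comp_splitFst e (contDiff_ambient hg) x
    change ENNReal.ofReal (energyDensity (ambient g ∘ splitFst e) x * gauss x₀ t x) = _
    rw [h, gauss_splitting e x₀ x ht, ← mul_assoc, ENNReal.ofReal_mul (mul_nonneg
      (energyDensity_nonneg _ _) (gauss_pos _ ht _).le)]
    rfl
  rw [lintegral_congr hsplit, (measurePreserving_splitting e).lintegral_comp hFm, hF, Measure.volume_eq_prod,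
    lintegral_prod_mul hm1.aemeasurable hm2.aemeasurable, hone, mul_one]

lemma entropy_comp_splitFst (hg : IsSmooth g) : entropy (g ∘ splitFst e) = entropy g := by
  unfold entropy
  apply le_antisymm
  · refine iSup_le fun x₀ => iSup_le fun t => iSup_le fun ht => ?_
    rw [functionalF_comp_splitFst e hg x₀ ht]
    exact functionalF_le_entropy g _ ht
  · refine iSup_le fun z => iSup_le fun t => iSup_le fun ht => ?_
    have h := functionalF_comp_splitFst e hg (splitInl e z) ht
    rw [splitFst_splitInl] at h
    rw [← h]
    exact functionalF_le_entropy _ _ ht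

lemma tension_comp_splitFst (hg : IsSmooth g) (x : Euc m) :
    tension (g ∘ splitFst e) x = tension g (splitFst e x) := by
  have h := laplacian_comp_splitFst e (contDiff_ambient hg) x
  change (ℝ ∙ ambient g (splitFst e x))ᗮ.starProjection
    (Laplacian.laplacian (ambient g ∘ splitFst e) x) = _
  rw [h]
  rfl

lemma isSoliton_of_comp_splitFst (hg : IsSmooth g) (h : IsSoliton (g ∘ splitFst e)) :
    IsSoliton g := by
  refine ⟨hg, fun z => ?_⟩
  have h1 := h.2 (splitInl e z)
  rw [tension_comp_splitFst e hg, splitFst_splitInl] at h1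
  rw [h1]
  change fderiv ℝ (ambient g ∘ splitFst e) _ _ = _
  rw [fderiv_comp_splitFst e (contDiff_ambient hg), map_smul, splitFst_splitInl]

/-- The projection has norm at most one, so derivatives do not grow and the same k and ε serve. -/
lemma UniformlyClose.comp_splitFst {k : ℕ} {ε : ℝ} {g' : Euc p → Sph n} (hg : IsSmooth g)
    (hg' : IsSmooth g') (h : UniformlyClose k ε g g') :
    UniformlyClose k ε (g ∘ splitFst e) (g' ∘ splitFst e) := by
  intro j hj x
  have hs : ContDiff ℝ ∞ (fun y => ambient g' y - ambient g y) :=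
    (contDiff_ambient hg').sub (contDiff_ambient hg)
  have h1 := (splitFst e).iteratedFDeriv_comp_right hs x (i := j) (by exact_mod_cast le_top)
  change ‖iteratedFDeriv ℝ j ((fun y => ambient g' y - ambient g y) ∘ splitFst e) x‖ < ε
  rw [h1]
  refine lt_of_le_of_lt ?_ (h j hj (splitFst e x))
  refine (ContinuousMultilinearMap.norm_compContinuousLinearMap_le _ _).trans ?_
  refine mul_le_of_le_one_right (norm_nonneg _) ?_
  exact Finset.prod_le_one (fun _ _ => norm_nonneg _) fun _ _ => norm_splitFst_le e

end Splitting

/-! ### Reduction to the non-cylindrical case. -/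

section Reduction

variable {m n : ℕ}

/-- The constant directions along which `f` is invariant. -/
def invariantDirections (f : Euc m → Sph n) : Submodule ℝ (Euc m) :=
  ⨅ x, LinearMap.ker (fderiv ℝ (ambient f) x : Euc m →ₗ[ℝ] Euc (n + 1))

lemma mem_invariantDirections {f : Euc m → Sph n} {ζ : Euc m} :
    ζ ∈ invariantDirections f ↔ ∀ x, fderiv ℝ (ambient f) x ζ = 0 := by
  simp [invariantDirections]

lemma apply_add_of_mem_invariantDirections {f : Euc m → Sph n} (hf : IsSmooth f) {ζ : Euc m}
    (hζ : ζ ∈ invariantDirections f) (x : Euc m) : f (x + ζ) = f x := by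
  have hd : ∀ t : ℝ, HasDerivAt (fun t : ℝ => ambient f (x + t • ζ)) 0 t := by
    intro t
    have h1 : HasDerivAt (fun t : ℝ => x + t • ζ) ((1 : ℝ) • ζ) t :=
      ((hasDerivAt_id t).smul_const ζ).const_add x
    have h2 := (((contDiff_ambient hf).differentiable (by simp)
      (x + t • ζ)).hasFDerivAt).comp_hasDerivAt t h1
    rw [one_smul, mem_invariantDirections.1 hζ] at h2
    exact h2
  have h := is_const_of_deriv_eq_zero (fun t => (hd t).differentiableAt) (fun t => (hd t).deriv) 1 0
  apply Subtype.ext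
  simpa [ambient] using h

/-- Every soliton is the pull-back of a non-cylindrical soliton under an orthogonal projection. -/
lemma IsSoliton.exists_eq_comp_splitFst {f : Euc m → Sph n} (hf : IsSoliton f) :
    ∃ (p q : ℕ) (e : Euc m ≃ₗᵢ[ℝ] WithLp 2 (Euc p × Euc q)) (g : Euc p → Sph n),
      f = g ∘ splitFst e ∧ IsSoliton g ∧ ¬ IsCylindrical g := by
  obtain ⟨p, q, e, he⟩ := exists_splitting (invariantDirections f)
  have hg : IsSmooth (f ∘ splitInl e) := ContMDiff.comp hf.1 (splitInl e).contDiff.contMDiff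
  have hfg : f = (f ∘ splitInl e) ∘ splitFst e := by
    funext x
    have hζ : x - splitInl e (splitFst e x) ∈ invariantDirections f := by
      rw [he, ← splitFst_apply, map_sub, splitFst_splitInl, sub_self]
    have := apply_add_of_mem_invariantDirections hf.1 hζ (splitInl e (splitFst e x))
    rwa [add_sub_cancel] at this
  refine ⟨p, q, e, f ∘ splitInl e, hfg, isSoliton_of_comp_splitFst e hg (hfg ▸ hf), ?_⟩
  rintro ⟨ζ, hζ, hζ0⟩
  apply hζ
  -- All invariant directions were split off at once: an invariant direction of the reduced map
  -- would lift to one of f lying in the first factor, which forces it to be zero.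
  have hmem : splitInl e ζ ∈ invariantDirections f := by
    rw [mem_invariantDirections]
    intro x
    have h := fderiv_comp_splitFst e (contDiff_ambient hg) x (splitInl e ζ)
    rw [splitFst_splitInl, hζ0] at h
    have h' : ambient f = ambient (f ∘ splitInl e) ∘ splitFst e := by
      conv_lhs => rw [hfg]
      rfl
    rwa [h']
  rw [he, ← splitFst_apply, splitFst_splitInl] at hmem
  exact hmem

end Reduction

end HarmonicSoliton

end

/-! ### The two stability statements. -/

theorem theorem1p3 (m n : ℕ) (hn : 3 ≤ n)
    (f : HarmonicSoliton.Euc m → HarmonicSoliton.Sph n)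
    (hf : HarmonicSoliton.IsSoliton f)
    (hfin : HarmonicSoliton.entropy f ≠ ⊤) :
    (HarmonicSoliton.IsEntropyStable f →
      HarmonicSoliton.entropy f ≤ ENNReal.ofReal (3 * (n : ℝ) / (4 * ((n : ℝ) - 2)))) ∧
    (¬ HarmonicSoliton.IsCylindrical f → HarmonicSoliton.IsCompactlyEntropyStable f →
      HarmonicSoliton.entropy f ≤ ENNReal.ofReal (3 * (n : ℝ) / (4 * ((n : ℝ) - 2)))) := by
  constructor
  · rintro ⟨k, ε, hε, hmin⟩
    by_contra! hbig
    -- The variation is made on the reduced space and pulled back. The pull-back need not have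
    -- compact support, but it is uniformly close to f, which is what this notion of stability
    -- tests.
    obtain ⟨p, q, e, g, rfl, hg, hcyl⟩ := hf.exists_eq_comp_splitFst
    rw [HarmonicSoliton.entropy_comp_splitFst e hg.1] at hfin hbig hmin
    obtain ⟨W, hW, hlt⟩ := hg.exists_entropy_variation_lt hn hfin hcyl hbig
    have hclose := (HarmonicSoliton.eventually_uniformlyClose_variation hg.1 hW k hε).filter_mono
      (nhdsWithin_le_nhds (s := {0}ᶜ))
    obtain ⟨s, hs, hs'⟩ := (hlt.and hclose).exists
    have hsm := HarmonicSoliton.isSmooth_variation hg.1 hW s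
    have h := hmin _ (hsm.comp_splitFst e) (hs'.comp_splitFst e hg.1 hsm)
    rw [HarmonicSoliton.entropy_comp_splitFst e hsm] at h
    exact absurd hs h.not_gt
  · intro hcyl hmin
    by_contra! hbig
    obtain ⟨W, hW, hlt⟩ := hf.exists_entropy_variation_lt hn hfin hcyl hbig
    -- The entropy drops strictly for every small s ≠ 0, so passing to the punctured neighbourhood
    -- contradicts the local minimum.
    have h := (hmin _ (HarmonicSoliton.isCompactVariation_variation hf.1 hW)).filter_mono
      (nhdsWithin_le_nhds (s := {0}ᶜ))
    obtain ⟨s, hs, hs'⟩ := (hlt.and h).exists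
    simp only [HarmonicSoliton.variation_zero hW] at hs'
    exact absurd hs hs'.not_gt
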